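/- Let $\mathcal V$ be a complete discrete valuation ring of mixed characteristic $(0,p)$ with perfect residue field and uniformizer $\pi$. For a (not necessarily commutative) $\mathcal V$-algebra $B$ with $p$-adic completion $\widehat B$, its weak completion $B^\dagger\subset\widehat B$ is the $\mathcal V$-subalgebra of all sums $\sum_{j\ge 0}P_j(x_1,\dots,x_N)$ with $N\in\mathbb N$, $x_1,\dots,x_N\in B$, where $P_j$ is a non-commutative polynomial in $N$ variables over $\mathcal V$ all of whose coefficients are divisible by $\pi^j$, and $\deg P_j\le c\,(j+1)$ for some real constant $c$ independent of $j$. Let $\mathcal V[\underline t]^\dagger$ be the weak completion of $\mathcal V[t_1,\dots,t_n]$, that is, the ring of functions of the weak formal affine space $\mathbb A^{n\dagger}_{\mathcal V}$. Let $g\colon U^\dagger\to\mathbb A^{n\dagger}_{\mathcal V}$ be a finite étale morphism of smooth weak formal $\mathcal V$-schemes; equivalently, $U^\dagger$ is affine and $A^\dagger:=\Gamma(U^\dagger,\mathcal O_{U^\dagger})$ is a finite étale $\mathcal V[\underline t]^\dagger$-algebra. For $m\in\mathbb N$ let $D^{(m)}_{U^\dagger}\subset \mathrm{End}_{\mathcal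 V}(A^\dagger)$ be the ring of global differential operators of finite order and level $m$ on $U^\dagger$: the free left $A^\dagger$-module with basis the operators $$\underline\partial^{\langle\underline k\rangle_{(m)}}=\prod_{i=1}^n\Big\lfloor \frac{k_i}{p^m}\Big\rfloor!\;\cdot\;\prod_{i=1}^n\frac{\partial_i^{k_i}}{k_i!},\qquad \underline k\in\mathbb N^n,$$ where $\partial_1,\dots,\partial_n$ are the $\mathcal V$-derivations of $A^\dagger$ with $\partial_i(t_j)=\delta_{ij}$. Let $D^{(m)\dagger}_{U^\dagger}$ be the weak completion of the $\mathcal V$-algebra $D^{(m)}_{U^\dagger}$, and $D^\dagger_{U^\dagger}:=\varinjlim_m D^{(m)\dagger}_{U^\dagger}$. Write $D^{(m)}$, $D^{(m)\dagger}$ and $D^{\dagger}$ for the corresponding rings of $\mathbb A^{n\dagger}_{\mathcal V}$. Then for every $m$ there is a unique homomorphism of $\mathcal V$-algebras $\psi_m\colon D^{(m)}\to D^{(m)}_{U^\dagger}$ such that $\psi_m(P)(g^*f)=g^*(P(f))$ for all $P\in D^{(m)}$ and $f\in\mathcal V[\underline t]^\dagger$. The $\psi_m$ induce homomorphisms of $\mathcal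 V$-algebras $D^{(m)\dagger}\to D^{(m)\dagger}_{U^\dagger}$ and $D^\dagger\to D^\dagger_{U^\dagger}$, and the canonical maps $$A^\dagger\otimes_{\mathcal V[\underline t]^\dagger}D^{(m)\dagger}\to D^{(m)\dagger}_{U^\dagger},\qquad D^{(m)\dagger}\otimes_{\mathcal V[\underline t]^\dagger}A^\dagger\to D^{(m)\dagger}_{U^\dagger},$$ $$A^\dagger\otimes_{\mathcal V[\underline t]^\dagger}D^{\dagger}\to D^{\dagger}_{U^\dagger},\qquad D^{\dagger}\otimes_{\mathcal V[\underline t]^\dagger}A^\dagger\to D^{\dagger}_{U^\dagger}$$ given by $a\otimes P\mapsto a\cdot P$ and $P\otimes a\mapsto P\cdot a$, where $P$ is sent to its image on $U^\dagger$, are isomorphisms, for every $m\in\mathbb N$. -/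

import Mathlib

open scoped TensorProduct Nat

/-! ### The `π`-adic completion and the weak completion of a possibly noncommutative algebra -/

section WeakCompletion

variable {V : Type*} [CommRing V] (π : V) (A : Type*) [Ring A] [Algebra V A]

/-- The two-sided ideal `π ^ j A` of the `V`-algebra `A`. -/
def powIdeal (j : ℕ) : Ideal A := Ideal.span {algebraMap V A (π ^ j)}

theorem mem_powIdeal {j : ℕ} {a : A} : a ∈ powIdeal π A j ↔ ∃ b : A, a = π ^ j • b := by
  rw [powIdeal, Ideal.mem_span_singleton']
  constructor
  · rintro ⟨b, rfl⟩
    exact ⟨b, by rw [Algebra.smul_def, Algebra.commutes]⟩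
  · rintro ⟨b, rfl⟩
    exact ⟨b, by rw [Algebra.smul_def, Algebra.commutes]⟩

instance powIdeal_isTwoSided (j : ℕ) : (powIdeal π A j).IsTwoSided := by
  refine ⟨fun {a} b ha => ?_⟩
  rw [mem_powIdeal] at ha ⊢
  obtain ⟨c, rfl⟩ := ha
  exact ⟨c * b, by rw [smul_mul_assoc]⟩

theorem powIdeal_le {i j : ℕ} (h : i ≤ j) : powIdeal π A j ≤ powIdeal π A i := by
  intro a ha
  rw [mem_powIdeal] at ha ⊢
  obtain ⟨b, rfl⟩ := ha
  obtain ⟨k, rfl⟩ := Nat.exists_eq_add_of_le h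
  exact ⟨π ^ k • b, by rw [smul_smul, pow_add]⟩

/-- The `π`-adic completion `lim_j A / π ^ j A`, as a subalgebra of `∏_j A / π ^ j A`. -/
def piCompletion : Subalgebra V (∀ j : ℕ, A ⧸ powIdeal π A j) where
  carrier := {z | ∀ i j (h : i ≤ j), Ideal.Quotient.factor (powIdeal_le π A h) (z j) = z i}
  mul_mem' := by
    intro y z hy hz i j h
    simp only [Pi.mul_apply, map_mul, hy i j h, hz i j h]
  add_mem' := by
    intro y z hy hz i j h
    simp only [Pi.add_apply, map_add, hy i j h, hz i j h]
  algebraMap_mem' := by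
    intro r i j h
    rfl

/-- The canonical map from `A` to its `π`-adic completion. -/
def toPiCompletion : A →ₐ[V] piCompletion π A :=
  (AlgHom.pi fun j => Ideal.Quotient.mkₐ V (powIdeal π A j)).codRestrict (piCompletion π A)
    (fun _ _ _ _ => rfl)

/-- The noncommutative polynomials in `N` variables of degree at most `d`: the `V`-span of the
words of length at most `d`. -/
def polyDegreeLE (V : Type*) [CommRing V] (N : ℕ) (d : ℝ) :
    Submodule V (FreeAlgebra V (Fin N)) :=
  Submodule.span V
    {w | ∃ l : List (Fin N), (l.length : ℝ) ≤ d ∧ w = (l.map (FreeAlgebra.ι V)).prod}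

/-- `z` is weakly generated by `x_1, …, x_N ∈ A`: it is a sum `∑ P_j (x_1, …, x_N)` in the
`π`-adic completion, where `P_j ∈ π ^ j B_N` has degree at most `c (j + 1)`. Modulo `π ^ i` this
sum is the finite sum of its terms with `j < i`. -/
def IsWeaklyGeneratedBy {N : ℕ} (x : Fin N → A) (z : piCompletion π A) : Prop :=
  ∃ (c : ℝ) (P : ℕ → FreeAlgebra V (Fin N)),
    (∀ j : ℕ, P j ∈ polyDegreeLE V N (c * (j + 1))) ∧
    (∀ j : ℕ, P j ∈ powIdeal π (FreeAlgebra V (Fin N)) j) ∧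
    ∀ i, (z : ∀ j, A ⧸ powIdeal π A j) i =
      Ideal.Quotient.mk (powIdeal π A i)
        (∑ j ∈ Finset.range i, FreeAlgebra.lift V x (P j))

variable {A}

theorem polyDegreeLE_mono {N : ℕ} {d e : ℝ} (h : d ≤ e) :
    polyDegreeLE V N d ≤ polyDegreeLE V N e :=
  Submodule.span_mono fun _ ⟨l, hl, hw⟩ => ⟨l, hl.trans h, hw⟩

theorem polyDegreeLE_mul {N : ℕ} {d e : ℝ} {P Q : FreeAlgebra V (Fin N)}
    (hP : P ∈ polyDegreeLE V N d) (hQ : Q ∈ polyDegreeLE V N e) :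
    P * Q ∈ polyDegreeLE V N (d + e) := by
  have h := Submodule.mul_mem_mul hP hQ
  rw [polyDegreeLE, polyDegreeLE, Submodule.span_mul_span] at h
  refine Submodule.span_mono ?_ h
  rintro _ ⟨_, ⟨l, hl, rfl⟩, _, ⟨l', hl', rfl⟩, rfl⟩
  refine ⟨l ++ l', ?_, by simp⟩
  rw [List.length_append]
  push_cast
  linarith

theorem polyDegreeLE_rename {N M : ℕ} (f : Fin N → Fin M) {d : ℝ} {P : FreeAlgebra V (Fin N)}
    (hP : P ∈ polyDegreeLE V N d) :
    FreeAlgebra.lift V (fun i => FreeAlgebra.ι V (f i)) P ∈ polyDegreeLE V M d := by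
  induction hP using Submodule.span_induction with
  | mem w hw =>
    obtain ⟨l, hl, rfl⟩ := hw
    refine Submodule.subset_span ⟨l.map f, by simpa using hl, ?_⟩
    rw [map_list_prod, List.map_map, List.map_map]
    congr 1
    refine List.map_congr_left fun i _ => ?_
    simp
  | zero => rw [map_zero]; exact Submodule.zero_mem _
  | add a b _ _ ha hb => rw [map_add]; exact Submodule.add_mem _ ha hb
  | smul r a _ ha => rw [map_smul]; exact Submodule.smul_mem _ _ ha

theorem map_mem_powIdeal {B : Type*} [Ring B] [Algebra V B] (f : A →ₐ[V] B) {j : ℕ} {a : A}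
    (ha : a ∈ powIdeal π A j) : f a ∈ powIdeal π B j := by
  rw [mem_powIdeal] at ha ⊢
  obtain ⟨b, rfl⟩ := ha
  exact ⟨f b, by rw [map_smul]⟩

theorem mul_mem_powIdeal {i j : ℕ} {a b : A} (ha : a ∈ powIdeal π A i)
    (hb : b ∈ powIdeal π A j) : a * b ∈ powIdeal π A (i + j) := by
  rw [mem_powIdeal] at ha hb ⊢
  obtain ⟨a, rfl⟩ := ha
  obtain ⟨b, rfl⟩ := hb
  exact ⟨a * b, by rw [smul_mul_smul_comm, pow_add]⟩

/-- Two weakly generated elements are weakly generated by the same elements of `A`, with the same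
nonnegative constant. -/
theorem IsWeaklyGeneratedBy.common {N M : ℕ} {x : Fin N → A} {y : Fin M → A}
    {z w : piCompletion π A} (hz : IsWeaklyGeneratedBy π A x z)
    (hw : IsWeaklyGeneratedBy π A y w) :
    ∃ (c : ℝ) (P Q : ℕ → FreeAlgebra V (Fin (N + M))), 0 ≤ c ∧
      (∀ j : ℕ, P j ∈ polyDegreeLE V (N + M) (c * (j + 1))) ∧
      (∀ j : ℕ, P j ∈ powIdeal π (FreeAlgebra V (Fin (N + M))) j) ∧
      (∀ j : ℕ, Q j ∈ polyDegreeLE V (N + M) (c * (j + 1))) ∧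
      (∀ j : ℕ, Q j ∈ powIdeal π (FreeAlgebra V (Fin (N + M))) j) ∧
      (∀ i, (z : ∀ j, A ⧸ powIdeal π A j) i = Ideal.Quotient.mk (powIdeal π A i)
        (∑ j ∈ Finset.range i, FreeAlgebra.lift V (Fin.append x y) (P j))) ∧
      (∀ i, (w : ∀ j, A ⧸ powIdeal π A j) i = Ideal.Quotient.mk (powIdeal π A i)
        (∑ j ∈ Finset.range i, FreeAlgebra.lift V (Fin.append x y) (Q j))) := by
  obtain ⟨c, P, hP1, hP2, hP3⟩ := hz
  obtain ⟨d, Q, hQ1, hQ2, hQ3⟩ := hw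
  have hl : ∀ p : FreeAlgebra V (Fin N), FreeAlgebra.lift V (Fin.append x y)
      (FreeAlgebra.lift V (fun i => FreeAlgebra.ι V (Fin.castAdd M i)) p)
        = FreeAlgebra.lift V x p := by
    intro p
    rw [← AlgHom.comp_apply]
    congr 1
    ext i
    simp
  have hr : ∀ p : FreeAlgebra V (Fin M), FreeAlgebra.lift V (Fin.append x y)
      (FreeAlgebra.lift V (fun i => FreeAlgebra.ι V (Fin.natAdd N i)) p)
        = FreeAlgebra.lift V y p := by
    intro p
    rw [← AlgHom.comp_apply]
    congr 1
    ext i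
    simp
  have hc : c ≤ max 0 (max c d) := (le_max_left _ _).trans (le_max_right _ _)
  have hd : d ≤ max 0 (max c d) := (le_max_right _ _).trans (le_max_right _ _)
  refine ⟨max 0 (max c d),
    fun j => FreeAlgebra.lift V (fun i => FreeAlgebra.ι V (Fin.castAdd M i)) (P j),
    fun j => FreeAlgebra.lift V (fun i => FreeAlgebra.ι V (Fin.natAdd N i)) (Q j),
    le_max_left _ _, fun j => ?_, fun j => map_mem_powIdeal π _ (hP2 j), fun j => ?_,
    fun j => map_mem_powIdeal π _ (hQ2 j), fun i => ?_, fun i => ?_⟩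
  · exact polyDegreeLE_mono (mul_le_mul_of_nonneg_right hc (by positivity))
      (polyDegreeLE_rename _ (hP1 j))
  · exact polyDegreeLE_mono (mul_le_mul_of_nonneg_right hd (by positivity))
      (polyDegreeLE_rename _ (hQ1 j))
  · rw [hP3 i]; simp only [hl]
  · rw [hQ3 i]; simp only [hr]

theorem IsWeaklyGeneratedBy.add {N M : ℕ} {x : Fin N → A} {y : Fin M → A}
    {z w : piCompletion π A} (hz : IsWeaklyGeneratedBy π A x z)
    (hw : IsWeaklyGeneratedBy π A y w) :
    IsWeaklyGeneratedBy π A (Fin.append x y) (z + w) := by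
  obtain ⟨c, P, Q, -, hP1, hP2, hQ1, hQ2, hP3, hQ3⟩ := hz.common π hw
  refine ⟨c, fun j => P j + Q j, fun j => Submodule.add_mem _ (hP1 j) (hQ1 j),
    fun j => Ideal.add_mem _ (hP2 j) (hQ2 j), fun i => ?_⟩
  rw [Subalgebra.coe_add, Pi.add_apply, hP3, hQ3, ← map_add, ← Finset.sum_add_distrib]
  simp only [map_add]

theorem IsWeaklyGeneratedBy.mul {N M : ℕ} {x : Fin N → A} {y : Fin M → A}
    {z w : piCompletion π A} (hz : IsWeaklyGeneratedBy π A x z)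
    (hw : IsWeaklyGeneratedBy π A y w) :
    IsWeaklyGeneratedBy π A (Fin.append x y) (z * w) := by
  obtain ⟨c, P, Q, hc, hP1, hP2, hQ1, hQ2, hP3, hQ3⟩ := hz.common π hw
  refine ⟨2 * c, fun j => ∑ ab ∈ Finset.HasAntidiagonal.antidiagonal j, P ab.1 * Q ab.2,
    fun j => Submodule.sum_mem _ fun ab hab => ?_,
    fun j => Ideal.sum_mem _ fun ab hab => ?_, fun i => ?_⟩
  · rw [Finset.HasAntidiagonal.mem_antidiagonal] at hab
    refine polyDegreeLE_mono ?_ (polyDegreeLE_mul (hP1 ab.1) (hQ1 ab.2))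
    rw [← hab]
    push_cast
    nlinarith [mul_nonneg hc (Nat.cast_nonneg (α := ℝ) ab.1),
      mul_nonneg hc (Nat.cast_nonneg (α := ℝ) ab.2)]
  · rw [Finset.HasAntidiagonal.mem_antidiagonal] at hab
    rw [← hab]
    exact mul_mem_powIdeal π (hP2 ab.1) (hQ2 ab.2)
  · rw [Subalgebra.coe_mul, Pi.mul_apply, hP3, hQ3, ← map_mul, Ideal.Quotient.mk_eq_mk_iff_sub_mem]
    set e := FreeAlgebra.lift V (Fin.append x y)
    have h1 : (∑ j ∈ Finset.range i, e (P j)) * (∑ j ∈ Finset.range i, e (Q j)) =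
        ∑ ab ∈ Finset.range i ×ˢ Finset.range i, e (P ab.1) * e (Q ab.2) := by
      rw [Finset.sum_mul_sum, Finset.sum_product]
    have h2 : ∑ j ∈ Finset.range i, e (∑ ab ∈ Finset.HasAntidiagonal.antidiagonal j, P ab.1 * Q ab.2) =
        ∑ ab ∈ (Finset.range i ×ˢ Finset.range i).filter (fun ab => ab.1 + ab.2 < i),
          e (P ab.1) * e (Q ab.2) := by
      simp only [map_sum, map_mul]
      rw [Finset.sum_sigma']
      refine Finset.sum_bij' (fun s _ => s.2) (fun ab _ => ⟨ab.1 + ab.2, ab⟩) ?_ ?_ ?_ ?_ ?_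
      · rintro ⟨j, a, b⟩ h
        simp only [Finset.mem_sigma, Finset.mem_range, Finset.HasAntidiagonal.mem_antidiagonal] at h
        simp only [Finset.mem_filter, Finset.mem_product, Finset.mem_range]
        omega
      · rintro ⟨a, b⟩ h
        simp only [Finset.mem_filter, Finset.mem_product, Finset.mem_range] at h
        simpa using h.2
      · rintro ⟨j, a, b⟩ h
        simp only [Finset.mem_sigma, Finset.mem_range, Finset.HasAntidiagonal.mem_antidiagonal] at h
        obtain ⟨-, rfl⟩ := h
        rfl
      · rintro ⟨a, b⟩ _
        rfl
      · rintro ⟨j, a, b⟩ _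
        rfl
    rw [h1, h2, ← Finset.sum_filter_add_sum_filter_not (Finset.range i ×ˢ Finset.range i)
      (fun ab => ab.1 + ab.2 < i), add_sub_cancel_left]
    refine Ideal.sum_mem _ fun ab hab => ?_
    simp only [Finset.mem_filter, not_lt] at hab
    exact powIdeal_le π A hab.2
      (mul_mem_powIdeal π (map_mem_powIdeal π e (hP2 _)) (map_mem_powIdeal π e (hQ2 _)))

theorem isWeaklyGeneratedBy_toPiCompletion (a : A) :
    IsWeaklyGeneratedBy π A (fun _ : Fin 1 => a) (toPiCompletion π A a) := by
  refine ⟨1, fun j => if j = 0 then FreeAlgebra.ι V 0 else 0, fun j => ?_, fun j => ?_,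
    fun i => ?_⟩
  · dsimp only
    split_ifs with h
    · subst h
      exact Submodule.subset_span ⟨[0], by simp, by simp⟩
    · exact Submodule.zero_mem _
  · dsimp only
    split_ifs with h
    · subst h
      exact (mem_powIdeal π _).2 ⟨FreeAlgebra.ι V 0, by simp⟩
    · exact Ideal.zero_mem _
  · change Ideal.Quotient.mk (powIdeal π A i) a = _
    rcases Nat.eq_zero_or_pos i with rfl | hi
    · rw [Ideal.Quotient.mk_eq_mk_iff_sub_mem]
      exact (mem_powIdeal π _).2 ⟨_, by rw [pow_zero, one_smul]⟩
    · congr 1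
      simp [apply_ite (FreeAlgebra.lift V (fun _ : Fin 1 => a)), hi]

variable (A)

/-- The weak completion of `A` as a `V`-algebra: the subalgebra of the `π`-adic completion
formed by the elements which are weakly generated by finitely many elements of `A`. -/
def weakCompletion : Subalgebra V (piCompletion π A) where
  carrier := {z | ∃ (N : ℕ) (x : Fin N → A), IsWeaklyGeneratedBy π A x z}
  mul_mem' := by
    rintro y z ⟨N, x, hx⟩ ⟨M, x', hx'⟩
    exact ⟨N + M, Fin.append x x', hx.mul π hx'⟩
  add_mem' := by
    rintro y z ⟨N, x, hx⟩ ⟨M, x', hx'⟩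
    exact ⟨N + M, Fin.append x x', hx.add π hx'⟩
  algebraMap_mem' := by
    intro r
    refine ⟨1, fun _ => algebraMap V A r, ?_⟩
    rw [← AlgHom.commutes (toPiCompletion π A)]
    exact isWeaklyGeneratedBy_toPiCompletion π _

/-- The weak completion `A^†`. -/
def WeakCompletion : Type _ := weakCompletion π A

instance : Ring (WeakCompletion π A) := inferInstanceAs (Ring (weakCompletion π A))

instance : Algebra V (WeakCompletion π A) := inferInstanceAs (Algebra V (weakCompletion π A))

/-- The canonical map `A → A^†`. -/
def toWeakCompletion : A →ₐ[V] WeakCompletion π A :=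
  (toPiCompletion π A).codRestrict (weakCompletion π A)
    (fun a => ⟨1, fun _ => a, isWeaklyGeneratedBy_toPiCompletion π a⟩)

variable {A} {B C : Type*} [Ring B] [Algebra V B] [Ring C] [Algebra V C]

/-- The map `A / π ^ j A → B / π ^ j B` induced by an algebra homomorphism `A → B`. -/
def powQuotientMap (f : A →ₐ[V] B) (j : ℕ) : (A ⧸ powIdeal π A j) →ₐ[V] (B ⧸ powIdeal π B j) :=
  Ideal.Quotient.liftₐ (powIdeal π A j) ((Ideal.Quotient.mkₐ V (powIdeal π B j)).comp f)
    (fun _ ha => Ideal.Quotient.eq_zero_iff_mem.2 (map_mem_powIdeal π f ha))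

/-- Functoriality of the `π`-adic completion. -/
def piCompletionMap (f : A →ₐ[V] B) : piCompletion π A →ₐ[V] piCompletion π B :=
  ((AlgHom.pi fun j => (powQuotientMap π f j).comp
    (Pi.evalAlgHom V (fun j => A ⧸ powIdeal π A j) j)).comp (piCompletion π A).val).codRestrict
      (piCompletion π B) (by
    rintro ⟨z, hz⟩ i j h
    change Ideal.Quotient.factor _ (powQuotientMap π f j (z j)) = powQuotientMap π f i (z i)
    rw [← hz i j h]
    obtain ⟨a, ha⟩ := Ideal.Quotient.mk_surjective (z j)
    rw [← ha]
    rfl)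

theorem IsWeaklyGeneratedBy.map (f : A →ₐ[V] B) {N : ℕ} {x : Fin N → A} {z : piCompletion π A}
    (h : IsWeaklyGeneratedBy π A x z) :
    IsWeaklyGeneratedBy π B (fun i => f (x i)) (piCompletionMap π f z) := by
  obtain ⟨c, P, h1, h2, h3⟩ := h
  refine ⟨c, P, h1, h2, fun i => ?_⟩
  change powQuotientMap π f i ((z : ∀ j, A ⧸ powIdeal π A j) i) = _
  rw [h3 i]
  change Ideal.Quotient.mk _ (f _) = _
  rw [map_sum]
  congr 1
  refine Finset.sum_congr rfl fun j _ => ?_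
  rw [← AlgHom.comp_apply]
  congr 1
  ext i
  simp

/-- Functoriality of the weak completion. -/
def weakCompletionMap (f : A →ₐ[V] B) : WeakCompletion π A →ₐ[V] WeakCompletion π B :=
  ((piCompletionMap π f).comp (weakCompletion π A).val).codRestrict (weakCompletion π B) (by
    rintro ⟨z, N, x, hx⟩
    exact ⟨N, fun i => f (x i), hx.map π f⟩)

theorem weakCompletionMap_id (z : WeakCompletion π A) :
    weakCompletionMap π (AlgHom.id V A) z = z := by
  refine Subtype.ext (Subtype.ext (funext fun j => ?_))
  change powQuotientMap π (AlgHom.id V A) j (z.1.1 j) = z.1.1 j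
  obtain ⟨a, ha⟩ := Ideal.Quotient.mk_surjective (z.1.1 j)
  rw [← ha]
  rfl

theorem weakCompletionMap_comp (g : B →ₐ[V] C) (f : A →ₐ[V] B) (z : WeakCompletion π A) :
    weakCompletionMap π g (weakCompletionMap π f z) = weakCompletionMap π (g.comp f) z := by
  refine Subtype.ext (Subtype.ext (funext fun j => ?_))
  change powQuotientMap π g j (powQuotientMap π f j (z.1.1 j)) =
    powQuotientMap π (g.comp f) j (z.1.1 j)
  obtain ⟨a, ha⟩ := Ideal.Quotient.mk_surjective (z.1.1 j)
  rw [← ha]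
  rfl

end WeakCompletion

/-- The weak completion of a commutative algebra is commutative. -/
instance weakCompletionCommRing {V : Type*} [CommRing V] (π : V) (A : Type*) [CommRing A]
    [Algebra V A] : CommRing (WeakCompletion π A) :=
  { (inferInstance : Ring (WeakCompletion π A)) with
    mul_comm := by
      intro x y
      refine Subtype.ext (Subtype.ext (funext fun j => ?_))
      change x.1.1 j * y.1.1 j = y.1.1 j * x.1.1 j
      exact mul_comm (G := A ⧸ powIdeal π A j) _ _ }

/-- The ring `V[t_1, …, t_n]^†` of functions on the weak formal affine space. -/
abbrev DagPolynomial {V : Type*} [CommRing V] (π : V) (n : ℕ) : Type _ :=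
  WeakCompletion π (MvPolynomial (Fin n) V)

/-- The coordinates `t_1, …, t_n` of the weak formal affine space. -/
noncomputable def dagCoord {V : Type*} [CommRing V] (π : V) (n : ℕ) (i : Fin n) :
    DagPolynomial π n :=
  toWeakCompletion π (MvPolynomial (Fin n) V) (MvPolynomial.X i)

/-! ### Differential operators of finite level -/

section DiffOp

variable (V : Type*) [CommRing V] {A : Type*} [CommRing A] [Algebra V A] {n : ℕ}

/-- `H` is the operator `∂^[k] = ∂_1 ^ k_1 ⋯ ∂_n ^ k_n / (k_1! ⋯ k_n!)` on `A`, where the `∂_i` are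
the derivations dual to the coordinates `t_i`. (The algebras below have no `V`-torsion and are
étale over `V[t]^†`, so the `∂_i` and `H` are unique.) -/
def IsDividedPartial (t : Fin n → A) (k : Fin n → ℕ) (H : Module.End V A) : Prop :=
  ∃ D : Fin n → Derivation V A A, (∀ i j, D i (t j) = if i = j then 1 else 0) ∧
    (∏ i, (k i)!) • H = (List.ofFn fun i => (D i : Module.End V A) ^ k i).prod

/-- The integer `q_1! ⋯ q_n!`, where `k_i = p ^ m q_i + r_i` with `0 ≤ r_i < p ^ m`. -/
def levelFactor (p m : ℕ) (k : Fin n → ℕ) : ℕ := ∏ i, (k i / p ^ m)!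

/-- The algebra `D^(m)` of differential operators of finite order and level `m` on `A` with respect
to the coordinates `t`: the `V`-subalgebra of `End_V A` generated by the multiplications by elements
of `A` and by the operators `∂^<k>_(m) = q_1! ⋯ q_n! ∂^[k]`, `k ∈ ℕ^n`. Products of these
generators are `A`-linear combinations of the `∂^<k>_(m)`, so that `D^(m)` consists of the finite
sums `∑ a_k ∂^<k>_(m)`: it is the usual ring of level `m`, with its canonical basis. -/
def diffOp (p m : ℕ) (t : Fin n → A) : Subalgebra V (Module.End V A) :=
  Algebra.adjoin V (Set.range (Algebra.lmul V A) ∪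
    {P | ∃ k H, IsDividedPartial V t k H ∧ P = levelFactor p m k • H})

variable {V}

theorem diffOp_mono (p : ℕ) (t : Fin n → A) {m m' : ℕ} (hp : 0 < p) (h : m ≤ m') :
    diffOp V p m t ≤ diffOp V p m' t := by
  refine Algebra.adjoin_le ?_
  rintro P (hP | ⟨k, H, hH, rfl⟩)
  · exact Algebra.subset_adjoin (Or.inl hP)
  · have hdvd : levelFactor p m' k ∣ levelFactor p m k :=
      Finset.prod_dvd_prod_of_dvd _ _ fun i _ => Nat.factorial_dvd_factorial
        (Nat.div_le_div_left (Nat.pow_le_pow_right hp h) (Nat.pow_pos hp))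
    obtain ⟨c, hc⟩ := hdvd
    rw [hc, mul_comm, mul_smul]
    exact nsmul_mem (show levelFactor p m' k • H ∈ diffOp V p m' t from
      Algebra.subset_adjoin (Or.inr ⟨k, H, hH, rfl⟩)) c

variable (V) in
/-- The embedding of `A` in `D^(m)`. -/
def funToDiffOp (p m : ℕ) (t : Fin n → A) : A →ₐ[V] diffOp V p m t :=
  (Algebra.lmul V A).codRestrict (diffOp V p m t)
    (fun a => Algebra.subset_adjoin (Or.inl ⟨a, rfl⟩))

variable (π : V) (p : ℕ) [Fact p.Prime] (t : Fin n → A)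

/-- `D^(m)†`, the weak completion of `D^(m)` as a `V`-algebra. -/
def DagDiffOpLevel (m : ℕ) : Type _ := WeakCompletion π (diffOp V p m t)

instance (m : ℕ) : Ring (DagDiffOpLevel π p t m) :=
  inferInstanceAs (Ring (WeakCompletion π (diffOp V p m t)))

instance (m : ℕ) : Algebra V (DagDiffOpLevel π p t m) :=
  inferInstanceAs (Algebra V (WeakCompletion π (diffOp V p m t)))

/-- The canonical map `A → D^(m)†`. -/
def funToDagLevel (m : ℕ) : A →+* DagDiffOpLevel π p t m :=
  ((toWeakCompletion π (diffOp V p m t)).comp (funToDiffOp V p m t)).toRingHom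

/-- The transition map `D^(m)† → D^(m')†` for `m ≤ m'`, induced by `D^(m) ⊆ D^(m')`. -/
def dagTransition (m m' : ℕ) (h : m ≤ m') :
    DagDiffOpLevel π p t m →ₐ[V] DagDiffOpLevel π p t m' :=
  weakCompletionMap π (Subalgebra.inclusion (diffOp_mono p t (Fact.out : p.Prime).pos h))

instance dagTransition_directed :
    DirectedSystem (DagDiffOpLevel π p t) (dagTransition π p t · · ·) where
  map_self m z := by
    have h : Subalgebra.inclusion (le_refl (diffOp V p m t)) = AlgHom.id V _ := by ext; rfl
    have h' : dagTransition π p t m m le_rfl = weakCompletionMap π (AlgHom.id V _) := by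
      rw [dagTransition, h]
    rw [h']
    exact weakCompletionMap_id π z
  map_map k j i hij hjk z := by
    have h : (Subalgebra.inclusion (diffOp_mono p t (Fact.out : p.Prime).pos hjk)).comp
        (Subalgebra.inclusion (diffOp_mono p t (Fact.out : p.Prime).pos hij)) =
        Subalgebra.inclusion (diffOp_mono (V := V) p t (Fact.out : p.Prime).pos
          (hij.trans hjk)) := by ext; rfl
    have h' : dagTransition π p t i k (hij.trans hjk) = weakCompletionMap π
        ((Subalgebra.inclusion (diffOp_mono p t (Fact.out : p.Prime).pos hjk)).comp
        (Subalgebra.inclusion (diffOp_mono p t (Fact.out : p.Prime).pos hij))) := by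
      rw [dagTransition, h]
    rw [h']
    exact weakCompletionMap_comp π _ _ z

/-- `D^†`, the direct limit of the `D^(m)†`. -/
abbrev DagDiffOp : Type _ := DirectLimit (DagDiffOpLevel π p t) (dagTransition π p t)

/-- The canonical map `D^(m)† → D^†`. -/
noncomputable def dagOfLevel (m : ℕ) : DagDiffOpLevel π p t m →+* DagDiffOp π p t where
  toFun z := ⟦⟨m, z⟩⟧
  map_one' := (DirectLimit.one_def m).symm
  map_mul' x y := (DirectLimit.mul_def m x y).symm
  map_zero' := (DirectLimit.zero_def m).symm
  map_add' x y := (DirectLimit.add_def m x y).symm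

/-- The canonical map `A → D^†`. -/
noncomputable def funToDag : A →+* DagDiffOp π p t := (dagOfLevel π p t 0).comp (funToDagLevel π p t 0)

/-- The map `D^(m)† → D'^(m)†` induced by a homomorphism `D^(m) → D'^(m)`. -/
def dagLevelMap {B : Type*} [CommRing B] [Algebra V B] {n' : ℕ} {u : Fin n' → B} {m : ℕ}
    {t : Fin n → A} (ψ : diffOp V p m t →ₐ[V] diffOp V p m u) :
    DagDiffOpLevel π p t m →+* DagDiffOpLevel π p u m :=
  (weakCompletionMap π ψ).toRingHom

end DiffOp

/-! ### Scalar extension of a ring on the left and on the right -/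

section Extension

variable {R S : Type*} [CommRing R] [Ring S]

/-- The ring `S` as an `R`-module through left multiplication. -/
def LeftMul (_ι : R →+* S) : Type _ := S

/-- The ring `S` as an `R`-module through right multiplication. -/
def RightMul (_ι : R →+* S) : Type _ := S

variable (ι : R →+* S)

instance : AddCommGroup (LeftMul ι) := inferInstanceAs (AddCommGroup S)

instance : AddCommGroup (RightMul ι) := inferInstanceAs (AddCommGroup S)

instance : Module R (LeftMul ι) := Module.compHom S ι

instance : Module R (RightMul ι) where
  smul r s := (show S from s) * ι r
  one_smul s := by change (show S from s) * ι 1 = s; rw [map_one, mul_one]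
  mul_smul r r' s := by
    change (show S from s) * ι (r * r') = (show S from s) * ι r' * ι r
    rw [mul_comm r r', map_mul, mul_assoc]
  smul_zero r := zero_mul (ι r)
  smul_add r x y := add_mul (show S from x) (show S from y) (ι r)
  add_smul r r' s := by
    change (show S from s) * ι (r + r') = (show S from s) * ι r + (show S from s) * ι r'
    rw [map_add, mul_add]
  zero_smul s := by change (show S from s) * ι 0 = (0 : S); rw [map_zero, mul_zero]

variable {A T : Type*} [CommRing A] [Algebra R A] [Ring T]

/-- The map `A ⊗_R S → T`, `a ⊗ s ↦ α a * ψ s`, is well defined and an isomorphism, where `S` is an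
`R`-module by left multiplication. (It is then `A`-linear for left multiplication by `A`.) -/
def IsLeftExtensionIso (α : A →+* T) (ψ : S →+* T) : Prop :=
  ∃ θ : A ⊗[R] LeftMul ι ≃+ T, ∀ (a : A) (s : S), θ (a ⊗ₜ[R] (show LeftMul ι from s)) = α a * ψ s

/-- The map `S ⊗_R A → T`, `s ⊗ a ↦ ψ s * α a`, is well defined and an isomorphism, where `S` is an
`R`-module by right multiplication. (It is then `A`-linear for right multiplication by `A`.) -/
def IsRightExtensionIso (α : A →+* T) (ψ : S →+* T) : Prop :=
  ∃ θ : RightMul ι ⊗[R] A ≃+ T, ∀ (s : S) (a : A), θ ((show RightMul ι from s) ⊗ₜ[R] a) = ψ s * α a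

end Extension

/-- `ψ` extends differential operators from `R` to the `R`-algebra `A`: the operator `ψ P` on `A`
induces `P` on `R`. -/
def ExtendsOperators {V R A : Type*} [CommRing V] [CommRing R] [CommRing A] [Algebra V R]
    [Algebra V A] [Algebra R A] {n n' : ℕ} {p m : ℕ} {t : Fin n → R} {u : Fin n' → A}
    (ψ : diffOp V p m t →ₐ[V] diffOp V p m u) : Prop :=
  ∀ (P : diffOp V p m t) (f : R),
    (ψ P : Module.End V A) (algebraMap R A f) = algebraMap R A ((P : Module.End V R) f)

/-- The coordinates on `A` which are the images of the coordinates of the weak formal affine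
space. -/
noncomputable def etaleCoord {V : Type*} [CommRing V] (π : V) (n : ℕ) (A : Type*) [CommRing A]
    [Algebra (DagPolynomial π n) A] (i : Fin n) : A :=
  algebraMap (DagPolynomial π n) A (dagCoord π n i)

/-! ### Powers of finitely generated submodules and noncommutative polynomials -/

section Growth

variable {V : Type*} [CommRing V] {B : Type*} [Ring B] [Algebra V B]

/-! Write `R` for the ring of functions of the weak formal affine space. A finite étale `R`-algebra
`A` is a finite projective module, so it has a dual basis: `a = ∑ e' i a • e i` with `e' i : A → R`
linear. Applying `e' i` to the coefficients of a differential operator of finite order on `A` gives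
`V`-linear maps `E i` from the level `m` ring of `A` to that of `R`, with `E i (a ψ(P)) = e' i (a)
P` and `b = ∑ e i ψ(E i b)`. If the `E i` extend to the weak completions, the two identities persist
modulo every `π ^ j`, and `z ↦ ∑ e i ⊗ E i z` inverts the canonical map. The other side is the
mirror image. No flatness or noetherian property of the completed rings is needed.

A `V`-linear map extends to weak completions as soon as it sends words of length `d` in finitely
many elements to expressions of degree `O(d + 1)` in finitely many elements
(`HasLinearGrowth.exists_extension`). The map `E i` has this property because it is linear over the
smaller operator ring: the matrices `(E i (b e j))` depend multiplicatively on `b`, so a word of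
length `d` becomes a product of `d` matrices with entries in a fixed finitely generated module
(`hasLinearGrowth_of_matrix`). The same criterion, with Toeplitz matrices, extends the divided
powers of the partial derivatives from polynomials to `R`.

It remains to know the operators of finite order. Formal smoothness lifts the divided powers from
`R` to `A`. A derivation of `A` which kills the coordinates vanishes, by unramifiedness and `π`-adic
separatedness. Hence the lifts are the divided powers of commuting derivations
(`DagPolynomial.exists_hasseCoordinates`). Legendre's formula shows that products of the `∂^<k>` are
`V`-multiples of the `∂^<k + l>`, and the Leibniz rule moves functions to either side; this gives
the spanning statements. Repeated commutators with the coordinates give independence, even after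
restriction to a subalgebra containing the coordinates (`eq_zero_of_commutator`). So an operator on
`A` is determined by its values on the image of `R`, which gives existence and uniqueness of `ψ` and
the compatibility between levels. The statement for `D^†` follows since tensor products commute with
direct limits. -/

theorem Submodule.pow_le_pow_of_one_mem {W : Submodule V B} (h1 : (1 : B) ∈ W) {m n : ℕ}
    (h : m ≤ n) : W ^ m ≤ W ^ n := by
  induction h with
  | refl => exact le_rfl
  | step _ ih =>
    refine ih.trans fun x hx => ?_
    rw [Submodule.pow_succ]
    simpa using Submodule.mul_mem_mul hx h1

theorem Submodule.mul_mem_pow_add {W : Submodule V B} {m n : ℕ} {x y : B} (hx : x ∈ W ^ m)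
    (hy : y ∈ W ^ n) : x * y ∈ W ^ (m + n) := by
  rw [pow_add]
  exact Submodule.mul_mem_mul hx hy

/-- Adjoining `1` to the generators pads shorter words to length exactly `d`, so that a degree bound
becomes membership in a single power. -/
theorem lift_mem_pow {N d : ℕ} (x : Fin N → B) {P : FreeAlgebra V (Fin N)}
    (hP : P ∈ polyDegreeLE V N d) :
    FreeAlgebra.lift V x P ∈ Submodule.span V (insert 1 (Set.range x)) ^ d := by
  have h1 : (1 : B) ∈ Submodule.span V (insert 1 (Set.range x)) :=
    Submodule.subset_span (Set.mem_insert _ _)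
  induction hP using Submodule.span_induction with
  | mem w hw =>
    obtain ⟨l, hl, rfl⟩ := hw
    refine Submodule.pow_le_pow_of_one_mem h1 (Nat.cast_le.1 hl) ?_
    clear hl
    induction l with
    | nil => simpa using ⟨1, map_one _⟩
    | cons i l ih =>
      rw [List.map_cons, List.prod_cons, map_mul, List.length_cons, add_comm]
      refine Submodule.mul_mem_pow_add ?_ ih
      rw [pow_one, FreeAlgebra.lift_ι_apply]
      exact Submodule.subset_span (Set.mem_insert_of_mem _ ⟨i, rfl⟩)
  | zero => rw [map_zero]; exact Submodule.zero_mem _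
  | add a b _ _ ha hb => rw [map_add]; exact Submodule.add_mem _ ha hb
  | smul r a _ ha => rw [map_smul]; exact Submodule.smul_mem _ _ ha

/-- The span of the `x i` is the image of the linear forms, and an algebra homomorphism carries
powers of a submodule to powers of its image. -/
theorem exists_lift_eq_of_mem_pow {N d : ℕ} (x : Fin N → B) {b : B}
    (hb : b ∈ Submodule.span V (Set.range x) ^ d) :
    ∃ P ∈ polyDegreeLE V N d, FreeAlgebra.lift V x P = b := by
  have h : Submodule.span V (Set.range x) = (Submodule.span V
      (Set.range (FreeAlgebra.ι V : Fin N → _))).map (FreeAlgebra.lift V x).toLinearMap := by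
    rw [Submodule.map_span, ← Set.range_comp]
    congr 2
    ext i
    simp
  rw [h, ← Submodule.map_pow] at hb
  obtain ⟨P, hP, rfl⟩ := hb
  refine ⟨P, ?_, rfl⟩
  clear h
  induction d generalizing P with
  | zero =>
    rw [SetLike.mem_coe, pow_zero, Submodule.mem_one] at hP
    obtain ⟨r, rfl⟩ := hP
    rw [Algebra.algebraMap_eq_smul_one]
    exact Submodule.smul_mem _ _ (Submodule.subset_span ⟨[], by simp, by simp⟩)
  | succ d ih =>
    rw [SetLike.mem_coe, Submodule.pow_succ] at hP
    induction hP using Submodule.mul_induction_on' with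
    | mem_mul_mem a ha b hb =>
      push_cast
      refine polyDegreeLE_mul (ih _ ha) (Submodule.span_mono ?_ hb)
      rintro _ ⟨i, rfl⟩
      exact ⟨[i], by simp, by simp⟩
    | add a _ b _ ha hb => exact Submodule.add_mem _ ha hb

/-- A quotient of `P` by `π ^ j` may have larger degree. Truncation to words of length at most `d`
is `V`-linear and fixes `P`, so truncating the quotient repairs this, without any cancellation of
`π`. -/
theorem exists_eq_smul_of_mem_powIdeal (π : V) {N j : ℕ} {d : ℝ} {P : FreeAlgebra V (Fin N)}
    (hP : P ∈ polyDegreeLE V N d) (hj : P ∈ powIdeal π (FreeAlgebra V (Fin N)) j) :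
    ∃ Q ∈ polyDegreeLE V N d, P = π ^ j • Q := by
  classical
  obtain ⟨Q, rfl⟩ := (mem_powIdeal π _).1 hj
  let b := FreeAlgebra.basisFreeMonoid V (Fin N)
  have hb : ∀ w, b w = ((FreeMonoid.toList w).map (FreeAlgebra.ι V)).prod := by
    intro w
    change (FreeAlgebra.equivMonoidAlgebraFreeMonoid (R := V) (X := Fin N)).symm
      (MonoidAlgebra.single w 1) = _
    simp [FreeAlgebra.equivMonoidAlgebraFreeMonoid, FreeMonoid.lift_apply]
  let τ : FreeAlgebra V (Fin N) →ₗ[V] FreeAlgebra V (Fin N) :=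
    b.constr V fun w => if ((FreeMonoid.toList w).length : ℝ) ≤ d then b w else 0
  have hτ : ∀ P ∈ polyDegreeLE V N d, τ P = P := by
    intro P hP
    induction hP using Submodule.span_induction with
    | mem w hw =>
      obtain ⟨l, hl, rfl⟩ := hw
      have := hb (FreeMonoid.ofList l)
      rw [FreeMonoid.toList_ofList] at this
      rw [← this, Module.Basis.constr_basis, FreeMonoid.toList_ofList, if_pos hl]
    | zero => rw [map_zero]
    | add a b _ _ ha hb => rw [map_add, ha, hb]
    | smul r a _ ha => rw [map_smul, ha]
  have hτ' : ∀ P, τ P ∈ polyDegreeLE V N d := by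
    intro P
    induction b.mem_span P using Submodule.span_induction with
    | zero => rw [map_zero]; exact Submodule.zero_mem _
    | mem x hx =>
      obtain ⟨w, rfl⟩ := hx
      rw [Module.Basis.constr_basis]
      split_ifs with h
      · exact Submodule.subset_span ⟨_, h, hb w⟩
      · exact Submodule.zero_mem _
    | smul c x _ h => rw [map_smul]; exact Submodule.smul_mem _ _ h
    | add x y _ _ hx hy => rw [map_add]; exact Submodule.add_mem _ hx hy
  exact ⟨τ Q, hτ' Q, by rw [← map_smul, hτ _ hP]⟩

end Growth

/-! ### Elements of the weak completion as series -/

namespace WeakCompletion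

variable {V : Type*} [CommRing V] (π : V) {B : Type*} [Ring B] [Algebra V B]

/-- The reduction map `B^† → B / π ^ j B`. -/
def residue (j : ℕ) : WeakCompletion π B →+* B ⧸ powIdeal π B j :=
  (Pi.evalRingHom (fun j => B ⧸ powIdeal π B j) j).comp
    ((piCompletion π B).val.toRingHom.comp (weakCompletion π B).val.toRingHom)

variable {π}

theorem ext_residue {z w : WeakCompletion π B} (h : ∀ j, residue π j z = residue π j w) :
    z = w :=
  Subtype.ext (Subtype.ext (funext h))

theorem exists_residue_eq (j : ℕ) (z : WeakCompletion π B) :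
    ∃ b : B, residue π j z = Ideal.Quotient.mk _ b := by
  obtain ⟨b, hb⟩ := Ideal.Quotient.mk_surjective (residue π j z)
  exact ⟨b, hb.symm⟩

theorem residue_toWeakCompletion (j : ℕ) (b : B) :
    residue π j (toWeakCompletion π B b) = Ideal.Quotient.mk _ b := rfl

theorem residue_smul (j : ℕ) (v : V) (z : WeakCompletion π B) :
    residue π j (v • z) = v • residue π j z := rfl

theorem mk_smul (j : ℕ) (v : V) (b : B) :
    v • Ideal.Quotient.mk (powIdeal π B j) b = Ideal.Quotient.mk (powIdeal π B j) (v • b) := rfl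

theorem residue_map {C : Type*} [Ring C] [Algebra V C] (f : B →ₐ[V] C) {j : ℕ}
    {z : WeakCompletion π B} {b : B} (h : residue π j z = Ideal.Quotient.mk _ b) :
    residue π j (weakCompletionMap π f z) = Ideal.Quotient.mk _ (f b) := by
  change powQuotientMap π f j (residue π j z) = _
  rw [h]
  rfl

theorem residue_of_le {i j : ℕ} (hij : i ≤ j) {z : WeakCompletion π B} {b : B}
    (h : residue π j z = Ideal.Quotient.mk _ b) : residue π i z = Ideal.Quotient.mk _ b := by
  have := z.1.2 i j hij
  change Ideal.Quotient.factor _ (residue π j z) = residue π i z at this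
  rw [← this, h]
  rfl

/-- With `exists_of_expansion`, this replaces noncommutative polynomials and real constants by
powers of one finitely generated submodule, the form in which growth of linear maps is measured. -/
theorem exists_expansion (z : WeakCompletion π B) :
    ∃ W : Submodule V B, W.FG ∧ (1 : B) ∈ W ∧ ∃ (c : ℕ) (a : ℕ → B),
      (∀ j, a j ∈ W ^ (c * (j + 1))) ∧
      ∀ i, residue π i z = Ideal.Quotient.mk _ (∑ j ∈ Finset.range i, π ^ j • a j) := by
  obtain ⟨N, x, c, P, h1, h2, h3⟩ := z.2
  have h1' : ∀ j : ℕ, P j ∈ polyDegreeLE V N ((⌈c⌉₊ * (j + 1) : ℕ) : ℝ) := fun j => by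
    refine polyDegreeLE_mono ?_ (h1 j)
    push_cast
    exact mul_le_mul_of_nonneg_right (Nat.le_ceil c) (by positivity)
  choose Q hQ hPQ using fun j => exists_eq_smul_of_mem_powIdeal π (h1' j) (h2 j)
  refine ⟨Submodule.span V (insert 1 (Set.range x)),
    Submodule.fg_span ((Set.finite_range x).insert 1), Submodule.subset_span (Set.mem_insert _ _),
    ⌈c⌉₊, fun j => FreeAlgebra.lift V x (Q j), fun j => lift_mem_pow x (hQ j), fun i => ?_⟩
  refine (h3 i).trans ?_
  congr 1
  refine Finset.sum_congr rfl fun j _ => ?_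
  rw [hPQ j, map_smul]

/-- The element `∑ π ^ j a_j` of the `π`-adic completion. -/
theorem exists_of_expansion {W : Submodule V B} (hW : W.FG) {c : ℕ} {a : ℕ → B}
    (ha : ∀ j, a j ∈ W ^ (c * (j + 1))) :
    ∃ z : WeakCompletion π B,
      ∀ i, residue π i z = Ideal.Quotient.mk _ (∑ j ∈ Finset.range i, π ^ j • a j) := by
  obtain ⟨N, x, rfl⟩ := Submodule.fg_iff_exists_fin_generating_family.1 hW
  choose P hP hPa using fun j => exists_lift_eq_of_mem_pow x (ha j)
  let z : piCompletion π B :=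
    ⟨fun i => Ideal.Quotient.mk _ (∑ j ∈ Finset.range i, π ^ j • a j), by
      intro i j h
      change Ideal.Quotient.mk _ _ = Ideal.Quotient.mk _ _
      rw [Ideal.Quotient.mk_eq_mk_iff_sub_mem, Finset.sum_range_sub_sum_range h]
      refine Ideal.sum_mem _ fun k hk => ?_
      rw [Finset.mem_filter] at hk
      exact powIdeal_le π B hk.2 ((mem_powIdeal π B).2 ⟨_, rfl⟩)⟩
  refine ⟨⟨z, N, x, c, fun j => π ^ j • P j, fun j => ?_, fun j => ?_, fun i => ?_⟩, fun i => rfl⟩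
  · have := hP j
    push_cast at this
    exact Submodule.smul_mem _ _ this
  · exact (mem_powIdeal π _).2 ⟨_, rfl⟩
  · simp only [map_smul, hPa]
    rfl

/-- The tail of a weakly convergent series, divided by `π ^ j`, still converges weakly: since `j + i
+ 1 ≤ (j + 1) * (i + 1)`, the constant `c` only has to be replaced by `c * (j + 1)`. The element `d`
below accounts for the difference between the partial sum and the chosen representative `b`. -/
theorem eq_toWeakCompletion_add {z : WeakCompletion π B} {j : ℕ} {b : B}
    (hz : residue π j z = Ideal.Quotient.mk _ b) :
    ∃ w : WeakCompletion π B, z = toWeakCompletion π B b + π ^ j • w := by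
  obtain ⟨W, hW, h1, c, a, ha, hza⟩ := exists_expansion z
  obtain ⟨w, hw⟩ := exists_of_expansion (π := π) hW (c := c * (j + 1)) (a := fun i => a (j + i))
    fun i => Submodule.pow_le_pow_of_one_mem h1 (by
      rw [mul_assoc]
      exact Nat.mul_le_mul_left c (by ring_nf; nlinarith [Nat.zero_le (j * i)])) (ha (j + i))
  rw [hza j, Ideal.Quotient.mk_eq_mk_iff_sub_mem] at hz
  obtain ⟨d, hd⟩ := (mem_powIdeal π B).1 hz
  refine ⟨w + toWeakCompletion π B d, ext_residue fun i => ?_⟩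
  rw [map_add, residue_smul, map_add, hw, residue_toWeakCompletion, residue_toWeakCompletion,
    ← map_add, mk_smul, ← map_add, hza i, Ideal.Quotient.mk_eq_mk_iff_sub_mem,
    smul_add, ← hd, Finset.smul_sum]
  have hsum : ∑ k ∈ Finset.range i, π ^ j • π ^ k • a (j + k) =
      ∑ k ∈ Finset.range (j + i), π ^ k • a k - ∑ k ∈ Finset.range j, π ^ k • a k := by
    rw [Finset.sum_range_add, add_sub_cancel_left]
    refine Finset.sum_congr rfl fun k _ => ?_
    rw [smul_smul, pow_add]
  rw [hsum]
  have : ∑ k ∈ Finset.range i, π ^ k • a k - (b + (∑ k ∈ Finset.range (j + i), π ^ k • a k -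
      ∑ k ∈ Finset.range j, π ^ k • a k + (∑ k ∈ Finset.range j, π ^ k • a k - b))) =
      -(∑ k ∈ Finset.range (j + i), π ^ k • a k - ∑ k ∈ Finset.range i, π ^ k • a k) := by abel
  rw [this, Finset.sum_range_sub_sum_range (Nat.le_add_left i j)]
  refine neg_mem (Ideal.sum_mem _ fun k hk => ?_)
  rw [Finset.mem_filter] at hk
  exact powIdeal_le π B hk.2 ((mem_powIdeal π B).2 ⟨_, rfl⟩)

theorem residue_smul_pow (j : ℕ) (z : WeakCompletion π B) : residue π j (π ^ j • z) = 0 := by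
  obtain ⟨b, hb⟩ := exists_residue_eq j z
  rw [residue_smul, hb, mk_smul, Ideal.Quotient.eq_zero_iff_mem]
  exact (mem_powIdeal π B).2 ⟨b, rfl⟩

theorem eq_zero_of_forall_smul {z : WeakCompletion π B}
    (h : ∀ j, ∃ w : WeakCompletion π B, z = π ^ j • w) : z = 0 := by
  refine ext_residue fun j => ?_
  obtain ⟨w, rfl⟩ := h j
  rw [residue_smul_pow, map_zero]

/-- Reading `π • z = 0` modulo `π ^ (j + 1)` and cancelling one `π` in `B` gives `z = 0` modulo `π ^
j`. -/
theorem eq_zero_of_smul_eq_zero (hB : ∀ b : B, π • b = 0 → b = 0) {z : WeakCompletion π B}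
    (h : π • z = 0) : z = 0 := by
  refine ext_residue fun j => ?_
  obtain ⟨b, hb⟩ := exists_residue_eq (j + 1) z
  have h2 : residue π (j + 1) (π • z) = 0 := by rw [h, map_zero]
  rw [residue_smul, hb, mk_smul, Ideal.Quotient.eq_zero_iff_mem, mem_powIdeal] at h2
  obtain ⟨d, hd⟩ := h2
  have h3 : b - π ^ j • d = 0 := hB _ (by rw [smul_sub, hd, smul_smul, ← pow_succ', sub_self])
  rw [residue_of_le (Nat.le_succ j) hb, map_zero, Ideal.Quotient.eq_zero_iff_mem, mem_powIdeal]
  exact ⟨d, sub_eq_zero.1 h3⟩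

end WeakCompletion

/-! ### Linear maps of controlled growth extend to weak completions -/

section Growth

variable {V : Type*} [CommRing V] {B C : Type*} [Ring B] [Algebra V B] [Ring C] [Algebra V C]

/-- A linear map has linear growth if it maps the words of length `d` in finitely many elements
of `B` to noncommutative polynomials of degree `O(d + 1)` in finitely many elements of `C`. -/
def HasLinearGrowth (f : B →ₗ[V] C) : Prop :=
  ∀ W : Submodule V B, W.FG → ∃ W' : Submodule V C, W'.FG ∧ (1 : C) ∈ W' ∧
    ∃ c : ℕ, ∀ d, ∀ b ∈ W ^ d, f b ∈ W' ^ (c * (d + 1))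

theorem map_mem_powIdeal_of_linear (π : V) (f : B →ₗ[V] C) {j : ℕ} {b : B}
    (hb : b ∈ powIdeal π B j) : f b ∈ powIdeal π C j := by
  obtain ⟨b, rfl⟩ := (mem_powIdeal π B).1 hb
  exact (mem_powIdeal π C).2 ⟨f b, by rw [map_smul]⟩

/-- Apply `f` termwise to an expansion: from `W ^ (c * (j + 1))` the terms land in `W' ^ (c' * (c *
(j + 1) + 1))`, which lies in `W' ^ (c' * (c + 1) * (j + 1))`. Linearity over `V` makes `f`
compatible with reduction modulo `π ^ j`, so the result does not depend on the expansion, and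
linearity of the extension is checked on residues. -/
theorem HasLinearGrowth.exists_extension (π : V) {f : B →ₗ[V] C} (hf : HasLinearGrowth f) :
    ∃ F : WeakCompletion π B →ₗ[V] WeakCompletion π C, ∀ (j : ℕ) (z : WeakCompletion π B) (b : B),
      WeakCompletion.residue π j z = Ideal.Quotient.mk _ b →
      WeakCompletion.residue π j (F z) = Ideal.Quotient.mk _ (f b) := by
  have h : ∀ z : WeakCompletion π B, ∃ w : WeakCompletion π C, ∀ (j : ℕ) (b : B),
      WeakCompletion.residue π j z = Ideal.Quotient.mk _ b →
      WeakCompletion.residue π j w = Ideal.Quotient.mk _ (f b) := by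
    intro z
    obtain ⟨W, hW, h1, c, a, ha, hza⟩ := WeakCompletion.exists_expansion z
    obtain ⟨W', hW', h1', c', hc'⟩ := hf W hW
    obtain ⟨w, hw⟩ := WeakCompletion.exists_of_expansion (π := π) hW' (c := c' * (c + 1))
      (a := fun j => f (a j)) fun j => Submodule.pow_le_pow_of_one_mem h1' (by
        rw [mul_assoc]
        exact Nat.mul_le_mul_left c' (by ring_nf; omega)) (hc' _ _ (ha j))
    refine ⟨w, fun j b hb => ?_⟩
    have hs : ∑ k ∈ Finset.range j, π ^ k • f (a k) = f (∑ k ∈ Finset.range j, π ^ k • a k) := by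
      simp only [map_sum, map_smul]
    rw [hza j, Ideal.Quotient.mk_eq_mk_iff_sub_mem] at hb
    rw [hw j, hs, Ideal.Quotient.mk_eq_mk_iff_sub_mem, ← map_sub]
    exact map_mem_powIdeal_of_linear π f hb
  choose F hF using h
  refine ⟨⟨⟨F, fun z w => WeakCompletion.ext_residue fun j => ?_⟩,
    fun v z => WeakCompletion.ext_residue fun j => ?_⟩, fun j z => hF z j⟩
  · obtain ⟨a, ha⟩ := WeakCompletion.exists_residue_eq j z
    obtain ⟨b, hb⟩ := WeakCompletion.exists_residue_eq j w
    rw [hF (z + w) j (a + b) (by rw [map_add, map_add, ha, hb]), map_add, map_add, map_add,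
      hF z j a ha, hF w j b hb]
  · obtain ⟨a, ha⟩ := WeakCompletion.exists_residue_eq j z
    rw [hF (v • z) j (v • a) (by rw [WeakCompletion.residue_smul, ha, WeakCompletion.mk_smul]),
      RingHom.id_apply, WeakCompletion.residue_smul, hF z j a ha, WeakCompletion.mk_smul, map_smul]

/-- The matrices `M b` are multiplicative in `b`, so a word of length `d` goes to a product of `d`
matrices whose entries lie in the finitely generated module `W'`. The function `f` is a fixed
bilinear expression `u M v` in these matrices. -/
theorem hasLinearGrowth_of_matrix {I : Type*} [Fintype I] (M : I → I → B →ₗ[V] C)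
    (hM : ∀ i j a b, M i j (a * b) = ∑ k, M i k a * M k j b) (u v : I → C) (f : B →ₗ[V] C)
    (hf : ∀ b, f b = ∑ i, ∑ j, u i * M i j b * v j) : HasLinearGrowth f := by
  intro W hW
  let S : Set C := insert 1 (Set.range u ∪ Set.range v ∪ Set.range fun ij : I × I => M ij.1 ij.2 1)
  let W' : Submodule V C := Submodule.span V S ⊔ ⨆ ij : I × I, W.map (M ij.1 ij.2)
  have hS : ∀ {s}, s ∈ S → s ∈ W' := fun hs =>
    (le_sup_left : _ ≤ W') (Submodule.subset_span hs)
  have h1 : (1 : C) ∈ W' := hS (Set.mem_insert _ _)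
  have hMW : ∀ i j, ∀ b ∈ W, M i j b ∈ W' := fun i j b hb =>
    (le_sup_right : _ ≤ W')
      ((le_iSup (fun ij : I × I => W.map (M ij.1 ij.2)) (i, j)) ⟨b, hb, rfl⟩)
  -- `M 1` need not be the identity matrix (for a projective module it is only idempotent), so its
  -- entries are put into `W'` and the empty word already costs one factor.
  have hpow : ∀ d, ∀ b ∈ W ^ d, ∀ i j, M i j b ∈ W' ^ (d + 1) := by
    intro d
    induction d with
    | zero =>
      intro b hb i j
      rw [pow_zero, Submodule.mem_one] at hb
      obtain ⟨r, rfl⟩ := hb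
      rw [Algebra.algebraMap_eq_smul_one, map_smul, zero_add, pow_one]
      exact Submodule.smul_mem _ _ (hS (Or.inr (Or.inr ⟨(i, j), rfl⟩)))
    | succ d ih =>
      intro b hb
      rw [Submodule.pow_succ] at hb
      induction hb using Submodule.mul_induction_on' with
      | mem_mul_mem a ha b hb =>
        intro i j
        rw [hM]
        refine Submodule.sum_mem _ fun k _ => Submodule.mul_mem_pow_add (ih a ha i k) ?_
        rw [pow_one]
        exact hMW k j b hb
      | add a _ b _ ha hb =>
        intro i j
        rw [map_add]
        exact Submodule.add_mem _ (ha i j) (hb i j)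
  -- The factors `u i` and `v j` contribute one degree each, and `1 + (d + 1) + 1 ≤ 3 * (d + 1)`.
  refine ⟨W', Submodule.FG.sup (Submodule.fg_span ?_) (Submodule.fg_iSup _ fun ij => hW.map _), h1, 3,
    fun d b hb => ?_⟩
  · exact (((Set.finite_range u).union (Set.finite_range v)).union (Set.finite_range _)).insert _
  · rw [hf]
    refine Submodule.sum_mem _ fun i _ => Submodule.sum_mem _ fun j _ => ?_
    have h2 := Submodule.mul_mem_pow_add (Submodule.mul_mem_pow_add
      ((pow_one W').symm ▸ hS (Or.inr (Or.inl (Or.inl ⟨i, rfl⟩))) : u i ∈ W' ^ 1) (hpow d b hb i j))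
      ((pow_one W').symm ▸ hS (Or.inr (Or.inl (Or.inr ⟨j, rfl⟩))) : v j ∈ W' ^ 1)
    exact Submodule.pow_le_pow_of_one_mem h1 (by omega) h2

end Growth

/-! ### Hasse–Schmidt families -/

section HasseSchmidt

variable {V : Type*} [CommRing V] {A : Type*} [CommRing A] [Algebra V A]

/-- The operators `η_0 = id, η_1, …, η_{N-1}` satisfy the Leibniz rule of divided powers of a
derivation. -/
structure IsHasseSchmidt (N : ℕ) (η : ℕ → A →ₗ[V] A) : Prop where
  zero : ∀ a, η 0 a = a
  mul : ∀ k < N, ∀ a b, η k (a * b) = ∑ ij ∈ Finset.HasAntidiagonal.antidiagonal k, η ij.1 a * η ij.2 b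

/-- The first member of a Hasse–Schmidt family is a derivation. -/
def IsHasseSchmidt.derivation {N : ℕ} {η : ℕ → A →ₗ[V] A} (hη : IsHasseSchmidt N η) (hN : 1 < N) :
    Derivation V A A :=
  Derivation.mk' (η 1) fun a b => by
    rw [hη.mul 1 hN]
    simp [Finset.Nat.antidiagonal_succ, hη.zero, mul_comm]

/-- Consider the defect `δ k = (k + 1) η_{k+1} - η_1 η_k`. It satisfies `δ k (a b) = ∑ (δ i a * η j
b + η i a * δ j b)` over `i + j = k`; when the earlier defects vanish, this makes `δ k` a
derivation. It kills the coordinates, hence is zero by `hU`. -/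
theorem IsHasseSchmidt.succ_smul {ι : Type*} {t : ι → A}
    (hU : ∀ E : Derivation V A A, (∀ j, E (t j) = 0) → E = 0) {N : ℕ} {η : ℕ → A →ₗ[V] A}
    (hη : IsHasseSchmidt N η) (ht1 : ∀ j, η 1 (η 1 (t j)) = 0)
    (ht : ∀ k < N, 2 ≤ k → ∀ j, η k (t j) = 0) (k : ℕ) (hk : k + 1 < N) (a : A) :
    (k + 1) • η (k + 1) a = η 1 (η k a) := by
  induction k using Nat.strong_induction_on generalizing a with
  | _ k ih =>
  have hd : ∀ a b, η 1 (a * b) = a * η 1 b + η 1 a * b := fun a b => by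
    rw [hη.mul 1 (by omega)]
    simp [Finset.Nat.antidiagonal_succ, hη.zero]
  let δ : ℕ → A →ₗ[V] A := fun k => (k + 1) • η (k + 1) - η 1 ∘ₗ η k
  have hδ : ∀ k a, δ k a = (k + 1) • η (k + 1) a - η 1 (η k a) := fun _ _ => rfl
  have hδ0 : ∀ i < k, ∀ a, δ i a = 0 := fun i hi a => by
    rw [hδ, ih i hi (by omega), sub_self]
  have hL : ∀ a b, δ k (a * b) = a * δ k b + δ k a * b := by
    intro a b
    -- In the Leibniz formula for `η_{k+1}` the factor `k + 1` is split as `i + j` over pairs with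
    -- `i + j = k + 1`; the terms with zero weight drop out and the rest is reindexed by pairs of
    -- sum `k`.
    have e1 : (k + 1) • η (k + 1) (a * b) =
        ∑ ij ∈ Finset.HasAntidiagonal.antidiagonal k, ((ij.1 + 1) • η (ij.1 + 1) a * η ij.2 b +
          η ij.1 a * ((ij.2 + 1) • η (ij.2 + 1) b)) := by
      rw [hη.mul _ hk, Finset.smul_sum, Finset.sum_add_distrib]
      have h1 := Finset.Nat.sum_antidiagonal_succ (n := k)
        (f := fun ij : ℕ × ℕ => ij.1 • η ij.1 a * η ij.2 b)
      have h2 := Finset.Nat.sum_antidiagonal_succ' (n := k)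
        (f := fun ij : ℕ × ℕ => η ij.1 a * (ij.2 • η ij.2 b))
      simp only [zero_smul, zero_mul, mul_zero, zero_add] at h1 h2
      rw [← h1, ← h2, ← Finset.sum_add_distrib]
      refine Finset.sum_congr rfl fun ij hij => ?_
      rw [Finset.HasAntidiagonal.mem_antidiagonal] at hij
      rw [← hij, add_smul, smul_mul_assoc, mul_smul_comm]
    have e2 : δ k (a * b) = ∑ ij ∈ Finset.HasAntidiagonal.antidiagonal k, (δ ij.1 a * η ij.2 b +
        η ij.1 a * δ ij.2 b) := by
      rw [hδ, e1, hη.mul _ (by omega), map_sum, ← Finset.sum_sub_distrib]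
      refine Finset.sum_congr rfl fun ij _ => ?_
      rw [hd, hδ, hδ]
      ring
    rw [e2, Finset.sum_add_distrib, Finset.sum_eq_single_of_mem (k, 0) (by simp),
      Finset.sum_eq_single_of_mem (0, k) (by simp)]
    · simp only [hη.zero]
      ring
    · rintro ⟨i, j⟩ hij hne
      rw [Finset.HasAntidiagonal.mem_antidiagonal] at hij
      simp only at hij ⊢
      rw [hδ0 j, mul_zero]
      rcases Nat.eq_zero_or_pos i with rfl | hi
      · exact absurd (by simp_all) hne
      · omega
    · rintro ⟨i, j⟩ hij hne
      rw [Finset.HasAntidiagonal.mem_antidiagonal] at hij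
      simp only at hij ⊢
      rw [hδ0 i, zero_mul]
      rcases Nat.eq_zero_or_pos j with rfl | hi
      · exact absurd (by simp_all) hne
      · omega
  have hE := hU (Derivation.mk' (δ k) fun a b => by
    rw [hL, smul_eq_mul, smul_eq_mul, mul_comm (δ k a)]) fun j => by
      change δ k (t j) = 0
      rw [hδ]
      rcases Nat.lt_or_ge k 1 with h0 | h0
      · obtain rfl : k = 0 := by omega
        simp [hη.zero]
      · rw [ht (k + 1) hk (by omega), smul_zero, zero_sub, neg_eq_zero]
        rcases Nat.lt_or_ge k 2 with h2 | h2
        · obtain rfl : k = 1 := by omega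
          exact ht1 j
        · rw [ht k (by omega) h2, map_zero]
  have := DFunLike.congr_fun hE a
  exact sub_eq_zero.1 this

theorem IsHasseSchmidt.factorial_smul {ι : Type*} {t : ι → A}
    (hU : ∀ E : Derivation V A A, (∀ j, E (t j) = 0) → E = 0) {N : ℕ} {η : ℕ → A →ₗ[V] A}
    (hη : IsHasseSchmidt N η) (ht1 : ∀ j, η 1 (η 1 (t j)) = 0)
    (ht : ∀ k < N, 2 ≤ k → ∀ j, η k (t j) = 0) (k : ℕ) (hk : k < N) (a : A) :
    k ! • η k a = ((η 1 : Module.End V A) ^ k) a := by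
  induction k with
  | zero => simp [hη.zero]
  | succ k ih =>
    rw [Nat.factorial_succ, mul_comm, mul_smul, hη.succ_smul hU ht1 ht k hk, ← map_nsmul,
      ih (by omega), pow_succ', Module.End.mul_apply]

/-- A Hasse–Schmidt family as a family of Toeplitz matrices. -/
theorem IsHasseSchmidt.hasLinearGrowth {η : ℕ → A →ₗ[V] A} (hη : ∀ N, IsHasseSchmidt N η) (K : ℕ) :
    HasLinearGrowth (η K) := by
  -- For lower triangular Toeplitz matrices the Leibniz rule is matrix multiplication. The row
  -- vector `u` and the column vector `v` pick out the corner entry in row `K` and column `0`, which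
  -- is `η K`.
  refine hasLinearGrowth_of_matrix (I := Fin (K + 1))
    (fun i j => if j ≤ i then η (i - j) else 0) ?_ (Pi.single (Fin.last K) 1) (Pi.single 0 1) _ ?_
  · intro i j a b
    by_cases hij : j ≤ i
    · rw [if_pos hij, (hη _).mul (i - j) (Nat.lt_succ_self _)]
      symm
      rw [← Finset.sum_filter_of_ne (p := fun k : Fin (K + 1) => j ≤ k ∧ k ≤ i)]
      · refine Finset.sum_bij' (fun k _ => ((i : ℕ) - k, (k : ℕ) - j))
          (fun ab h => ⟨ab.2 + j, by
            rw [Finset.HasAntidiagonal.mem_antidiagonal] at h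
            have := i.2
            have := Fin.le_def.1 hij
            omega⟩) ?_ ?_ ?_ ?_ ?_
        · intro k hk
          simp only [Finset.mem_filter, Fin.le_def] at hk
          rw [Finset.HasAntidiagonal.mem_antidiagonal]
          simp only
          omega
        · intro ab h
          rw [Finset.HasAntidiagonal.mem_antidiagonal] at h
          simp only [Finset.mem_filter, Finset.mem_univ, true_and, Fin.le_def] at hij ⊢
          omega
        · intro k hk
          simp only [Finset.mem_filter, Fin.le_def] at hk
          ext
          simp only
          omega
        · intro ab h
          rw [Finset.HasAntidiagonal.mem_antidiagonal] at h
          rw [Fin.le_def] at hij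
          ext <;> simp only <;> omega
        · intro k hk
          simp only [Finset.mem_filter] at hk
          rw [if_pos hk.2.2, if_pos hk.2.1]
      · intro k _ hk
        by_contra h
        apply hk
        rw [not_and_or] at h
        rcases h with h | h
        · rw [if_neg h, LinearMap.zero_apply, mul_zero]
        · rw [if_neg h, LinearMap.zero_apply, zero_mul]
    · rw [if_neg hij, LinearMap.zero_apply]
      symm
      refine Finset.sum_eq_zero fun k _ => ?_
      by_cases h : j ≤ k
      · rw [if_neg (fun h' => hij (h.trans h')), LinearMap.zero_apply, zero_mul]
      · rw [if_neg h, LinearMap.zero_apply, mul_zero]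
  · intro b
    rw [Finset.sum_eq_single (Fin.last K), Finset.sum_eq_single 0]
    · simp
    · intro j _ hj
      rw [Pi.single_eq_of_ne hj, mul_zero]
    · simp
    · intro i _ hi
      simp only [Pi.single_eq_of_ne hi, zero_mul, Finset.sum_const_zero]
    · simp

end HasseSchmidt

/-! ### Hasse–Schmidt families on the weak formal affine space and on étale algebras -/

section Polynomial

variable {V : Type*} [CommRing V] (n : ℕ)

open MvPolynomial in
/-- The coefficients of the Taylor expansion in the `i`-th variable. -/
theorem exists_isHasseSchmidt_mvPolynomial (i : Fin n) :
    ∃ η : ℕ → MvPolynomial (Fin n) V →ₗ[V] MvPolynomial (Fin n) V,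
      (∀ N, IsHasseSchmidt N η) ∧ (∀ k, η (k + 1) 1 = 0) ∧
      (∀ j, η 1 (X j) = if i = j then 1 else 0) ∧ ∀ k j, η (k + 2) (X j) = 0 := by
  let T : MvPolynomial (Fin n) V →ₐ[V] Polynomial (MvPolynomial (Fin n) V) :=
    aeval fun j => Polynomial.C (X j) + if i = j then Polynomial.X else 0
  have hT : ∀ j, T (X j) = Polynomial.C (X j) + if i = j then Polynomial.X else 0 :=
    fun j => aeval_X _ j
  refine ⟨fun k => (Polynomial.lcoeff (MvPolynomial (Fin n) V) k).restrictScalars V ∘ₗ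
    T.toLinearMap, fun N => ⟨fun a => ?_, fun k _ a b => ?_⟩, fun k => ?_, fun j => ?_,
    fun k j => ?_⟩
  · have : ((Polynomial.aeval (0 : MvPolynomial (Fin n) V)).restrictScalars V).comp T =
        AlgHom.id V _ := by
      refine MvPolynomial.algHom_ext fun j => ?_
      simp only [AlgHom.comp_apply, hT]
      split_ifs <;> simp
    have h2 := DFunLike.congr_fun this a
    simpa [Polynomial.coeff_zero_eq_aeval_zero] using h2
  · simp [Polynomial.coeff_mul]
  · simp [Polynomial.coeff_one]
  · simp only [LinearMap.comp_apply, AlgHom.toLinearMap_apply, hT]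
    split_ifs <;> simp
  · simp only [LinearMap.comp_apply, AlgHom.toLinearMap_apply, hT]
    split_ifs <;> simp [Polynomial.coeff_X]

/-- The polynomial operators have linear growth, hence extend; the Leibniz identities can be checked
modulo each `π ^ j`, where elements are represented by polynomials. -/
theorem exists_isHasseSchmidt_dagPolynomial (π : V) (i : Fin n) :
    ∃ η : ℕ → DagPolynomial π n →ₗ[V] DagPolynomial π n,
      (∀ N, IsHasseSchmidt N η) ∧ (∀ k, η (k + 1) 1 = 0) ∧
      (∀ j, η 1 (dagCoord π n j) = if i = j then 1 else 0) ∧ ∀ k j, η (k + 2) (dagCoord π n j) = 0 := by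
  obtain ⟨η, hη, h1, hX1, hX2⟩ := exists_isHasseSchmidt_mvPolynomial (V := V) n i
  choose Φ hΦ using fun k => (IsHasseSchmidt.hasLinearGrowth hη k).exists_extension π
  have hW : ∀ k b, Φ k (toWeakCompletion π _ b) = toWeakCompletion π _ (η k b) := fun k b =>
    WeakCompletion.ext_residue fun j => hΦ k j _ b rfl
  refine ⟨Φ, fun N => ⟨fun a => WeakCompletion.ext_residue fun j => ?_,
    fun k hk a b => WeakCompletion.ext_residue fun j => ?_⟩, fun k => ?_, fun j => ?_, fun k j => ?_⟩
  · obtain ⟨x, hx⟩ := WeakCompletion.exists_residue_eq j a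
    rw [hΦ 0 j a x hx, (hη 1).zero, hx]
  · obtain ⟨x, hx⟩ := WeakCompletion.exists_residue_eq j a
    obtain ⟨y, hy⟩ := WeakCompletion.exists_residue_eq j b
    rw [hΦ k j _ (x * y) (by rw [map_mul, map_mul, hx, hy]), (hη N).mul k hk, map_sum]
    erw [map_sum]
    refine Finset.sum_congr rfl fun ij _ => ?_
    rw [map_mul]
    erw [map_mul]
    rw [hΦ _ j a x hx, hΦ _ j b y hy]
  · rw [← map_one (toWeakCompletion π _), hW, h1, map_zero]
  · rw [dagCoord, hW, hX1]
    split_ifs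
    · exact map_one _
    · exact map_zero _
  · rw [dagCoord, hW, hX2, map_zero]

end Polynomial

section Etale

/-- The `R`-algebra structure on `B` is a bare homomorphism `σ`: in the application `B` is a
truncated power series ring over `A`, and `σ` is a Taylor expansion instead of the inclusion of
constants. -/
theorem Algebra.FormallySmooth.exists_ringHom_lift {R A B : Type*} [CommRing R] [CommRing A]
    [CommRing B] [Algebra R A] [Algebra.FormallySmooth R A] (σ : R →+* B) (g : B →+* A)
    (hg : Function.Surjective g) (hn : IsNilpotent (RingHom.ker g))
    (h : ∀ r, g (σ r) = algebraMap R A r) :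
    ∃ τ : A →+* B, (∀ r, τ (algebraMap R A r) = σ r) ∧ ∀ a, g (τ a) = a := by
  let _ := σ.toAlgebra
  let g' : B →ₐ[R] A := { g with commutes' := h }
  refine ⟨(Algebra.FormallySmooth.liftOfSurjective (AlgHom.id R A) g' hg hn).toRingHom,
    fun r => ?_, fun a => ?_⟩
  · exact (Algebra.FormallySmooth.liftOfSurjective (AlgHom.id R A) g' hg hn).commutes r
  · exact Algebra.FormallySmooth.liftOfSurjective_apply (AlgHom.id R A) g' hg hn a

variable {V R A : Type*} [CommRing V] [CommRing R] [Algebra V R] [CommRing A] [Algebra V A]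
  [Algebra R A] [IsScalarTower V R A]

open PowerSeries in
-- A Hasse–Schmidt family truncated at `N` is the same as a ring homomorphism to power series modulo
-- `X ^ N` whose constant term is prescribed. The Taylor map `r ↦ ∑ Φ k r X ^ k` from `R` extends to
-- `A` by formal smoothness, since the constant coefficient has nilpotent kernel. The coefficients
-- of the extension are the `η k`.
theorem IsHasseSchmidt.exists_lift [Algebra.FormallySmooth R A] {Φ : ℕ → R →ₗ[V] R}
    (hΦ : ∀ N, IsHasseSchmidt N Φ) (h1 : ∀ k, Φ (k + 1) 1 = 0) (N : ℕ) (hN : 0 < N) :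
    ∃ η : ℕ → A →ₗ[V] A, IsHasseSchmidt N η ∧
      ∀ k < N, ∀ r, η k (algebraMap R A r) = algebraMap R A (Φ k r) := by
  let I : Ideal A⟦X⟧ := Ideal.span {X ^ N}
  have hI : ∀ {f g : A⟦X⟧}, Ideal.Quotient.mk I f = Ideal.Quotient.mk I g →
      ∀ k < N, coeff k f = coeff k g := by
    intro f g h k hk
    rw [Ideal.Quotient.mk_eq_mk_iff_sub_mem, Ideal.mem_span_singleton, X_pow_dvd_iff] at h
    exact sub_eq_zero.1 (by rw [← map_sub]; exact h k hk)
  let s : R →+* A⟦X⟧ :=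
    { toFun := fun r => PowerSeries.mk fun k => algebraMap R A (Φ k r)
      map_one' := by
        ext k
        rw [coeff_mk, coeff_one]
        rcases k with _ | k
        · simp [(hΦ 1).zero]
        · simp [h1]
      map_mul' := fun a b => by
        ext k
        rw [coeff_mk, coeff_mul, (hΦ (k + 1)).mul k (Nat.lt_succ_self k), map_sum]
        simp
      map_zero' := by ext k; simp
      map_add' := fun a b => by ext k; simp }
  have hs : ∀ r k, coeff k (s r) = algebraMap R A (Φ k r) := fun r k =>
    coeff_mk k fun k => algebraMap R A (Φ k r)
  let g : A⟦X⟧ ⧸ I →+* A := Ideal.Quotient.lift I constantCoeff fun f hf => by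
    rw [Ideal.mem_span_singleton, X_pow_dvd_iff] at hf
    simpa using hf 0 hN
  have hg : ∀ f, g (Ideal.Quotient.mk I f) = constantCoeff f := fun f => rfl
  obtain ⟨τ, hτ, hgτ⟩ := Algebra.FormallySmooth.exists_ringHom_lift (A := A)
    ((Ideal.Quotient.mk I).comp s) g (fun a => ⟨Ideal.Quotient.mk I (C a), by simp [hg]⟩)
    ⟨N, by
      rw [Ideal.zero_eq_bot, eq_bot_iff]
      have hker : RingHom.ker g ≤ Ideal.map (Ideal.Quotient.mk I) (Ideal.span {X}) := by
        intro x hx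
        obtain ⟨f, rfl⟩ := Ideal.Quotient.mk_surjective x
        refine Ideal.mem_map_of_mem _ (Ideal.mem_span_singleton.2 (X_dvd_iff.2 ?_))
        exact hx
      refine (Ideal.pow_right_mono hker N).trans ?_
      rw [← Ideal.map_pow, Ideal.span_singleton_pow, Ideal.map_le_iff_le_comap]
      intro x hx
      exact Ideal.Quotient.eq_zero_iff_mem.2 hx⟩
    (fun r => by
      rw [RingHom.comp_apply, hg, ← coeff_zero_eq_constantCoeff_apply, hs, (hΦ 1).zero])
  choose c hc using fun a => Ideal.Quotient.mk_surjective (τ a)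
  -- Only coefficients of index less than `N` are well defined modulo `X ^ N`; the value `0` beyond
  -- is arbitrary and never enters `IsHasseSchmidt N`.
  let η : ℕ → A →ₗ[V] A := fun k =>
    if hk : k < N then
      { toFun := fun a => coeff k (c a)
        map_add' := fun a b => by
          rw [← map_add]
          exact hI (by rw [hc, map_add, map_add, hc, hc]) k hk
        map_smul' := fun v a => by
          -- Linearity over `V` holds because the `Φ (k + 1)` kill `1`, so that the Taylor expansion
          -- of a scalar is constant.
          have hv : s (algebraMap V R v) = C (algebraMap V A v) := by
            ext k
            rw [hs, Algebra.algebraMap_eq_smul_one (A := R), map_smul, coeff_C]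
            rcases k with _ | k
            · simp [(hΦ 1).zero, IsScalarTower.algebraMap_apply V R A, Algebra.smul_def]
            · simp [h1]
          have := hI (f := c (v • a)) (g := C (algebraMap V A v) * c a) (by
            rw [hc, map_mul, hc, ← hv, Algebra.smul_def, map_mul,
              IsScalarTower.algebraMap_apply V R A, hτ]
            rfl) k hk
          rw [this, coeff_C_mul, RingHom.id_apply, Algebra.smul_def] }
    else 0
  have hη : ∀ k < N, ∀ a, η k a = coeff k (c a) := fun k hk a => by
    simp only [η, dif_pos hk]
    rfl
  refine ⟨η, ⟨fun a => ?_, fun k hk a b => ?_⟩, fun k hk r => ?_⟩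
  · rw [hη 0 hN, coeff_zero_eq_constantCoeff_apply, ← hg, hc, hgτ]
  · rw [hη k hk, hI (f := c (a * b)) (g := c a * c b) (by rw [hc, map_mul, map_mul, hc, hc]) k hk,
      coeff_mul]
    refine Finset.sum_congr rfl fun ij hij => ?_
    rw [Finset.HasAntidiagonal.mem_antidiagonal] at hij
    rw [hη _ (by omega), hη _ (by omega)]
  · rw [hη k hk, ← hs]
    exact hI (by rw [hc, hτ]; rfl) k hk

end Etale

/-- Vanishing on `R` makes `E` an `R`-derivation, which factors through the zero module of Kähler
differentials of `A` over `R`. -/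
theorem Derivation.eq_zero_of_formallyUnramified {V R A : Type*} [CommRing V] [CommRing R]
    [CommRing A] [Algebra V A] [Algebra R A] [Algebra.FormallyUnramified R A]
    (E : Derivation V A A) (h : ∀ r, E (algebraMap R A r) = 0) : E = 0 := by
  let E' : Derivation R A A := Derivation.mk'
    { toFun := E
      map_add' := map_add E
      map_smul' := fun r a => by
        rw [Algebra.smul_def, E.leibniz, h, smul_zero, add_zero, RingHom.id_apply, smul_eq_mul,
          Algebra.smul_def] } E.leibniz
  ext a
  change E' a = 0
  rw [← E'.liftKaehlerDifferential_comp_D, Subsingleton.elim (KaehlerDifferential.D R A a) 0,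
    map_zero]

/-! ### Divided powers of commuting derivations -/

section HasseCoordinates

universe u v

variable {V : Type u} [CommRing V] {A : Type v} [CommRing A] [Algebra V A] {n : ℕ}

/-- `η i k` is the divided power `∂_i ^ k / k!` of the derivation `∂_i` of `A` dual to the
coordinates `t`. -/
structure HasseCoordinates (t : Fin n → A) (η : Fin n → ℕ → Module.End V A) : Prop where
  isHasseSchmidt : ∀ i N, IsHasseSchmidt N (η i)
  dual : ∀ i j, η i 1 (t j) = if i = j then 1 else 0
  factorial_smul : ∀ i k, k ! • η i k = η i 1 ^ k
  unique : ∀ E : Derivation V A A, (∀ j, E (t j) = 0) → E = 0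

/-- The operator `∂^[k] = ∂_1 ^ k_1 ⋯ ∂_n ^ k_n / (k_1! ⋯ k_n!)`. -/
def hasseMonomial (η : Fin n → ℕ → Module.End V A) (k : Fin n → ℕ) : Module.End V A :=
  (List.ofFn fun i => η i (k i)).prod

/-- Identities between divided powers are checked after multiplication by factorials, where they
become identities between powers of derivations. -/
theorem nsmul_end_injective [IsAddTorsionFree A] {N : ℕ} (hN : N ≠ 0) {f g : Module.End V A}
    (h : N • f = N • g) : f = g := by
  ext a
  exact nsmul_right_injective hN (LinearMap.congr_fun h a)

namespace HasseCoordinates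

variable {t : Fin n → A} {η : Fin n → ℕ → Module.End V A}

theorem zero_eq_one (hη : HasseCoordinates t η) (i : Fin n) : η i 0 = 1 := by
  ext a
  exact (hη.isHasseSchmidt i 1).zero a

/-- The derivation `∂_i`. -/
def derivation (hη : HasseCoordinates t η) (i : Fin n) : Derivation V A A :=
  (hη.isHasseSchmidt i 2).derivation (by norm_num)

theorem derivation_apply (hη : HasseCoordinates t η) (i : Fin n) (a : A) :
    hη.derivation i a = η i 1 a := rfl

/-- The bracket of two of the derivations kills the coordinates, because each derivation takes
constant values on them. -/
theorem commute_one (hη : HasseCoordinates t η) (i j : Fin n) : Commute (η i 1) (η j 1) := by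
  have h := hη.unique ⁅hη.derivation i, hη.derivation j⁆ fun l => by
    rw [Derivation.commutator_apply]
    simp only [derivation_apply, hη.dual]
    have h0 : ∀ i (P : Prop) [Decidable P], η i 1 (if P then 1 else 0) = 0 := by
      intro i P _
      split_ifs
      · exact (hη.derivation i).map_one_eq_zero
      · exact map_zero _
    rw [h0, h0, sub_zero]
  ext a
  have := DFunLike.congr_fun h a
  rw [Derivation.commutator_apply] at this
  exact sub_eq_zero.1 this

theorem mul_lmul_coord_of_ne [IsAddTorsionFree A] (hη : HasseCoordinates t η) {i j : Fin n} (hij : i ≠ j) (k : ℕ) :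
    Commute (η i k) (Algebra.lmul V A (t j)) := by
  have h1 : Commute (η i 1) (Algebra.lmul V A (t j)) := by
    ext a
    have := (hη.derivation i).leibniz (t j) a
    rw [derivation_apply, derivation_apply, derivation_apply, hη.dual, if_neg hij, smul_zero,
      add_zero] at this
    exact this
  refine nsmul_end_injective k.factorial_ne_zero ?_
  rw [← smul_mul_assoc, ← mul_smul_comm, hη.factorial_smul]
  exact h1.pow_left k

/-- This is the relation `[∂ ^ (k + 1), t] = (k + 1) ∂ ^ k` divided by `(k + 1)!`. -/
theorem mul_lmul_coord [IsAddTorsionFree A] (hη : HasseCoordinates t η) (i : Fin n) (k : ℕ) :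
    η i (k + 1) * Algebra.lmul V A (t i) = Algebra.lmul V A (t i) * η i (k + 1) + η i k := by
  have h1 : η i 1 * Algebra.lmul V A (t i) = Algebra.lmul V A (t i) * η i 1 + 1 := by
    ext a
    have := (hη.derivation i).leibniz (t i) a
    rw [derivation_apply, derivation_apply, derivation_apply, hη.dual, if_pos rfl, smul_eq_mul,
      smul_eq_mul, mul_one] at this
    exact this
  have h2 : ∀ k : ℕ, η i 1 ^ (k + 1) * Algebra.lmul V A (t i) =
      Algebra.lmul V A (t i) * η i 1 ^ (k + 1) + (k + 1) • η i 1 ^ k := by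
    intro k
    induction k with
    | zero => simpa using h1
    | succ k ih =>
      rw [pow_succ', mul_assoc, ih, mul_add, ← mul_assoc, h1, add_mul, one_mul, mul_assoc,
        ← pow_succ', mul_smul_comm, ← pow_succ', add_assoc]
      congr 1
      rw [succ_nsmul _ (k + 1), add_comm]
  refine nsmul_end_injective (k + 1).factorial_ne_zero ?_
  rw [smul_add, ← smul_mul_assoc, ← mul_smul_comm, hη.factorial_smul, h2, Nat.factorial_succ,
    mul_smul, hη.factorial_smul]

theorem commute [IsAddTorsionFree A] (hη : HasseCoordinates t η) (i j : Fin n) (k l : ℕ) :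
    Commute (η i k) (η j l) := by
  have h : Commute (k ! • η i k) (l ! • η j l) := by
    rw [hη.factorial_smul, hη.factorial_smul]
    exact ((hη.commute_one i j).pow_pow k l)
  refine nsmul_end_injective (mul_ne_zero k.factorial_ne_zero l.factorial_ne_zero) ?_
  rw [← smul_mul_smul_comm, h.eq, smul_mul_smul_comm, mul_comm]

theorem mul_eq [IsAddTorsionFree A] (hη : HasseCoordinates t η) (i : Fin n) (k l : ℕ) :
    η i k * η i l = (k + l).choose k • η i (k + l) := by
  refine nsmul_end_injective (mul_ne_zero k.factorial_ne_zero l.factorial_ne_zero) ?_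
  rw [← smul_mul_smul_comm, hη.factorial_smul, hη.factorial_smul, smul_smul, ← pow_add,
    ← hη.factorial_smul, mul_comm, ← mul_assoc, Nat.choose_symm_add, Nat.add_choose_mul_factorial_mul_factorial]

/-- The `η i k` commute with one another, but live in a noncommutative ring where products over `i`
are ordered lists. Realising them in a commutative ring allows unordered products and their
rearrangement. -/
theorem exists_commRing [IsAddTorsionFree A] (hη : HasseCoordinates t η) :
    ∃ (Z : Type v) (_ : CommRing Z) (f : Z →+* Module.End V A) (ζ : Fin n → ℕ → Z),
      Function.Injective f ∧ ∀ i k, f (ζ i k) = η i k := by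
  let s : Set (Module.End V A) := Set.range fun ik : Fin n × ℕ => η ik.1 ik.2
  have : IsMulCommutative (Algebra.adjoin V s) := Algebra.isMulCommutative_adjoin V (by
    rintro _ ⟨⟨i, k⟩, rfl⟩ _ ⟨⟨j, l⟩, rfl⟩
    exact hη.commute i j k l)
  let _ : CommRing (Algebra.adjoin V s) :=
    { (inferInstance : Ring (Algebra.adjoin V s)) with mul_comm := this.is_comm.comm }
  exact ⟨Algebra.adjoin V s, inferInstance, (Algebra.adjoin V s).val.toRingHom,
    fun i k => ⟨η i k, Algebra.subset_adjoin ⟨(i, k), rfl⟩⟩, Subtype.val_injective, fun _ _ => rfl⟩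

theorem hasseMonomial_mul [IsAddTorsionFree A] (hη : HasseCoordinates t η) (k l : Fin n → ℕ) :
    hasseMonomial η k * hasseMonomial η l =
      (∏ i, (k i + l i).choose (k i)) • hasseMonomial η (k + l) := by
  obtain ⟨Z, _, f, ζ, hf, hζ⟩ := hη.exists_commRing
  have h : ∀ k, hasseMonomial η k = f (∏ i, ζ i (k i)) := fun k => by
    rw [← List.prod_ofFn, map_list_prod, List.map_ofFn, hasseMonomial]
    simp only [Function.comp_def, hζ]
  rw [h, h, h, ← map_mul, ← map_nsmul]
  congr 1
  rw [← Finset.prod_mul_distrib, nsmul_eq_mul, Nat.cast_prod, ← Finset.prod_mul_distrib]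
  refine Finset.prod_congr rfl fun i _ => hf ?_
  rw [map_mul, hζ, hζ, hη.mul_eq, Pi.add_apply, ← nsmul_eq_mul, map_nsmul, hζ]

theorem hasseMonomial_zero (hη : HasseCoordinates t η) : hasseMonomial η 0 = 1 := by
  rw [hasseMonomial]
  simp only [Pi.zero_apply, hη.zero_eq_one]
  exact List.prod_eq_one fun x hx => by
    rw [List.mem_ofFn] at hx
    obtain ⟨_, rfl⟩ := hx
    rfl

theorem hasseMonomial_single [IsAddTorsionFree A] (hη : HasseCoordinates t η) (i : Fin n) (l : ℕ) :
    hasseMonomial η (Pi.single i l) = η i l := by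
  obtain ⟨Z, _, f, ζ, hf, hζ⟩ := hη.exists_commRing
  have h : ∀ k, hasseMonomial η k = f (∏ i, ζ i (k i)) := fun k => by
    rw [← List.prod_ofFn, map_list_prod, List.map_ofFn, hasseMonomial]
    simp only [Function.comp_def, hζ]
  have h0 : ∀ i, ζ i 0 = 1 := fun i => hf (by rw [hζ, hη.zero_eq_one, map_one])
  rw [h, Finset.prod_eq_single i, Pi.single_eq_same, hζ]
  · intro j _ hj
    rw [Pi.single_eq_of_ne hj, h0]
  · simp

theorem hasseMonomial_split [IsAddTorsionFree A] (hη : HasseCoordinates t η) (k : Fin n → ℕ)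
    (i : Fin n) : hasseMonomial η k = η i (k i) * hasseMonomial η (Function.update k i 0) := by
  have h1 : Pi.single i (k i) + Function.update k i 0 = k := by
    ext j
    by_cases hj : j = i
    · subst hj; simp
    · simp [hj]
  rw [← hη.hasseMonomial_single, hη.hasseMonomial_mul, h1, Finset.prod_eq_one, one_smul]
  intro j _
  by_cases hj : j = i
  · subst hj; simp
  · simp [hj]

theorem hasseMonomial_commute_lmul [IsAddTorsionFree A] (hη : HasseCoordinates t η)
    {k : Fin n → ℕ} {i : Fin n} (hk : k i = 0) :
    Commute (hasseMonomial η k) (Algebra.lmul V A (t i)) := by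
  refine Commute.list_prod_left _ _ fun x hx => ?_
  rw [List.mem_ofFn] at hx
  obtain ⟨j, rfl⟩ := hx
  by_cases hj : j = i
  · subst hj
    simp only [hk, hη.zero_eq_one]
    exact Commute.one_left _
  · exact hη.mul_lmul_coord_of_ne hj _

theorem hasseMonomial_mul_lmul [IsAddTorsionFree A] (hη : HasseCoordinates t η)
    (k : Fin n → ℕ) (i : Fin n) :
    hasseMonomial η (k + Pi.single i 1) * Algebra.lmul V A (t i) =
      Algebra.lmul V A (t i) * hasseMonomial η (k + Pi.single i 1) + hasseMonomial η k := by
  have h1 : Function.update (k + Pi.single i 1) i 0 = Function.update k i 0 := by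
    ext j
    by_cases hj : j = i
    · subst hj; simp
    · simp [hj]
  have h2 : Commute (hasseMonomial η (Function.update k i 0)) (Algebra.lmul V A (t i)) :=
    hη.hasseMonomial_commute_lmul (by simp)
  rw [hη.hasseMonomial_split (k + Pi.single i 1) i, h1, hη.hasseMonomial_split k i, mul_assoc,
    h2.eq, ← mul_assoc, Pi.add_apply, Pi.single_eq_same, hη.mul_lmul_coord]
  noncomm_ring

/-- The derivations are forced by `unique`, and the division by factorials is forced by
torsion-freeness. The definition of `diffOp` can thus be expressed through `η`. -/
theorem isDividedPartial_iff [IsAddTorsionFree A] (hη : HasseCoordinates t η) (k : Fin n → ℕ)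
    (P : Module.End V A) : IsDividedPartial V t k P ↔ P = hasseMonomial η k := by
  obtain ⟨Z, _, f, ζ, hf, hζ⟩ := hη.exists_commRing
  have h : (∏ i, (k i)!) • hasseMonomial η k = (List.ofFn fun i => η i 1 ^ k i).prod := by
    have e1 : hasseMonomial η k = f (∏ i, ζ i (k i)) := by
      rw [← List.prod_ofFn, map_list_prod, List.map_ofFn, hasseMonomial]
      simp only [Function.comp_def, hζ]
    have e2 : (List.ofFn fun i => η i 1 ^ k i).prod = f (∏ i, ζ i 1 ^ k i) := by
      rw [← List.prod_ofFn, map_list_prod, List.map_ofFn]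
      simp only [Function.comp_def, hζ, map_pow]
    rw [e1, e2, ← map_nsmul, nsmul_eq_mul, Nat.cast_prod, ← Finset.prod_mul_distrib]
    congr 1
    refine Finset.prod_congr rfl fun i _ => hf ?_
    rw [← nsmul_eq_mul, map_nsmul, map_pow, hζ, hζ, hη.factorial_smul]
  constructor
  · rintro ⟨D, hD, hP⟩
    have hDη : ∀ i, (D i : Module.End V A) = η i 1 := fun i => by
      have := hη.unique (D i - hη.derivation i) fun j => by
        rw [Derivation.sub_apply, hD, derivation_apply, hη.dual, sub_self]
      ext a
      exact sub_eq_zero.1 (DFunLike.congr_fun this a)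
    simp only [hDη] at hP
    exact nsmul_end_injective (Finset.prod_ne_zero_iff.2 fun i _ => (k i).factorial_ne_zero)
      (hP.trans h.symm)
  · rintro rfl
    exact ⟨hη.derivation, fun i j => hη.dual i j, h⟩

end HasseCoordinates

end HasseCoordinates

/-! ### Divisibility of level factors -/

section LevelFactor

/-- Legendre's formula, cut at `m`: the terms with `i > m` are those of Legendre's formula for `k /
p ^ m`. -/
theorem padicValNat_factorial_eq_add (p : ℕ) [Fact p.Prime] (m k : ℕ) :
    padicValNat p k ! = padicValNat p (k / p ^ m)! + ∑ i ∈ Finset.Ico 1 (m + 1), k / p ^ i := by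
  have h1 := padicValNat_factorial (p := p) (n := k) (b := Nat.log p k + 1 + m) (by omega)
  have h2 := padicValNat_factorial (p := p) (n := k / p ^ m) (b := Nat.log p k + 1)
    (Nat.lt_succ_of_le (Nat.log_mono_right (Nat.div_le_self _ _)))
  rw [h1, h2, ← Finset.sum_Ico_consecutive _ (show 1 ≤ m + 1 by omega)
    (show m + 1 ≤ Nat.log p k + 1 + m by omega), add_comm]
  congr 1
  rw [add_comm m 1, ← Finset.sum_Ico_add']
  exact Finset.sum_congr rfl fun i _ => by rw [Nat.div_div_eq_div_mul, ← pow_add, add_comm]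

/-- This makes the structure constants of the level `m` basis `p`-integral. By Legendre's formula,
the valuation of `(k + l).choose k * (k / p ^ m)! * (l / p ^ m)!` exceeds that of `((k + l) / p ^
m)!` by the sum over `1 ≤ i ≤ m` of `(k + l) / p ^ i - k / p ^ i - l / p ^ i`, and these differences
are nonnegative. The denominator `u` is the prime-to-`p` part of `((k + l) / p ^ m)!`. -/
theorem exists_mul_choose_eq (p : ℕ) [Fact p.Prime] (m k l : ℕ) :
    ∃ u N : ℕ, ¬ p ∣ u ∧
      u * ((k + l).choose k * ((k / p ^ m)! * (l / p ^ m)!)) = N * ((k + l) / p ^ m)! := by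
  set x := ((k + l) / p ^ m)!
  set y := (k + l).choose k * ((k / p ^ m)! * (l / p ^ m)!)
  have hx : x ≠ 0 := Nat.factorial_ne_zero _
  have hc : (k + l).choose k ≠ 0 := (Nat.choose_pos (Nat.le_add_right k l)).ne'
  have hy : y ≠ 0 := mul_ne_zero hc (mul_ne_zero (Nat.factorial_ne_zero _) (Nat.factorial_ne_zero _))
  have hv : padicValNat p x ≤ padicValNat p y := by
    have e1 := congrArg (padicValNat p) (Nat.add_choose_mul_factorial_mul_factorial k l)
    rw [← Nat.choose_symm_add, padicValNat.mul (mul_ne_zero hc (Nat.factorial_ne_zero _)) (Nat.factorial_ne_zero _),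
      padicValNat.mul hc (Nat.factorial_ne_zero _), padicValNat_factorial_eq_add p m k,
      padicValNat_factorial_eq_add p m l, padicValNat_factorial_eq_add p m (k + l)] at e1
    have e2 : padicValNat p y = padicValNat p ((k + l).choose k) + (padicValNat p (k / p ^ m)! +
        padicValNat p (l / p ^ m)!) := by
      rw [padicValNat.mul hc (mul_ne_zero (Nat.factorial_ne_zero _) (Nat.factorial_ne_zero _)),
        padicValNat.mul (Nat.factorial_ne_zero _) (Nat.factorial_ne_zero _)]
    have e3 : ∑ i ∈ Finset.Ico 1 (m + 1), k / p ^ i + ∑ i ∈ Finset.Ico 1 (m + 1), l / p ^ i ≤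
        ∑ i ∈ Finset.Ico 1 (m + 1), (k + l) / p ^ i := by
      rw [← Finset.sum_add_distrib]
      exact Finset.sum_le_sum fun i _ => Nat.div_add_div_le_add_div
    change padicValNat p ((k + l) / p ^ m)! ≤ _
    omega
  obtain ⟨c, hc'⟩ : p ^ padicValNat p x ∣ y := (pow_dvd_pow p hv).trans pow_padicValNat_dvd
  obtain ⟨u, hu⟩ : p ^ padicValNat p x ∣ x := pow_padicValNat_dvd
  refine ⟨u, c, fun h => ?_, ?_⟩
  · obtain ⟨w, rfl⟩ := h
    refine pow_succ_padicValNat_not_dvd hx (p := p) ?_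
    exact ⟨w, by rw [pow_succ, mul_assoc]; exact hu⟩
  · conv_rhs => rw [hu]
    rw [hc']
    ring

end LevelFactor

/-! ### The canonical basis of the ring of differential operators of level `m` -/

section LevelMonomial

universe u v

variable {V : Type u} [CommRing V] {A : Type v} [CommRing A] [Algebra V A] {n : ℕ}

/-- The operator `∂^<k>_(m)`. -/
def levelMonomial (η : Fin n → ℕ → Module.End V A) (p m : ℕ) (k : Fin n → ℕ) : Module.End V A :=
  levelFactor p m k • hasseMonomial η k

theorem List.prod_ofFn_smul {B : Type*} [Ring B] {n : ℕ} (c : Fin n → ℕ) (f : Fin n → B) :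
    (List.ofFn fun i => c i • f i).prod = (∏ i, c i) • (List.ofFn f).prod := by
  induction n with
  | zero => simp
  | succ n ih =>
    rw [List.ofFn_succ, List.ofFn_succ, List.prod_cons, List.prod_cons, Fin.prod_univ_succ, ih,
      smul_mul_smul_comm]

theorem levelFactor_ne_zero (p m : ℕ) (k : Fin n → ℕ) : levelFactor p m k ≠ 0 :=
  Finset.prod_ne_zero_iff.2 fun _ _ => Nat.factorial_ne_zero _

theorem levelFactor_single (p m : ℕ) (i : Fin n) (l : ℕ) :
    levelFactor p m (Pi.single i l) = (l / p ^ m)! := by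
  rw [levelFactor, Finset.prod_eq_single i]
  · simp
  · intro j _ hj
    simp [Pi.single_eq_of_ne hj]
  · simp

theorem lmul_commute (a b : A) : Commute (Algebra.lmul V A a) (Algebra.lmul V A b) := by
  rw [Commute, SemiconjBy, ← map_mul, mul_comm, map_mul]

/-- A finite sum `∑ F_k a_k` which vanishes on a subalgebra containing the coordinates has zero
coefficients, if `F_0 a` is the multiplication by `a` and the commutator with `t_i` maps `F_k a` to
`F_{k - e_i} a`. -/
theorem eq_zero_of_commutator {t : Fin n → A} (F : (Fin n → ℕ) → A →+ Module.End V A)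
    (hF0 : ∀ a, F 0 a = Algebra.lmul V A a)
    (hF1 : ∀ k i a, F (k + Pi.single i 1) a * Algebra.lmul V A (t i) =
      Algebra.lmul V A (t i) * F (k + Pi.single i 1) a + F k a)
    (hF2 : ∀ k i a, k i = 0 → F k a * Algebra.lmul V A (t i) = Algebra.lmul V A (t i) * F k a)
    {S : Subalgebra V A} (hS : ∀ i, t i ∈ S) (s : Finset (Fin n → ℕ)) (a : (Fin n → ℕ) → A)
    (h : ∀ x ∈ S, (∑ k ∈ s, F k (a k)) x = 0) : ∀ k ∈ s, a k = 0 := by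
  classical
  obtain ⟨d, hd⟩ : ∃ d, ∀ k ∈ s, ∑ i, k i < d :=
    ⟨s.sup (fun k => ∑ i, k i) + 1, fun k hk =>
      Nat.lt_succ_of_le (Finset.le_sup (f := fun k : Fin n → ℕ => ∑ i, k i) hk)⟩
  induction d generalizing s a with
  | zero => exact fun k hk => absurd (hd k hk) (Nat.not_lt_zero _)
  | succ d ih =>
    -- The commutator of the sum with `t i` still vanishes on `S`, because `S` is stable under
    -- multiplication by `t i`. It is the sum over the indices `k` with `k i ≠ 0`, each lowered by
    -- one in position `i`, so the induction on total degree applies.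
    have hk0 : ∀ k ∈ s, ∀ i, k i ≠ 0 → a k = 0 := by
      intro k hk i hki
      have hsub : ∀ k : Fin n → ℕ, k i ≠ 0 → k - Pi.single i 1 + Pi.single i 1 = k := by
        intro k hki
        ext j
        by_cases hj : j = i
        · subst hj; simp; omega
        · simp [hj]
      let s' := (s.filter fun k => k i ≠ 0).image fun k => k - Pi.single i 1
      have hs' : ∑ k ∈ s', F k (a (k + Pi.single i 1)) =
          (∑ k ∈ s, F k (a k)) * Algebra.lmul V A (t i) -
            Algebra.lmul V A (t i) * ∑ k ∈ s, F k (a k) := by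
        rw [Finset.sum_mul, Finset.mul_sum, ← Finset.sum_sub_distrib, Finset.sum_image,
          Finset.sum_filter]
        · refine Finset.sum_congr rfl fun k _ => ?_
          split_ifs with hki
          · rw [hsub k hki]
            have := hF1 (k - Pi.single i 1) i (a k)
            rw [hsub k hki] at this
            rw [this, add_sub_cancel_left]
          · rw [hF2 k i (a k) (not_not.1 hki), sub_self]
        · intro k hk l hl hkl
          simp only [Finset.coe_filter, Set.mem_ofPred_eq] at hk hl
          rw [← hsub k hk.2, ← hsub l hl.2]
          exact congrArg (· + Pi.single i 1) hkl
      have := ih s' (fun k => a (k + Pi.single i 1)) (fun x hx => by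
        rw [hs', LinearMap.sub_apply, Module.End.mul_apply, Module.End.mul_apply, h x hx, map_zero,
          sub_zero]
        exact h _ (S.mul_mem (hS i) hx)) (by
        intro k hk
        rw [Finset.mem_image] at hk
        obtain ⟨l, hl, rfl⟩ := hk
        rw [Finset.mem_filter] at hl
        have h1 := hd l hl.1
        have h2 : ∑ j, (l - Pi.single i 1 : Fin n → ℕ) j < ∑ j, l j := by
          refine Finset.sum_lt_sum (fun j _ => Nat.sub_le _ _) ⟨i, Finset.mem_univ i, ?_⟩
          have := hl.2
          simp
          omega
        omega) (k - Pi.single i 1) (Finset.mem_image.2 ⟨k, Finset.mem_filter.2 ⟨hk, hki⟩, rfl⟩)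
      simpa only [hsub k hki] using this
    intro k hk
    by_cases hki : ∃ i, k i ≠ 0
    · obtain ⟨i, hi⟩ := hki
      exact hk0 k hk i hi
    · push Not at hki
      obtain rfl : k = 0 := funext hki
      -- Only the index `0` survives; evaluation at `1` then returns its coefficient.
      have h1 := h 1 S.one_mem
      rw [Finset.sum_eq_single_of_mem 0 hk, hF0] at h1
      · simpa using h1
      · intro l hl hl0
        obtain ⟨i, hi⟩ := Function.ne_iff.1 hl0
        rw [hk0 l hl i hi, map_zero]

theorem HasseCoordinates.levelMonomial_zero {t : Fin n → A} {η : Fin n → ℕ → Module.End V A}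
    {p m : ℕ} (hη : HasseCoordinates t η) : levelMonomial η p m 0 = 1 := by
  simp [levelMonomial, levelFactor, hη.hasseMonomial_zero]

namespace HasseCoordinates

variable {t : Fin n → A} {η : Fin n → ℕ → Module.End V A} [IsAddTorsionFree A] {p m : ℕ}

theorem diffOp_eq (hη : HasseCoordinates t η) (p m : ℕ) : diffOp V p m t = Algebra.adjoin V
    (Set.range (Algebra.lmul V A) ∪ Set.range (levelMonomial η p m)) := by
  rw [diffOp]
  congr 2
  ext P
  constructor
  · rintro ⟨k, H, hH, rfl⟩
    rw [hη.isDividedPartial_iff] at hH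
    exact ⟨k, by rw [hH]; rfl⟩
  · rintro ⟨k, rfl⟩
    exact ⟨k, _, (hη.isDividedPartial_iff k _).2 rfl, rfl⟩

theorem levelMonomial_mem (hη : HasseCoordinates t η) (p m : ℕ) (k : Fin n → ℕ) :
    levelMonomial η p m k ∈ diffOp V p m t := by
  rw [hη.diffOp_eq]
  exact Algebra.subset_adjoin (Or.inr ⟨k, rfl⟩)

theorem levelMonomial_single (hη : HasseCoordinates t η) (i : Fin n) (l : ℕ) :
    levelMonomial η p m (Pi.single i l) = (l / p ^ m)! • η i l := by
  rw [levelMonomial, levelFactor_single, hη.hasseMonomial_single]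

/-- The level factor is a product over the variables, so the several-variable operators are products
of one-variable ones. -/
theorem levelMonomial_mem_of_single (hη : HasseCoordinates t η)
    {S : Subalgebra V (Module.End V A)} (hS : ∀ i l, levelMonomial η p m (Pi.single i l) ∈ S)
    (k : Fin n → ℕ) : levelMonomial η p m k ∈ S := by
  have : levelMonomial η p m k =
      (List.ofFn fun i => levelMonomial η p m (Pi.single i (k i))).prod := by
    simp only [hη.levelMonomial_single]
    rw [List.prod_ofFn_smul]
    rfl
  rw [this]
  refine Subalgebra.list_prod_mem _ fun x hx => ?_
  rw [List.mem_ofFn] at hx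
  obtain ⟨i, rfl⟩ := hx
  exact hS i _

/-- The structure constants have denominators prime to `p`, and these are invertible in `V` by `hp`.
-/
theorem levelMonomial_mul [Fact p.Prime] (hp : ∀ u : ℕ, ¬ p ∣ u → IsUnit (u : V))
    (hη : HasseCoordinates t η) (k l : Fin n → ℕ) :
    ∃ c : V, levelMonomial η p m k * levelMonomial η p m l = c • levelMonomial η p m (k + l) := by
  choose u N hu huN using fun i => exists_mul_choose_eq p m (k i) (l i)
  have hU : IsUnit ((∏ i, u i : ℕ) : V) := hp _ fun h => by
    obtain ⟨i, _, hi⟩ := (Fact.out : p.Prime).prime.exists_mem_finset_dvd h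
    exact hu i hi
  obtain ⟨w, hw⟩ := hU.exists_left_inv
  refine ⟨w * ((∏ i, N i : ℕ) : V), ?_⟩
  have h1 : (∏ i, u i) * ((∏ i, (k i + l i).choose (k i)) *
      (levelFactor p m k * levelFactor p m l)) = (∏ i, N i) * levelFactor p m (k + l) := by
    simp only [levelFactor, ← Finset.prod_mul_distrib]
    exact Finset.prod_congr rfl fun i _ => huN i
  have h2 : (∏ i, u i) • (levelMonomial η p m k * levelMonomial η p m l) =
      (∏ i, N i) • levelMonomial η p m (k + l) := by
    simp only [levelMonomial]
    rw [smul_mul_smul_comm, hη.hasseMonomial_mul, smul_smul, smul_smul, smul_smul, ← h1]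
    congr 1
    ring
  rw [mul_smul, Nat.cast_smul_eq_nsmul, ← h2, ← Nat.cast_smul_eq_nsmul V, smul_smul, hw, one_smul]

/-- This is the Leibniz rule read as a commutation relation. The division of factorials is exact,
since `xy.2 ≤ l`. -/
theorem levelMonomial_single_mul_lmul (hη : HasseCoordinates t η) (i : Fin n) (l : ℕ) (a : A) :
    levelMonomial η p m (Pi.single i l) * Algebra.lmul V A a =
      ∑ xy ∈ Finset.HasAntidiagonal.antidiagonal l, ((l / p ^ m)! / (xy.2 / p ^ m)!) •
        (Algebra.lmul V A (η i xy.1 a) * levelMonomial η p m (Pi.single i xy.2)) := by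
  simp only [hη.levelMonomial_single]
  have h : η i l * Algebra.lmul V A a = ∑ xy ∈ Finset.HasAntidiagonal.antidiagonal l,
      Algebra.lmul V A (η i xy.1 a) * η i xy.2 := by
    ext b
    rw [LinearMap.sum_apply]
    exact (hη.isHasseSchmidt i (l + 1)).mul l (Nat.lt_succ_self l) a b
  rw [smul_mul_assoc, h, Finset.smul_sum]
  refine Finset.sum_congr rfl fun xy hxy => ?_
  rw [Finset.HasAntidiagonal.mem_antidiagonal] at hxy
  rw [mul_smul_comm, smul_smul, Nat.div_mul_cancel]
  exact Nat.factorial_dvd_factorial (Nat.div_le_div_right (by omega))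

/-- In the Leibniz formula the term of order `l` has coefficient `1`. Solving for it leaves terms of
smaller order, to which the induction applies. -/
theorem lmul_mul_levelMonomial_single (hη : HasseCoordinates t η) (i : Fin n) (l : ℕ) (a : A) :
    Algebra.lmul V A a * levelMonomial η p m (Pi.single i l) ∈ Submodule.span V
      (Set.range fun bk : A × ℕ =>
        levelMonomial η p m (Pi.single i bk.2) * Algebra.lmul V A bk.1) := by
  induction l using Nat.strong_induction_on generalizing a with
  | _ l ih =>
  have h := hη.levelMonomial_single_mul_lmul (p := p) (m := m) i l a
  rw [← Finset.add_sum_erase _ _ (show (0, l) ∈ Finset.HasAntidiagonal.antidiagonal l by simp),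
    Nat.div_self (Nat.factorial_pos _), one_smul, (hη.isHasseSchmidt i 1).zero] at h
  rw [eq_sub_of_add_eq h.symm]
  refine Submodule.sub_mem _ (Submodule.subset_span ⟨(a, l), rfl⟩)
    (Submodule.sum_mem _ fun xy hxy => nsmul_mem (ih _ ?_ _) _)
  rw [Finset.mem_erase, Finset.HasAntidiagonal.mem_antidiagonal] at hxy
  obtain ⟨x, y⟩ := xy
  simp only at hxy ⊢
  rcases Nat.eq_zero_or_pos x with rfl | hx
  · exact absurd (by simp_all) hxy.1
  · omega

/-- The left multipliers of the span `L` form a subalgebra. It contains the functions trivially and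
the operators by the Leibniz rule together with `levelMonomial_mul`, hence contains `diffOp`; apply
this to `1 ∈ L`. -/
theorem mem_span_left [Fact p.Prime] (hp : ∀ u : ℕ, ¬ p ∣ u → IsUnit (u : V))
    (hη : HasseCoordinates t η) {P : Module.End V A} (hP : P ∈ diffOp V p m t) :
    P ∈ Submodule.span V (Set.range fun ak : A × (Fin n → ℕ) =>
      Algebra.lmul V A ak.1 * levelMonomial η p m ak.2) := by
  set L := Submodule.span V (Set.range fun ak : A × (Fin n → ℕ) =>
    Algebra.lmul V A ak.1 * levelMonomial η p m ak.2)
  let S : Subalgebra V (Module.End V A) :=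
    { carrier := {x | ∀ y ∈ L, x * y ∈ L}
      mul_mem' := fun {a b} ha hb y hy => by rw [mul_assoc]; exact ha _ (hb y hy)
      add_mem' := fun {a b} ha hb y hy => by rw [add_mul]; exact L.add_mem (ha y hy) (hb y hy)
      algebraMap_mem' := fun r y hy => by
        rw [← Algebra.smul_def]
        exact L.smul_mem r hy }
  have hS : ∀ x, (∀ a k, x * (Algebra.lmul V A a * levelMonomial η p m k) ∈ L) → x ∈ S := by
    intro x hx y hy
    induction hy using Submodule.span_induction with
    | mem y hy => obtain ⟨ak, rfl⟩ := hy; exact hx _ _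
    | zero => rw [mul_zero]; exact L.zero_mem
    | add y z _ _ h1 h2 => rw [mul_add]; exact L.add_mem h1 h2
    | smul r y _ h => rw [mul_smul_comm]; exact L.smul_mem r h
  have hle : diffOp V p m t ≤ S := by
    rw [hη.diffOp_eq]
    refine Algebra.adjoin_le ?_
    rintro _ (⟨b, rfl⟩ | ⟨k, rfl⟩)
    · refine hS _ fun a k => Submodule.subset_span ⟨(b * a, k), ?_⟩
      simp only [map_mul, mul_assoc]
    · refine hη.levelMonomial_mem_of_single (fun i l => hS _ fun a k => ?_) k
      rw [← mul_assoc, hη.levelMonomial_single_mul_lmul, Finset.sum_mul]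
      refine L.sum_mem fun xy _ => ?_
      obtain ⟨c, hc⟩ := hη.levelMonomial_mul (m := m) hp (Pi.single i xy.2) k
      rw [smul_mul_assoc, mul_assoc, hc, mul_smul_comm]
      exact nsmul_mem (L.smul_mem c (Submodule.subset_span ⟨(_, _), rfl⟩)) _
  have h1 : (1 : Module.End V A) ∈ L :=
    Submodule.subset_span ⟨(1, 0), by simp only [hη.levelMonomial_zero, map_one, mul_one]⟩
  simpa using hle hP 1 h1

/-- The mirror argument with right multipliers, where a function is moved to the right of an
operator by `lmul_mul_levelMonomial_single`. -/
theorem mem_span_right [Fact p.Prime] (hp : ∀ u : ℕ, ¬ p ∣ u → IsUnit (u : V))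
    (hη : HasseCoordinates t η) {P : Module.End V A} (hP : P ∈ diffOp V p m t) :
    P ∈ Submodule.span V (Set.range fun ak : A × (Fin n → ℕ) =>
      levelMonomial η p m ak.2 * Algebra.lmul V A ak.1) := by
  set L := Submodule.span V (Set.range fun ak : A × (Fin n → ℕ) =>
    levelMonomial η p m ak.2 * Algebra.lmul V A ak.1)
  let S : Subalgebra V (Module.End V A) :=
    { carrier := {x | ∀ y ∈ L, y * x ∈ L}
      mul_mem' := fun {a b} ha hb y hy => by rw [← mul_assoc]; exact hb _ (ha y hy)
      add_mem' := fun {a b} ha hb y hy => by rw [mul_add]; exact L.add_mem (ha y hy) (hb y hy)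
      algebraMap_mem' := fun r y hy => by
        rw [← Algebra.commutes, ← Algebra.smul_def]
        exact L.smul_mem r hy }
  have hS : ∀ x, (∀ a k, levelMonomial η p m k * Algebra.lmul V A a * x ∈ L) → x ∈ S := by
    intro x hx y hy
    induction hy using Submodule.span_induction with
    | mem y hy => obtain ⟨ak, rfl⟩ := hy; exact hx _ _
    | zero => rw [zero_mul]; exact L.zero_mem
    | add y z _ _ h1 h2 => rw [add_mul]; exact L.add_mem h1 h2
    | smul r y _ h => rw [smul_mul_assoc]; exact L.smul_mem r h
  have hle : diffOp V p m t ≤ S := by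
    rw [hη.diffOp_eq]
    refine Algebra.adjoin_le ?_
    rintro _ (⟨b, rfl⟩ | ⟨k, rfl⟩)
    · refine hS _ fun a k => Submodule.subset_span ⟨(a * b, k), ?_⟩
      simp only [map_mul, mul_assoc]
    · refine hη.levelMonomial_mem_of_single (fun i l => hS _ fun a k => ?_) k
      rw [mul_assoc]
      have hy := hη.lmul_mul_levelMonomial_single (p := p) (m := m) i l a
      generalize Algebra.lmul V A a * levelMonomial η p m (Pi.single i l) = y at hy ⊢
      induction hy using Submodule.span_induction with
      | mem y hy =>
        obtain ⟨⟨b, j⟩, rfl⟩ := hy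
        obtain ⟨c, hc⟩ := hη.levelMonomial_mul (m := m) hp k (Pi.single i j)
        simp only
        rw [← mul_assoc, hc, smul_mul_assoc]
        exact L.smul_mem c (Submodule.subset_span ⟨(_, _), rfl⟩)
      | zero => rw [mul_zero]; exact L.zero_mem
      | add y z _ _ h1 h2 => rw [mul_add]; exact L.add_mem h1 h2
      | smul r y _ h => rw [mul_smul_comm]; exact L.smul_mem r h
  have h1 : (1 : Module.End V A) ∈ L :=
    Submodule.subset_span ⟨(1, 0), by simp only [hη.levelMonomial_zero, map_one, mul_one]⟩
  simpa using hle hP 1 h1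

/-- `eq_zero_of_commutator` is applied to the divided powers, with the level factors moved into the
coefficients and cancelled afterwards. Testing only on `S` is what later shows that an operator on
`A` is determined on the image of `R`. -/
theorem left_independent (hη : HasseCoordinates t η) {S : Subalgebra V A} (hS : ∀ i, t i ∈ S)
    (s : Finset (Fin n → ℕ)) (a : (Fin n → ℕ) → A)
    (h : ∀ x ∈ S, (∑ k ∈ s, Algebra.lmul V A (a k) * levelMonomial η p m k) x = 0) :
    ∀ k ∈ s, a k = 0 := by
  have := eq_zero_of_commutator (t := t)
    (fun k => (AddMonoidHom.mulRight (hasseMonomial η k)).comp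
      (Algebra.lmul V A : A →+ Module.End V A)) ?_ ?_ ?_ hS s (fun k => levelFactor p m k • a k) ?_
  · intro k hk
    exact nsmul_right_injective (levelFactor_ne_zero p m k)
      ((this k hk).trans (nsmul_zero _).symm)
  · intro a
    change Algebra.lmul V A a * _ = _
    rw [hη.hasseMonomial_zero, mul_one]
  · intro k i a
    change Algebra.lmul V A a * _ * _ = _ * (Algebra.lmul V A a * _) + Algebra.lmul V A a * _
    rw [mul_assoc, hη.hasseMonomial_mul_lmul, mul_add, ← mul_assoc, ← mul_assoc,
      (lmul_commute a (t i)).eq]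
  · intro k i a hk
    change Algebra.lmul V A a * _ * _ = _ * (Algebra.lmul V A a * _)
    rw [mul_assoc, (hη.hasseMonomial_commute_lmul hk).eq, ← mul_assoc, ← mul_assoc,
      (lmul_commute a (t i)).eq]
  · convert! h using 6 with x hx k hk
    change Algebra.lmul V A (levelFactor p m k • a k) * _ = _
    rw [levelMonomial, map_nsmul, smul_mul_assoc, mul_smul_comm]

/-- Here `S` is everything. Independence on this side makes the right coefficients of an operator
well defined. -/
theorem right_independent (hη : HasseCoordinates t η)
    (s : Finset (Fin n → ℕ)) (a : (Fin n → ℕ) → A)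
    (h : ∑ k ∈ s, levelMonomial η p m k * Algebra.lmul V A (a k) = 0) :
    ∀ k ∈ s, a k = 0 := by
  have := eq_zero_of_commutator (t := t)
    (fun k => (AddMonoidHom.mulLeft (hasseMonomial η k)).comp
      (Algebra.lmul V A : A →+ Module.End V A)) ?_ ?_ ?_ (S := ⊤) (fun _ => Algebra.mem_top) s
      (fun k => levelFactor p m k • a k) ?_
  · intro k hk
    exact nsmul_right_injective (levelFactor_ne_zero p m k)
      ((this k hk).trans (nsmul_zero _).symm)
  · intro a
    change _ * Algebra.lmul V A a = _
    rw [hη.hasseMonomial_zero, one_mul]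
  · intro k i a
    change _ * Algebra.lmul V A a * _ = _ * (_ * Algebra.lmul V A a) + _ * Algebra.lmul V A a
    rw [mul_assoc, (lmul_commute a (t i)).eq, ← mul_assoc, hη.hasseMonomial_mul_lmul, add_mul,
      mul_assoc]
  · intro k i a hk
    change _ * Algebra.lmul V A a * _ = _ * (_ * Algebra.lmul V A a)
    rw [mul_assoc, (lmul_commute a (t i)).eq, ← mul_assoc, (hη.hasseMonomial_commute_lmul hk).eq,
      mul_assoc]
  · intro x _
    rw [← LinearMap.zero_apply (σ₁₂ := RingHom.id V) (M₂ := A) x, ← h]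
    congr 1
    refine Finset.sum_congr rfl fun k hk => ?_
    change _ * Algebra.lmul V A (levelFactor p m k • a k) = _
    rw [levelMonomial, map_nsmul, smul_mul_assoc, mul_smul_comm]

end HasseCoordinates

end LevelMonomial

/-! ### The maps `A ⊗_R S → T` and `S ⊗_R A → T` -/

section ExtensionMap

variable {R S A T : Type*} [CommRing R] [Ring S] [CommRing A] [Algebra R A] [Ring T]
  {ι : R →+* S} {α : A →+* T} {ψ : S →+* T}

/-- The map `A ⊗_R S → T`, `a ⊗ s ↦ α a * ψ s`. -/
def leftExtensionMap (h : ∀ r, ψ (ι r) = α (algebraMap R A r)) : A ⊗[R] LeftMul ι →+ T :=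
  TensorProduct.liftAddHom
    (AddMonoidHom.mk' (fun a => ((AddMonoidHom.mulLeft (α a)).comp (ψ : S →+ T) : LeftMul ι →+ T))
      fun a b => AddMonoidHom.ext fun s => by
        change α (a + b) * ψ s = α a * ψ s + α b * ψ s
        rw [map_add, add_mul])
    fun r a s => by
      change α (r • a) * ψ s = α a * ψ (ι r * (show S from s))
      rw [map_mul, h, ← mul_assoc, ← map_mul, Algebra.smul_def, mul_comm a]

theorem leftExtensionMap_tmul (h : ∀ r, ψ (ι r) = α (algebraMap R A r)) (a : A) (s : S) :
    leftExtensionMap h (a ⊗ₜ[R] (show LeftMul ι from s)) = α a * ψ s := rfl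

/-- The map `S ⊗_R A → T`, `s ⊗ a ↦ ψ s * α a`. -/
def rightExtensionMap (h : ∀ r, ψ (ι r) = α (algebraMap R A r)) : RightMul ι ⊗[R] A →+ T :=
  TensorProduct.liftAddHom
    (AddMonoidHom.mk' (fun s : RightMul ι => ((AddMonoidHom.mulLeft (ψ (show S from s))).comp
        (α : A →+ T) : A →+ T))
      fun s s' => AddMonoidHom.ext fun a => by
        change ψ ((show S from s) + (show S from s')) * α a =
          ψ (show S from s) * α a + ψ (show S from s') * α a
        rw [map_add, add_mul])
    fun r s a => by
      change ψ ((show S from s) * ι r) * α a = ψ (show S from s) * α (r • a)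
      rw [map_mul, h, mul_assoc, ← map_mul, Algebra.smul_def]

theorem rightExtensionMap_tmul (h : ∀ r, ψ (ι r) = α (algebraMap R A r)) (s : S) (a : A) :
    rightExtensionMap h ((show RightMul ι from s) ⊗ₜ[R] a) = ψ s * α a := rfl

theorem isLeftExtensionIso_iff (h : ∀ r, ψ (ι r) = α (algebraMap R A r)) :
    IsLeftExtensionIso ι α ψ ↔ Function.Bijective (leftExtensionMap h) := by
  constructor
  · rintro ⟨θ, hθ⟩
    have : leftExtensionMap h = θ.toAddMonoidHom := by
      ext x
      induction x using TensorProduct.induction_on with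
      | zero => rw [map_zero, map_zero]
      | tmul a s => exact (hθ a s).symm
      | add x y hx hy => rw [map_add, map_add, hx, hy]
    rw [this]
    exact θ.bijective
  · exact fun hb => ⟨AddEquiv.ofBijective _ hb, fun a s => leftExtensionMap_tmul h a s⟩

theorem isRightExtensionIso_iff (h : ∀ r, ψ (ι r) = α (algebraMap R A r)) :
    IsRightExtensionIso ι α ψ ↔ Function.Bijective (rightExtensionMap h) := by
  constructor
  · rintro ⟨θ, hθ⟩
    have : rightExtensionMap h = θ.toAddMonoidHom := by
      ext x
      induction x using TensorProduct.induction_on with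
      | zero => rw [map_zero, map_zero]
      | tmul s a => exact (hθ s a).symm
      | add x y hx hy => rw [map_add, map_add, hx, hy]
    rw [this]
    exact θ.bijective
  · exact fun hb => ⟨AddEquiv.ofBijective _ hb, fun s a => rightExtensionMap_tmul h s a⟩

variable {I : Type*} [Fintype I] {e : I → A} {e' : I → A →ₗ[R] R}

/-- The inverse is `z ↦ ∑ e i ⊗ F i z`: on pure tensors `hF` moves the scalar `e' i a` across the
tensor sign and the dual basis identity `he` finishes; the other composite is `hF'`. -/
theorem isLeftExtensionIso_of_coeff (h : ∀ r, ψ (ι r) = α (algebraMap R A r))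
    (he : ∀ a, ∑ i, e' i a • e i = a) (F : I → T →+ S)
    (hF : ∀ i a s, F i (α a * ψ s) = ι (e' i a) * s) (hF' : ∀ z, ∑ i, α (e i) * ψ (F i z) = z) :
    IsLeftExtensionIso ι α ψ := by
  rw [isLeftExtensionIso_iff h, Function.bijective_iff_has_inverse]
  refine ⟨fun z => ∑ i, e i ⊗ₜ[R] (show LeftMul ι from F i z), fun x => ?_, fun z => ?_⟩
  · induction x using TensorProduct.induction_on with
    | zero =>
      refine Finset.sum_eq_zero fun i _ => ?_
      rw [map_zero, map_zero]
      exact TensorProduct.tmul_zero _ _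
    | tmul a s =>
      conv_rhs => rw [← he a, TensorProduct.sum_tmul]
      refine Finset.sum_congr rfl fun i _ => ?_
      rw [TensorProduct.smul_tmul]
      exact congrArg (fun y : LeftMul ι => e i ⊗ₜ[R] y) (hF i a s)
    | add x y hx hy =>
      conv_rhs => rw [← hx, ← hy, ← Finset.sum_add_distrib]
      refine Finset.sum_congr rfl fun i _ => ?_
      rw [map_add, map_add]
      exact TensorProduct.tmul_add _ _ _
  · rw [map_sum]
    exact hF' z

theorem isRightExtensionIso_of_coeff (h : ∀ r, ψ (ι r) = α (algebraMap R A r))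
    (he : ∀ a, ∑ i, e' i a • e i = a) (F : I → T →+ S)
    (hF : ∀ i a s, F i (ψ s * α a) = s * ι (e' i a)) (hF' : ∀ z, ∑ i, ψ (F i z) * α (e i) = z) :
    IsRightExtensionIso ι α ψ := by
  rw [isRightExtensionIso_iff h, Function.bijective_iff_has_inverse]
  refine ⟨fun z => ∑ i, (show RightMul ι from F i z) ⊗ₜ[R] e i, fun x => ?_, fun z => ?_⟩
  · induction x using TensorProduct.induction_on with
    | zero =>
      refine Finset.sum_eq_zero fun i _ => ?_
      rw [map_zero, map_zero]
      exact TensorProduct.zero_tmul _ _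
    | tmul s a =>
      conv_rhs => rw [← he a, TensorProduct.tmul_sum]
      refine Finset.sum_congr rfl fun i _ => ?_
      rw [← TensorProduct.smul_tmul]
      exact congrArg (fun y : RightMul ι => y ⊗ₜ[R] e i) (hF i a s)
    | add x y hx hy =>
      conv_rhs => rw [← hx, ← hy, ← Finset.sum_add_distrib]
      refine Finset.sum_congr rfl fun i _ => ?_
      rw [map_add, map_add]
      exact TensorProduct.add_tmul _ _ _
  · rw [map_sum]
    exact hF' z

end ExtensionMap

/-! ### Scalar extension commutes with weak completion along finite projective extensions -/

section Extension

variable {V : Type*} [CommRing V] (π : V) {R A : Type*} [CommRing R] [Algebra V R] [CommRing A]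
  [Algebra V A] [Algebra R A] {B C : Type*} [Ring B] [Algebra V B] [Ring C] [Algebra V C]
  (ι : R →ₐ[V] C) (α : A →ₐ[V] B) (ψ : C →ₐ[V] B)

/-- The coefficient maps `E i` are right linear over `C` and reconstruct `b` as `∑ e i * E i b`.
Both facts hold on the spanning products and give linear growth of `E i`; the extensions to the weak
completions inherit the identities and invert the canonical map. -/
theorem isLeftExtensionIso_weakCompletion (hψ : ∀ r, ψ (ι r) = α (algebraMap R A r))
    {I : Type*} [Fintype I] (e : I → A) (e' : I → A →ₗ[R] R) (he : ∀ a, ∑ i, e' i a • e i = a)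
    (E : I → B →ₗ[V] C) (hE : ∀ i a P, E i (α a * ψ P) = ι (e' i a) * P)
    (hspan : ∀ b, b ∈ Submodule.span V (Set.range fun aP : A × C => α aP.1 * ψ aP.2)) :
    IsLeftExtensionIso ((toWeakCompletion π C).comp ι).toRingHom
      ((toWeakCompletion π B).comp α).toRingHom
      (weakCompletionMap π ψ).toRingHom := by
  classical
  have hEψ : ∀ i b Q, E i (b * ψ Q) = E i b * Q := by
    intro i b Q
    induction hspan b using Submodule.span_induction with
    | mem b hb =>
      obtain ⟨⟨a, P⟩, rfl⟩ := hb
      simp only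
      rw [mul_assoc, ← map_mul, hE, hE, mul_assoc]
    | zero => simp
    | add x y _ _ hx hy => rw [add_mul, map_add, hx, hy, map_add, add_mul]
    | smul v x _ hx => rw [smul_mul_assoc, map_smul, hx, map_smul, smul_mul_assoc]
  have hrec : ∀ b, ∑ i, α (e i) * ψ (E i b) = b := by
    intro b
    induction hspan b using Submodule.span_induction with
    | mem b hb =>
      obtain ⟨⟨a, P⟩, rfl⟩ := hb
      simp only
      conv_rhs => rw [← he a, map_sum, Finset.sum_mul]
      refine Finset.sum_congr rfl fun i _ => ?_
      rw [hE, map_mul, hψ, ← mul_assoc, ← map_mul, Algebra.smul_def, mul_comm (e i)]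
    | zero => simp
    | add x y _ _ hx hy =>
      simp only [map_add, mul_add, Finset.sum_add_distrib, hx, hy]
    | smul v x _ hx => simp only [map_smul, mul_smul_comm, ← Finset.smul_sum, hx]
  have hgrowth : ∀ i, HasLinearGrowth (E i) := by
    intro i
    -- The matrix `E i (b e j)` describes left multiplication by `b` in terms of the dual basis.
    -- Inserting the reconstruction of `b e j` between two factors gives multiplicativity, and `1 =
    -- ∑ e' j 1 • e j` recovers `E i b` from row `i`.
    refine hasLinearGrowth_of_matrix (fun i j => E i ∘ₗ LinearMap.mulRight V (α (e j))) ?_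
      (Pi.single i 1) (fun j => ι (e' j 1)) (E i) ?_
    · intro i j a b
      simp only [LinearMap.comp_apply, LinearMap.mulRight_apply]
      conv_lhs => rw [mul_assoc, ← hrec (b * α (e j)), Finset.mul_sum, map_sum]
      refine Finset.sum_congr rfl fun k _ => ?_
      rw [← mul_assoc, hEψ]
    · intro b
      rw [Finset.sum_eq_single_of_mem i (Finset.mem_univ i)]
      · simp only [Pi.single_eq_same, one_mul, LinearMap.comp_apply, LinearMap.mulRight_apply,
          ← hEψ]
        rw [← map_sum]
        congr 1
        simp only [mul_assoc, ← Finset.mul_sum]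
        rw [← mul_one b]
        congr 1
        · rw [mul_one]
        · conv_lhs => rw [← map_one α, ← he 1, map_sum]
          refine Finset.sum_congr rfl fun j _ => ?_
          rw [hψ, ← map_mul, Algebra.smul_def, mul_comm]
      · intro j _ hj
        simp [Pi.single_eq_of_ne hj]
  choose F hF using fun i => (hgrowth i).exists_extension π
  let α' : A →+* WeakCompletion π B := ((toWeakCompletion π B).comp α).toRingHom
  let ι' : R →+* WeakCompletion π C := ((toWeakCompletion π C).comp ι).toRingHom
  have hα' : ∀ j a, WeakCompletion.residue π j (α' a) = Ideal.Quotient.mk _ (α a) := fun _ _ => rfl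
  have hι' : ∀ j r, WeakCompletion.residue π j (ι' r) = Ideal.Quotient.mk _ (ι r) := fun _ _ => rfl
  have hψ' : ∀ r, weakCompletionMap π ψ (ι' r) = α' (algebraMap R A r) := fun r =>
    WeakCompletion.ext_residue fun j => by
      rw [WeakCompletion.residue_map ψ (hι' j r), hα', hψ]
  -- Both identities are compared modulo `π ^ j`, on representatives in `B` and `C`.
  refine isLeftExtensionIso_of_coeff hψ' he (fun i => (F i).toAddMonoidHom) (fun i a s => ?_)
    fun z => ?_
  · refine WeakCompletion.ext_residue fun j => ?_
    obtain ⟨P, hP⟩ := WeakCompletion.exists_residue_eq j s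
    refine (hF i j _ (α a * ψ P) ?_).trans ?_
    · rw [map_mul, map_mul, ← hα']
      exact congrArg (_ * ·) (WeakCompletion.residue_map ψ hP)
    · rw [hE, map_mul, map_mul, hP]
      rfl
  · refine WeakCompletion.ext_residue fun j => ?_
    obtain ⟨b, hb⟩ := WeakCompletion.exists_residue_eq j z
    rw [hb, map_sum]
    conv_rhs => rw [← hrec b, map_sum]
    refine Finset.sum_congr rfl fun i _ => ?_
    rw [map_mul, map_mul, ← hα']
    exact congrArg (_ * ·) (WeakCompletion.residue_map ψ (hF i j z b hb))

/-- Now the `E i` are left linear over `C`, so the multiplicative matrix is `E j (e i b)`, and the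
vector of the `e' j 1` moves to the left. -/
theorem isRightExtensionIso_weakCompletion (hψ : ∀ r, ψ (ι r) = α (algebraMap R A r))
    {I : Type*} [Fintype I] (e : I → A) (e' : I → A →ₗ[R] R) (he : ∀ a, ∑ i, e' i a • e i = a)
    (E : I → B →ₗ[V] C) (hE : ∀ i a P, E i (ψ P * α a) = P * ι (e' i a))
    (hspan : ∀ b, b ∈ Submodule.span V (Set.range fun aP : A × C => ψ aP.2 * α aP.1)) :
    IsRightExtensionIso ((toWeakCompletion π C).comp ι).toRingHom
      ((toWeakCompletion π B).comp α).toRingHom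
      (weakCompletionMap π ψ).toRingHom := by
  classical
  have hEψ : ∀ i b Q, E i (ψ Q * b) = Q * E i b := by
    intro i b Q
    induction hspan b using Submodule.span_induction with
    | mem b hb =>
      obtain ⟨⟨a, P⟩, rfl⟩ := hb
      simp only
      rw [← mul_assoc, ← map_mul, hE, hE, mul_assoc]
    | zero => simp
    | add x y _ _ hx hy => rw [mul_add, map_add, hx, hy, map_add, mul_add]
    | smul v x _ hx => rw [mul_smul_comm, map_smul, hx, map_smul, mul_smul_comm]
  have hrec : ∀ b, ∑ i, ψ (E i b) * α (e i) = b := by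
    intro b
    induction hspan b using Submodule.span_induction with
    | mem b hb =>
      obtain ⟨⟨a, P⟩, rfl⟩ := hb
      simp only
      conv_rhs => rw [← he a, map_sum, Finset.mul_sum]
      refine Finset.sum_congr rfl fun i _ => ?_
      rw [hE, map_mul, hψ, mul_assoc, ← map_mul, Algebra.smul_def]
    | zero => simp
    | add x y _ _ hx hy =>
      simp only [map_add, add_mul, Finset.sum_add_distrib, hx, hy]
    | smul v x _ hx => simp only [map_smul, smul_mul_assoc, ← Finset.smul_sum, hx]
  have hgrowth : ∀ i, HasLinearGrowth (E i) := by
    intro i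
    refine hasLinearGrowth_of_matrix (fun i j => E j ∘ₗ LinearMap.mulLeft V (α (e i))) ?_
      (fun j => ι (e' j 1)) (Pi.single i 1) (E i) ?_
    · intro i j a b
      simp only [LinearMap.comp_apply, LinearMap.mulLeft_apply]
      conv_lhs => rw [← mul_assoc, ← hrec (α (e i) * a), Finset.sum_mul, map_sum]
      refine Finset.sum_congr rfl fun k _ => ?_
      rw [mul_assoc, hEψ]
    · intro b
      rw [Finset.sum_comm, Finset.sum_eq_single_of_mem i (Finset.mem_univ i)]
      · simp only [Pi.single_eq_same, mul_one, LinearMap.comp_apply, LinearMap.mulLeft_apply,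
          ← hEψ]
        rw [← map_sum]
        congr 1
        simp only [← mul_assoc, ← Finset.sum_mul]
        rw [← one_mul b]
        congr 1
        · conv_lhs => rw [← map_one α, ← he 1, map_sum]
          refine Finset.sum_congr rfl fun j _ => ?_
          rw [hψ, ← map_mul, Algebra.smul_def]
        · rw [one_mul]
      · intro j _ hj
        simp [Pi.single_eq_of_ne hj]
  choose F hF using fun i => (hgrowth i).exists_extension π
  let α' : A →+* WeakCompletion π B := ((toWeakCompletion π B).comp α).toRingHom
  let ι' : R →+* WeakCompletion π C := ((toWeakCompletion π C).comp ι).toRingHom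
  have hα' : ∀ j a, WeakCompletion.residue π j (α' a) = Ideal.Quotient.mk _ (α a) := fun _ _ => rfl
  have hι' : ∀ j r, WeakCompletion.residue π j (ι' r) = Ideal.Quotient.mk _ (ι r) := fun _ _ => rfl
  have hψ' : ∀ r, weakCompletionMap π ψ (ι' r) = α' (algebraMap R A r) := fun r =>
    WeakCompletion.ext_residue fun j => by
      rw [WeakCompletion.residue_map ψ (hι' j r), hα', hψ]
  refine isRightExtensionIso_of_coeff hψ' he (fun i => (F i).toAddMonoidHom) (fun i a s => ?_)
    fun z => ?_
  · refine WeakCompletion.ext_residue fun j => ?_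
    obtain ⟨P, hP⟩ := WeakCompletion.exists_residue_eq j s
    refine (hF i j _ (ψ P * α a) ?_).trans ?_
    · rw [map_mul, map_mul, ← hα']
      exact congrArg (· * _) (WeakCompletion.residue_map ψ hP)
    · rw [hE, map_mul, map_mul, hP]
      rfl
  · refine WeakCompletion.ext_residue fun j => ?_
    obtain ⟨b, hb⟩ := WeakCompletion.exists_residue_eq j z
    rw [hb, map_sum]
    conv_rhs => rw [← hrec b, map_sum]
    refine Finset.sum_congr rfl fun i _ => ?_
    rw [map_mul, map_mul, ← hα']
    exact congrArg (· * _) (WeakCompletion.residue_map ψ (hF i j z b hb))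

end Extension

/-! ### Extension of differential operators -/

section ExtendOperators

universe u v w

variable {V : Type u} [CommRing V] {R : Type v} [CommRing R] [Algebra V R] {A : Type w} [CommRing A]
  [Algebra V A] {n : ℕ}

theorem List.prod_ofFn_apply_algebraMap [Algebra R A] {n : ℕ} (f : Fin n → Module.End V R)
    (g : Fin n → Module.End V A) (h : ∀ i r, g i (algebraMap R A r) = algebraMap R A (f i r)) (r : R) :
    (List.ofFn g).prod (algebraMap R A r) = algebraMap R A ((List.ofFn f).prod r) := by
  induction n with
  | zero => simp
  | succ n ih =>
    rw [List.ofFn_succ, List.ofFn_succ, List.prod_cons, List.prod_cons, Module.End.mul_apply,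
      Module.End.mul_apply, ih _ _ fun i r => h i.succ r, h]

theorem levelMonomial_algebraMap [Algebra R A] {η : Fin n → ℕ → Module.End V R}
    {η' : Fin n → ℕ → Module.End V A}
    (h : ∀ i k r, η' i k (algebraMap R A r) = algebraMap R A (η i k r)) (p m : ℕ) (k : Fin n → ℕ)
    (r : R) : levelMonomial η' p m k (algebraMap R A r) = algebraMap R A (levelMonomial η p m k r) := by
  rw [levelMonomial, levelMonomial, LinearMap.smul_apply, LinearMap.smul_apply, map_nsmul]
  congr 1
  exact List.prod_ofFn_apply_algebraMap _ _ (fun i => h i (k i)) r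

/-- The finite sum `∑ a_k ∂^<k>`. -/
noncomputable def leftSum (η : Fin n → ℕ → Module.End V A) (p m : ℕ) :
    ((Fin n → ℕ) →₀ A) →ₗ[V] Module.End V A :=
  Finsupp.lsum V fun k => LinearMap.mulRight V (levelMonomial η p m k) ∘ₗ (Algebra.lmul V A).toLinearMap

/-- The finite sum `∑ ∂^<k> a_k`. -/
noncomputable def rightSum (η : Fin n → ℕ → Module.End V A) (p m : ℕ) :
    ((Fin n → ℕ) →₀ A) →ₗ[V] Module.End V A :=
  Finsupp.lsum V fun k => LinearMap.mulLeft V (levelMonomial η p m k) ∘ₗ (Algebra.lmul V A).toLinearMap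

theorem leftSum_single (η : Fin n → ℕ → Module.End V A) (p m : ℕ) (k : Fin n → ℕ) (a : A) :
    leftSum η p m (Finsupp.single k a) = Algebra.lmul V A a * levelMonomial η p m k := by
  rw [leftSum, Finsupp.lsum_single]
  rfl

theorem rightSum_single (η : Fin n → ℕ → Module.End V A) (p m : ℕ) (k : Fin n → ℕ) (a : A) :
    rightSum η p m (Finsupp.single k a) = levelMonomial η p m k * Algebra.lmul V A a := by
  rw [rightSum, Finsupp.lsum_single]
  rfl

namespace HasseCoordinates

variable [IsAddTorsionFree A] {p m : ℕ} {t : Fin n → A} {η : Fin n → ℕ → Module.End V A}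

theorem exists_leftSum_eq [Fact p.Prime] (hp : ∀ u : ℕ, ¬ p ∣ u → IsUnit (u : V))
    (hη : HasseCoordinates t η) {P : Module.End V A} (hP : P ∈ diffOp V p m t) :
    ∃ x, leftSum η p m x = P := by
  refine (Submodule.span_le (p := LinearMap.range (leftSum η p m))).2 ?_ (hη.mem_span_left hp hP)
  rintro _ ⟨⟨a, k⟩, rfl⟩
  exact ⟨Finsupp.single k a, leftSum_single η p m k a⟩

theorem exists_rightSum_eq [Fact p.Prime] (hp : ∀ u : ℕ, ¬ p ∣ u → IsUnit (u : V))
    (hη : HasseCoordinates t η) {P : Module.End V A} (hP : P ∈ diffOp V p m t) :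
    ∃ x, rightSum η p m x = P := by
  refine (Submodule.span_le (p := LinearMap.range (rightSum η p m))).2 ?_ (hη.mem_span_right hp hP)
  rintro _ ⟨⟨a, k⟩, rfl⟩
  exact ⟨Finsupp.single k a, rightSum_single η p m k a⟩

theorem rightSum_mem (hη : HasseCoordinates t η) (x : (Fin n → ℕ) →₀ A) :
    rightSum η p m x ∈ diffOp V p m t := by
  induction x using Finsupp.induction_linear with
  | zero => rw [map_zero]; exact zero_mem _
  | add x y hx hy => rw [map_add]; exact add_mem hx hy
  | single k a =>
    rw [rightSum_single]
    exact mul_mem (hη.levelMonomial_mem p m k) (Algebra.subset_adjoin (Or.inl ⟨a, rfl⟩))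

theorem rightSum_injective (hη : HasseCoordinates t η) : Function.Injective (rightSum η p m) := by
  rw [injective_iff_map_eq_zero]
  intro x hx
  ext k
  by_cases hk : k ∈ x.support
  · exact hη.right_independent (p := p) (m := m) x.support x hx k hk
  · exact Finsupp.notMem_support_iff.1 hk

/-- A differential operator is determined by its restriction to a subalgebra containing the
coordinates. -/
theorem eq_of_eqOn [Fact p.Prime] (hp : ∀ u : ℕ, ¬ p ∣ u → IsUnit (u : V))
    (hη : HasseCoordinates t η) {S : Subalgebra V A} (hS : ∀ i, t i ∈ S) {P Q : Module.End V A}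
    (hP : P ∈ diffOp V p m t) (hQ : Q ∈ diffOp V p m t) (h : ∀ a ∈ S, P a = Q a) : P = Q := by
  obtain ⟨x, hx⟩ := hη.exists_leftSum_eq hp (sub_mem hP hQ)
  have hx0 : x = 0 := by
    ext k
    by_cases hk : k ∈ x.support
    · refine hη.left_independent (p := p) (m := m) hS x.support x (fun a ha => ?_) k hk
      change leftSum η p m x a = 0
      rw [hx, LinearMap.sub_apply, h a ha, sub_self]
    · exact Finsupp.notMem_support_iff.1 hk
  rw [hx0, map_zero] at hx
  exact (sub_eq_zero.1 hx.symm)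

end HasseCoordinates

variable [Algebra R A] [IsScalarTower V R A] [IsAddTorsionFree A] {p m : ℕ}
  {t : Fin n → R} {u : Fin n → A} {η : Fin n → ℕ → Module.End V R}
  {η' : Fin n → ℕ → Module.End V A}

theorem HasseCoordinates.eq_of_algebraMap [Fact p.Prime] (hp : ∀ u : ℕ, ¬ p ∣ u → IsUnit (u : V))
    (hη' : HasseCoordinates u η') (hu : ∀ i, u i = algebraMap R A (t i)) (P Q : diffOp V p m u)
    (h : ∀ r, (P : Module.End V A) (algebraMap R A r) = (Q : Module.End V A) (algebraMap R A r)) :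
    P = Q :=
  Subtype.ext (hη'.eq_of_eqOn hp (S := (IsScalarTower.toAlgHom V R A).range)
    (fun i => ⟨t i, (hu i).symm⟩) P.2 Q.2 (by rintro _ ⟨r, rfl⟩; exact h r))

/-- Functions and the `∂^<k>` extend from `R` to `A`, hence so does every operator, by sums and
products. The extension is unique, so the pointwise choice is a homomorphism: both sides of each
identity to be checked agree on the image of `R`. -/
theorem existsUnique_extendsOperators [IsAddTorsionFree R] [Fact p.Prime] (hp : ∀ u : ℕ, ¬ p ∣ u → IsUnit (u : V))
    (hη : HasseCoordinates t η) (hη' : HasseCoordinates u η')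
    (hu : ∀ i, u i = algebraMap R A (t i))
    (hηη' : ∀ i k r, η' i k (algebraMap R A r) = algebraMap R A (η i k r)) :
    ∃! ψ : diffOp V p m t →ₐ[V] diffOp V p m u, ExtendsOperators (R := R) (A := A) ψ := by
  have hex : ∀ P : diffOp V p m t, ∃ Q : diffOp V p m u, ∀ r,
      (Q : Module.End V A) (algebraMap R A r) = algebraMap R A ((P : Module.End V R) r) := by
    suffices ∀ P ∈ diffOp V p m t, ∃ Q ∈ diffOp V p m u, ∀ r,
        Q (algebraMap R A r) = algebraMap R A (P r) by
      rintro ⟨P, hP⟩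
      obtain ⟨Q, hQ, h⟩ := this P hP
      exact ⟨⟨Q, hQ⟩, h⟩
    rw [hη.diffOp_eq]
    intro P hP
    induction hP using Algebra.adjoin_induction with
    | mem P hP =>
      rcases hP with ⟨a, rfl⟩ | ⟨k, rfl⟩
      · exact ⟨Algebra.lmul V A (algebraMap R A a), Algebra.subset_adjoin (Or.inl ⟨_, rfl⟩),
          fun r => (map_mul (algebraMap R A) a r).symm⟩
      · exact ⟨_, hη'.levelMonomial_mem p m k, levelMonomial_algebraMap hηη' p m k⟩
    | algebraMap v =>
      refine ⟨algebraMap V _ v, Subalgebra.algebraMap_mem _ v, fun r => ?_⟩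
      rw [Module.algebraMap_end_apply, Module.algebraMap_end_apply, algebraMap.smul]
    | add P P' _ _ h h' =>
      obtain ⟨Q, hQ, h⟩ := h
      obtain ⟨Q', hQ', h'⟩ := h'
      exact ⟨Q + Q', add_mem hQ hQ', fun r => by
        rw [LinearMap.add_apply, LinearMap.add_apply, map_add, h, h']⟩
    | mul P P' _ _ h h' =>
      obtain ⟨Q, hQ, h⟩ := h
      obtain ⟨Q', hQ', h'⟩ := h'
      exact ⟨Q * Q', mul_mem hQ hQ', fun r => by
        rw [Module.End.mul_apply, Module.End.mul_apply, h', h]⟩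
  choose f hf using hex
  have huniq := hη'.eq_of_algebraMap (m := m) hp hu
  refine ⟨AlgHom.ofLinearMap ⟨⟨f, fun P Q => huniq _ _ fun r => ?_⟩,
    fun v P => huniq _ _ fun r => ?_⟩ (huniq _ _ fun r => ?_) fun P Q => huniq _ _ fun r => ?_,
    fun P r => hf P r, fun ψ hψ => AlgHom.ext fun P => huniq _ _ fun r => ?_⟩
  · rw [hf]
    change _ = (f P : Module.End V A) _ + (f Q : Module.End V A) _
    rw [hf, hf, ← map_add]
    rfl
  · rw [hf]
    change _ = v • (f P : Module.End V A) _
    rw [hf, ← algebraMap.smul]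
    rfl
  · exact hf 1 r
  · change (f (P * Q) : Module.End V A) _ = (f P : Module.End V A) ((f Q : Module.End V A) _)
    rw [hf, hf, hf]
    rfl
  · exact (hψ P r).trans (hf P r).symm

end ExtendOperators

/-! ### Scalar extension of the rings of differential operators of level `m` -/

section Subalgebra

variable {V : Type*} [CommRing V] (π : V) {R A : Type*} [CommRing R] [Algebra V R] [CommRing A]
  [Algebra V A] [Algebra R A] {B₀ C₀ : Type*} [Ring B₀] [Algebra V B₀] [Ring C₀] [Algebra V C₀]
  (B : Subalgebra V B₀) (C : Subalgebra V C₀) (ι : R →ₐ[V] C) (α : A →ₐ[V] B) (ψ : C →ₐ[V] B)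

theorem isLeftExtensionIso_weakCompletion_subalgebra (hψ : ∀ r, ψ (ι r) = α (algebraMap R A r))
    {I : Type*} [Fintype I] (e : I → A) (e' : I → A →ₗ[R] R) (he : ∀ a, ∑ i, e' i a • e i = a)
    (E : I → B →ₗ[V] C) (hE : ∀ i a P, E i (α a * ψ P) = ι (e' i a) * P)
    (hspan : ∀ b, b ∈ Submodule.span V (Set.range fun aP : A × C => α aP.1 * ψ aP.2)) :
    IsLeftExtensionIso ((toWeakCompletion π C).comp ι).toRingHom
      ((toWeakCompletion π B).comp α).toRingHom (weakCompletionMap π ψ).toRingHom :=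
  isLeftExtensionIso_weakCompletion π ι α ψ hψ e e' he E hE hspan

theorem isRightExtensionIso_weakCompletion_subalgebra (hψ : ∀ r, ψ (ι r) = α (algebraMap R A r))
    {I : Type*} [Fintype I] (e : I → A) (e' : I → A →ₗ[R] R) (he : ∀ a, ∑ i, e' i a • e i = a)
    (E : I → B →ₗ[V] C) (hE : ∀ i a P, E i (ψ P * α a) = P * ι (e' i a))
    (hspan : ∀ b, b ∈ Submodule.span V (Set.range fun aP : A × C => ψ aP.2 * α aP.1)) :
    IsRightExtensionIso ((toWeakCompletion π C).comp ι).toRingHom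
      ((toWeakCompletion π B).comp α).toRingHom (weakCompletionMap π ψ).toRingHom :=
  isRightExtensionIso_weakCompletion π ι α ψ hψ e e' he E hE hspan

end Subalgebra

section LevelExtension

universe u v w

variable {V : Type u} [CommRing V] {R : Type v} [CommRing R] [Algebra V R] {A : Type w} [CommRing A]
  [Algebra V A] {n : ℕ} [Algebra R A] [IsScalarTower V R A] [IsAddTorsionFree A]
  {p : ℕ} [Fact p.Prime] {m : ℕ}
  {t : Fin n → R} {u : Fin n → A} {η : Fin n → ℕ → Module.End V R}
  {η' : Fin n → ℕ → Module.End V A} {ψ : diffOp V p m t →ₐ[V] diffOp V p m u}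

theorem ExtendsOperators.map_funToDiffOp (hp : ∀ u : ℕ, ¬ p ∣ u → IsUnit (u : V))
    (hη' : HasseCoordinates u η') (hu : ∀ i, u i = algebraMap R A (t i))
    (hψ : ExtendsOperators (R := R) (A := A) ψ) (r : R) :
    ψ (funToDiffOp V p m t r) = funToDiffOp V p m u (algebraMap R A r) :=
  hη'.eq_of_algebraMap hp hu _ _ fun s => (hψ _ s).trans (map_mul (algebraMap R A) r s)

variable [IsAddTorsionFree R]

theorem ExtendsOperators.map_levelMonomial (hp : ∀ u : ℕ, ¬ p ∣ u → IsUnit (u : V))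
    (hη : HasseCoordinates t η) (hη' : HasseCoordinates u η')
    (hu : ∀ i, u i = algebraMap R A (t i))
    (hηη' : ∀ i k r, η' i k (algebraMap R A r) = algebraMap R A (η i k r))
    (hψ : ExtendsOperators (R := R) (A := A) ψ) (k : Fin n → ℕ) :
    ψ ⟨levelMonomial η p m k, hη.levelMonomial_mem p m k⟩ =
      ⟨levelMonomial η' p m k, hη'.levelMonomial_mem p m k⟩ :=
  hη'.eq_of_algebraMap hp hu _ _ fun s =>
    (hψ _ s).trans (levelMonomial_algebraMap hηη' p m k s).symm

theorem ExtendsOperators.mem_span_left (hp : ∀ u : ℕ, ¬ p ∣ u → IsUnit (u : V))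
    (hη : HasseCoordinates t η) (hη' : HasseCoordinates u η')
    (hu : ∀ i, u i = algebraMap R A (t i))
    (hηη' : ∀ i k r, η' i k (algebraMap R A r) = algebraMap R A (η i k r))
    (hψ : ExtendsOperators (R := R) (A := A) ψ) (b : diffOp V p m u) :
    b ∈ Submodule.span V (Set.range fun aP : A × diffOp V p m t =>
      funToDiffOp V p m u aP.1 * ψ aP.2) := by
  have h := hη'.mem_span_left hp b.2
  have hle : Submodule.span V (Set.range fun ak : A × (Fin n → ℕ) =>
      Algebra.lmul V A ak.1 * levelMonomial η' p m ak.2) ≤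
      (Submodule.span V (Set.range fun aP : A × diffOp V p m t =>
        funToDiffOp V p m u aP.1 * ψ aP.2)).map (diffOp V p m u).val.toLinearMap := by
    rw [Submodule.span_le]
    rintro _ ⟨⟨a, k⟩, rfl⟩
    refine ⟨_, Submodule.subset_span ⟨(a, ⟨levelMonomial η p m k, hη.levelMonomial_mem p m k⟩), rfl⟩,
      ?_⟩
    simp only [hψ.map_levelMonomial hp hη hη' hu hηη']
    rfl
  obtain ⟨b', hb', hb⟩ := hle h
  rwa [Subtype.ext hb] at hb'

theorem ExtendsOperators.mem_span_right (hp : ∀ u : ℕ, ¬ p ∣ u → IsUnit (u : V))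
    (hη : HasseCoordinates t η) (hη' : HasseCoordinates u η')
    (hu : ∀ i, u i = algebraMap R A (t i))
    (hηη' : ∀ i k r, η' i k (algebraMap R A r) = algebraMap R A (η i k r))
    (hψ : ExtendsOperators (R := R) (A := A) ψ) (b : diffOp V p m u) :
    b ∈ Submodule.span V (Set.range fun aP : A × diffOp V p m t =>
      ψ aP.2 * funToDiffOp V p m u aP.1) := by
  have h := hη'.mem_span_right hp b.2
  have hle : Submodule.span V (Set.range fun ak : A × (Fin n → ℕ) =>
      levelMonomial η' p m ak.2 * Algebra.lmul V A ak.1) ≤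
      (Submodule.span V (Set.range fun aP : A × diffOp V p m t =>
        ψ aP.2 * funToDiffOp V p m u aP.1)).map (diffOp V p m u).val.toLinearMap := by
    rw [Submodule.span_le]
    rintro _ ⟨⟨a, k⟩, rfl⟩
    refine ⟨_, Submodule.subset_span ⟨(a, ⟨levelMonomial η p m k, hη.levelMonomial_mem p m k⟩), rfl⟩,
      ?_⟩
    simp only [hψ.map_levelMonomial hp hη hη' hu hηη']
    rfl
  obtain ⟨b', hb', hb⟩ := hle h
  rwa [Subtype.ext hb] at hb'

/-- The map is `x ↦ e ∘ x ∘ (R → A)`. Operators on `A` extended from `R` preserve the image of `R`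
and `e` is `R`-linear, so `a ∂^<k>` is sent to `e a ∂^<k>`; in particular the result is again a
differential operator. -/
theorem ExtendsOperators.exists_leftCoeff (hp : ∀ u : ℕ, ¬ p ∣ u → IsUnit (u : V))
    (hη : HasseCoordinates t η) (hη' : HasseCoordinates u η')
    (hηη' : ∀ i k r, η' i k (algebraMap R A r) = algebraMap R A (η i k r))
    (hψ : ExtendsOperators (R := R) (A := A) ψ) (e : A →ₗ[R] R) :
    ∃ E : diffOp V p m u →ₗ[V] diffOp V p m t,
      ∀ a P, E (funToDiffOp V p m u a * ψ P) = funToDiffOp V p m t (e a) * P := by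
  have he : ∀ a r, e (a * algebraMap R A r) = e a * r := fun a r => by
    rw [mul_comm, ← Algebra.smul_def, map_smul, smul_eq_mul, mul_comm]
  let f : Module.End V A →ₗ[V] Module.End V R :=
    { toFun := fun x => e.restrictScalars V ∘ₗ x ∘ₗ (IsScalarTower.toAlgHom V R A).toLinearMap
      map_add' := fun x y => by rw [LinearMap.add_comp, LinearMap.comp_add]
      map_smul' := fun c x => by
        rw [LinearMap.smul_comp, LinearMap.comp_smul, RingHom.id_apply] }
  have hf : ∀ x r, f x r = e (x (algebraMap R A r)) := fun _ _ => rfl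
  have hmem : ∀ x ∈ diffOp V p m u, f x ∈ diffOp V p m t := by
    intro x hx
    refine (Submodule.span_le (p := (Subalgebra.toSubmodule (diffOp V p m t)).comap f)).2 ?_
      (hη'.mem_span_left hp hx)
    rintro _ ⟨⟨a, k⟩, rfl⟩
    have : f (Algebra.lmul V A a * levelMonomial η' p m k) =
        Algebra.lmul V R (e a) * levelMonomial η p m k := by
      ext r
      rw [hf, Module.End.mul_apply, levelMonomial_algebraMap hηη']
      exact he _ _
    change f _ ∈ diffOp V p m t
    rw [this]
    exact mul_mem (Algebra.subset_adjoin (Or.inl ⟨_, rfl⟩)) (hη.levelMonomial_mem p m k)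
  refine ⟨{ toFun := fun x => ⟨f x, hmem x x.2⟩
            map_add' := fun x y => Subtype.ext (map_add f (x : Module.End V A) y)
            map_smul' := fun c x => Subtype.ext (map_smul f c (x : Module.End V A)) },
    fun a P => Subtype.ext (LinearMap.ext fun r => ?_)⟩
  change e (a * (ψ P : Module.End V A) (algebraMap R A r)) = e a * (P : Module.End V R) r
  rw [hψ, he]

/-- On this side the map is defined on coefficients, `∑ ∂^<k> a_k ↦ ∑ ∂^<k> e(a_k)`, which requires
the right expansion to be unique. -/
theorem ExtendsOperators.exists_rightCoeff (hp : ∀ u : ℕ, ¬ p ∣ u → IsUnit (u : V))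
    (hη : HasseCoordinates t η) (hη' : HasseCoordinates u η')
    (hu : ∀ i, u i = algebraMap R A (t i))
    (hηη' : ∀ i k r, η' i k (algebraMap R A r) = algebraMap R A (η i k r))
    (hψ : ExtendsOperators (R := R) (A := A) ψ) (e : A →ₗ[R] R) :
    ∃ E : diffOp V p m u →ₗ[V] diffOp V p m t,
      ∀ a P, E (ψ P * funToDiffOp V p m u a) = P * funToDiffOp V p m t (e a) := by
  let f : ((Fin n → ℕ) →₀ A) →ₗ[V] diffOp V p m u :=
    { toFun := fun x => ⟨rightSum η' p m x, hη'.rightSum_mem x⟩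
      map_add' := fun x y => Subtype.ext (map_add _ x y)
      map_smul' := fun c x => Subtype.ext (map_smul _ c x) }
  let g : ((Fin n → ℕ) →₀ R) →ₗ[V] diffOp V p m t :=
    { toFun := fun x => ⟨rightSum η p m x, hη.rightSum_mem x⟩
      map_add' := fun x y => Subtype.ext (map_add _ x y)
      map_smul' := fun c x => Subtype.ext (map_smul _ c x) }
  have hf : Function.Bijective f := by
    refine ⟨fun x y h => hη'.rightSum_injective (congrArg Subtype.val h), fun b => ?_⟩
    obtain ⟨x, hx⟩ := hη'.exists_rightSum_eq hp b.2
    exact ⟨x, Subtype.ext hx⟩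
  let q := LinearEquiv.ofBijective f hf
  have hq : ∀ x, q.symm (f x) = x := fun x => q.symm_apply_apply x
  refine ⟨g ∘ₗ Finsupp.mapRange.linearMap (e.restrictScalars V) ∘ₗ q.symm.toLinearMap, fun a P => ?_⟩
  obtain ⟨y, hy⟩ := hη.exists_rightSum_eq hp P.2
  obtain rfl : g y = P := Subtype.ext hy
  clear hy
  induction y using Finsupp.induction_linear with
  | zero => simp only [map_zero, zero_mul]
  | add x y hx hy => simp only [map_add, add_mul, hx, hy]
  | single k r =>
    have h1 : g (Finsupp.single k r) =
        ⟨levelMonomial η p m k, hη.levelMonomial_mem p m k⟩ * funToDiffOp V p m t r :=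
      Subtype.ext (rightSum_single η p m k r)
    have h2 : ∀ a, f (Finsupp.single k a) =
        ⟨levelMonomial η' p m k, hη'.levelMonomial_mem p m k⟩ * funToDiffOp V p m u a := fun a =>
      Subtype.ext (rightSum_single η' p m k a)
    have h3 : g (Finsupp.single k (r * e a)) =
        ⟨levelMonomial η p m k, hη.levelMonomial_mem p m k⟩ * funToDiffOp V p m t (r * e a) :=
      Subtype.ext (rightSum_single η p m k _)
    -- For `P = ∂^<k> r`, the function `r` is absorbed into `a`, and the claim becomes `e (r a) = r
    -- * e a`.
    rw [h1, map_mul ψ, hψ.map_levelMonomial hp hη hη' hu hηη', hψ.map_funToDiffOp hp hη' hu, mul_assoc,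
      ← map_mul, ← h2, LinearMap.comp_apply, LinearMap.comp_apply, LinearEquiv.coe_coe, hq,
      Finsupp.mapRange.linearMap_apply, Finsupp.mapRange_single, LinearMap.restrictScalars_apply,
      ← Algebra.smul_def, map_smul, smul_eq_mul, h3, map_mul, mul_assoc]

theorem ExtendsOperators.isExtensionIso [Module.Finite R A] [Module.Projective R A] (π : V)
    (hp : ∀ u : ℕ, ¬ p ∣ u → IsUnit (u : V))
    (hη : HasseCoordinates t η) (hη' : HasseCoordinates u η')
    (hu : ∀ i, u i = algebraMap R A (t i))
    (hηη' : ∀ i k r, η' i k (algebraMap R A r) = algebraMap R A (η i k r))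
    (hψ : ExtendsOperators (R := R) (A := A) ψ) :
    IsLeftExtensionIso (funToDagLevel π p t m) (funToDagLevel π p u m) (dagLevelMap π p ψ) ∧
      IsRightExtensionIso (funToDagLevel π p t m) (funToDagLevel π p u m) (dagLevelMap π p ψ) := by
  classical
  -- A presentation of `A` as a direct summand of a free module of rank `N` gives the dual basis
  -- `e`, `e'`.
  obtain ⟨N, f, g, -, -, hfg⟩ := Module.Finite.exists_comp_eq_id_of_projective R A
  let e : Fin N → A := fun i => f (Pi.single i 1)
  let e' : Fin N → A →ₗ[R] R := fun i => LinearMap.proj i ∘ₗ g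
  have he : ∀ a, ∑ i, e' i a • e i = a := by
    intro a
    conv_rhs => rw [← LinearMap.id_apply (R := R) a, ← hfg, LinearMap.comp_apply,
      pi_eq_sum_univ' (g a), map_sum]
    refine Finset.sum_congr rfl fun i _ => ?_
    rw [map_smul]
    congr 2
  choose E hE using fun i => hψ.exists_leftCoeff hp hη hη' hηη' (e' i)
  choose E' hE' using fun i => hψ.exists_rightCoeff hp hη hη' hu hηη' (e' i)
  exact ⟨isLeftExtensionIso_weakCompletion_subalgebra π (diffOp V p m u) (diffOp V p m t)
      (funToDiffOp V p m t) (funToDiffOp V p m u) ψ (hψ.map_funToDiffOp hp hη' hu) e e' he E hE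
      (hψ.mem_span_left hp hη hη' hu hηη'),
    isRightExtensionIso_weakCompletion_subalgebra π (diffOp V p m u) (diffOp V p m t)
      (funToDiffOp V p m t) (funToDiffOp V p m u) ψ (hψ.map_funToDiffOp hp hη' hu) e e' he E' hE'
      (hψ.mem_span_right hp hη hη' hu hηη')⟩

end LevelExtension

/-! ### Finite étale algebras over the ring of functions of the weak formal affine space -/

section FiniteEtale

variable {V : Type*} [CommRing V] {π : V} (n : ℕ) {A : Type*} [CommRing A]
  [Algebra (DagPolynomial π n) A] [Module.Finite (DagPolynomial π n) A]

/-- Through this embedding `A` inherits `π`-adic separatedness and torsion-freeness from the ring of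
functions of the affine space. -/
theorem DagPolynomial.exists_injective [Module.Projective (DagPolynomial π n) A] :
    ∃ (N : ℕ) (g : A →ₗ[DagPolynomial π n] Fin N → DagPolynomial π n), Function.Injective g := by
  obtain ⟨N, f, g, -, hg, -⟩ := Module.Finite.exists_comp_eq_id_of_projective (DagPolynomial π n) A
  exact ⟨N, g, hg⟩

section

variable [Algebra V A] [IsScalarTower V (DagPolynomial π n) A]

theorem DagPolynomial.eq_zero_of_forall_smul [Module.Projective (DagPolynomial π n) A] {a : A}
    (h : ∀ j, ∃ b : A, a = π ^ j • b) : a = 0 := by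
  obtain ⟨N, g, hg⟩ := DagPolynomial.exists_injective n (π := π) (A := A)
  refine hg (funext fun i => ?_)
  rw [map_zero]
  refine WeakCompletion.eq_zero_of_forall_smul fun j => ?_
  obtain ⟨b, rfl⟩ := h j
  exact ⟨g b i, by rw [LinearMap.map_smul_of_tower]; rfl⟩

/-- A derivation of a finite étale algebra which vanishes on the coordinates is zero. -/
theorem DagPolynomial.derivation_eq_zero [Module.Projective (DagPolynomial π n) A]
    [Algebra.FormallyUnramified (DagPolynomial π n) A] (E : Derivation V A A)
    (hE : ∀ j, E (etaleCoord π n A j) = 0) : E = 0 := by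
  refine Derivation.eq_zero_of_formallyUnramified (R := DagPolynomial π n) E fun r => ?_
  have hpoly : ∀ b : MvPolynomial (Fin n) V,
      E (algebraMap (DagPolynomial π n) A (toWeakCompletion π _ b)) = 0 := by
    intro b
    let q : MvPolynomial (Fin n) V →ₐ[V] A :=
      (IsScalarTower.toAlgHom V (DagPolynomial π n) A).comp (toWeakCompletion π _)
    change E (q b) = 0
    induction b using MvPolynomial.induction_on with
    | C v =>
      rw [← MvPolynomial.algebraMap_eq, AlgHom.commutes, E.map_algebraMap]
    | add x y hx hy => rw [map_add, map_add, hx, hy, add_zero]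
    | mul_X x i hx =>
      rw [map_mul, E.leibniz, hx, smul_zero, add_zero]
      exact (congrArg (q x • ·) (hE i)).trans (smul_zero _)
  -- Every `r` is a polynomial plus `π ^ j w`, and `E` kills the polynomial, so `E r` is divisible
  -- by every `π ^ j`.
  refine DagPolynomial.eq_zero_of_forall_smul n (π := π) fun j => ?_
  obtain ⟨b, hb⟩ := WeakCompletion.exists_residue_eq j r
  obtain ⟨w, rfl⟩ := WeakCompletion.eq_toWeakCompletion_add hb
  refine ⟨E (algebraMap _ A w), ?_⟩
  rw [map_add, map_add, hpoly, zero_add, algebraMap.smul, E.map_smul]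

end

variable [IsDomain V] [IsDiscreteValuationRing V]

theorem DagPolynomial.eq_zero_of_smul_eq_zero (hπ : Irreducible π) {v : V} (hv : v ≠ 0)
    {z : DagPolynomial π n} (h : v • z = 0) : z = 0 := by
  obtain ⟨k, w, rfl⟩ := IsDiscreteValuationRing.eq_unit_mul_pow_irreducible hv hπ
  have h1 : π ^ k • z = 0 := by
    rw [mul_smul] at h
    exact (smul_eq_zero_iff_eq w).1 h
  clear h hv
  induction k with
  | zero => simpa using h1
  | succ k ih =>
    refine ih (WeakCompletion.eq_zero_of_smul_eq_zero (fun b hb => ?_)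
      (by rwa [smul_smul, ← pow_succ']))
    exact (smul_eq_zero.1 hb).resolve_left hπ.ne_zero

variable [CharZero V]

theorem DagPolynomial.isAddTorsionFree (hπ : Irreducible π) :
    IsAddTorsionFree (DagPolynomial π n) where
  nsmul_right_injective N hN x y h := by
    refine sub_eq_zero.1 (DagPolynomial.eq_zero_of_smul_eq_zero n hπ (v := (N : V))
      (Nat.cast_ne_zero.2 hN) ?_)
    rw [Nat.cast_smul_eq_nsmul, smul_sub, sub_eq_zero]
    exact h

theorem DagPolynomial.isAddTorsionFree_of_projective [Module.Projective (DagPolynomial π n) A]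
    (hπ : Irreducible π) : IsAddTorsionFree A := by
  obtain ⟨N, g, hg⟩ := DagPolynomial.exists_injective n (π := π) (A := A)
  have := DagPolynomial.isAddTorsionFree n hπ
  refine ⟨fun k hk x y h => hg (funext fun i => nsmul_right_injective hk ?_)⟩
  have := congrFun (congrArg g (show k • x = k • y from h)) i
  rw [map_nsmul, map_nsmul] at this
  exact this

variable [Algebra V A] [IsScalarTower V (DagPolynomial π n) A]

/-- Formal smoothness gives only truncated lifts `θ i N`, one for each `N`. They agree where they
overlap: `θ i N 1` is a derivation determined by its values on the coordinates, and `k ! • θ i N k`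
is its `k`-th power, which determines `θ i N k` as `A` is torsion-free. -/
theorem DagPolynomial.exists_hasseCoordinates [Module.Projective (DagPolynomial π n) A]
    [Algebra.Etale (DagPolynomial π n) A] (hπ : Irreducible π) :
    ∃ (η : Fin n → ℕ → Module.End V (DagPolynomial π n)) (η' : Fin n → ℕ → Module.End V A),
      HasseCoordinates (dagCoord π n) η ∧ HasseCoordinates (etaleCoord π n A) η' ∧
      ∀ i k r, η' i k (algebraMap _ A r) = algebraMap _ A (η i k r) := by
  have := DagPolynomial.isAddTorsionFree_of_projective n (A := A) hπ
  choose η hη h1 hX1 hX2 using exists_isHasseSchmidt_dagPolynomial (V := V) n π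
  have hU : ∀ E : Derivation V A A, (∀ j, E (etaleCoord π n A j) = 0) → E = 0 :=
    DagPolynomial.derivation_eq_zero n (π := π)
  have hUR : ∀ E : Derivation V (DagPolynomial π n) (DagPolynomial π n),
      (∀ j, E (dagCoord π n j) = 0) → E = 0 :=
    DagPolynomial.derivation_eq_zero n (π := π) (A := DagPolynomial π n)
  -- Truncation at `N + 2` keeps both the index `1`, needed for the derivation, and the index `N` in
  -- range.
  choose θ hθ hθη using fun i N => IsHasseSchmidt.exists_lift (A := A) (hη i) (h1 i) (N + 2)
    (by omega)
  have hdual : ∀ i N j, θ i N 1 (etaleCoord π n A j) = if i = j then 1 else 0 := fun i N j => by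
    rw [etaleCoord, hθη i N 1 (by omega), hX1]
    split_ifs
    · exact map_one _
    · exact map_zero _
  have hfac : ∀ i N k, k < N + 2 → ∀ a, k ! • θ i N k a = ((θ i N 1 : Module.End V A) ^ k) a := by
    intro i N k hk a
    refine (hθ i N).factorial_smul hU (fun j => ?_) (fun l hl hl2 j => ?_) k hk a
    · rw [hdual]
      split_ifs
      · exact ((hθ i N).derivation (by omega)).map_one_eq_zero
      · exact map_zero _
    · obtain ⟨l, rfl⟩ := Nat.exists_eq_add_of_le' hl2
      rw [etaleCoord, hθη i N _ hl, hX2, map_zero]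
  have hθ1 : ∀ i N M, θ i N 1 = θ i M 1 := fun i N M => by
    have := hU ((hθ i N).derivation (by omega) - (hθ i M).derivation (by omega)) fun j => by
      rw [Derivation.sub_apply]
      exact (congrArg₂ (· - ·) (hdual i N j) (hdual i M j)).trans (sub_self _)
    ext a
    exact sub_eq_zero.1 (DFunLike.congr_fun this a)
  have hθk : ∀ i N M k, k < N + 2 → k < M + 2 → θ i N k = θ i M k := fun i N M k hN hM => by
    ext a
    refine nsmul_right_injective k.factorial_ne_zero ?_
    change k ! • _ = k ! • _
    rw [hfac i N k hN, hfac i M k hM, hθ1 i N M]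
  -- The diagonal choice takes the `k`-th operator from the `k`-th lift; `hθk` lets all operators in
  -- one Leibniz formula be read in a common lift.
  refine ⟨η, fun i k => θ i k k, ⟨hη, hX1, fun i k => ?_, hUR⟩,
    ⟨fun i N => ⟨(hθ i 0).zero, fun k hk a b => ?_⟩, fun i j => hdual i 1 j, fun i k => ?_, hU⟩,
    fun i k r => hθη i k k (by omega) r⟩
  · ext a
    refine (hη i (k + 1)).factorial_smul hUR (fun j => ?_) (fun l hl hl2 j => ?_) k
      (Nat.lt_succ_self k) a
    · rw [hX1]
      split_ifs
      · exact h1 i 0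
      · exact map_zero _
    · obtain ⟨l, rfl⟩ := Nat.exists_eq_add_of_le' hl2
      exact hX2 i l j
  · rw [(hθ i k).mul k (by omega)]
    refine Finset.sum_congr rfl fun ij hij => ?_
    rw [Finset.HasAntidiagonal.mem_antidiagonal] at hij
    rw [hθk i k ij.1 ij.1 (by omega) (by omega), hθk i k ij.2 ij.2 (by omega) (by omega)]
  · ext a
    change k ! • θ i k k a = _
    rw [hfac i k k (by omega), hθ1 i k 1]

end FiniteEtale

/-! ### Scalar extension of direct limits of rings -/

section MapMul

variable {R S S' S'' A : Type*} [CommRing R] [Ring S] [Ring S'] [Ring S''] [CommRing A]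
  [Algebra R A] {ι : R →+* S} {ι' : R →+* S'} {ι'' : R →+* S''}

/-- A ring homomorphism over `R`, as an `R`-linear map for left multiplication. -/
def LeftMul.map (f : S →+* S') (hf : ∀ r, f (ι r) = ι' r) : LeftMul ι →ₗ[R] LeftMul ι' where
  toFun s := f s
  map_add' x y := map_add f x y
  map_smul' r s := (map_mul f (ι r) (show S from s)).trans (by rw [hf]; rfl)

/-- A ring homomorphism over `R`, as an `R`-linear map for right multiplication. -/
def RightMul.map (f : S →+* S') (hf : ∀ r, f (ι r) = ι' r) : RightMul ι →ₗ[R] RightMul ι' where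
  toFun s := f s
  map_add' x y := map_add f x y
  map_smul' r s := (map_mul f (show S from s) (ι r)).trans (by rw [hf]; rfl)

theorem LeftMul.lTensor_map_map {f : S →+* S'} {g : S' →+* S''} {k : S →+* S''}
    (hf : ∀ r, f (ι r) = ι' r) (hg : ∀ r, g (ι' r) = ι'' r) (hk : ∀ r, k (ι r) = ι'' r)
    (hgf : ∀ s, g (f s) = k s) (x : A ⊗[R] LeftMul ι) :
    (LeftMul.map g hg).lTensor A ((LeftMul.map f hf).lTensor A x) =
      (LeftMul.map k hk).lTensor A x := by
  rw [← LinearMap.comp_apply, ← LinearMap.lTensor_comp]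
  exact congrArg (fun h : LeftMul ι →ₗ[R] LeftMul ι'' => h.lTensor A x) (LinearMap.ext hgf)

theorem RightMul.rTensor_map_map {f : S →+* S'} {g : S' →+* S''} {k : S →+* S''}
    (hf : ∀ r, f (ι r) = ι' r) (hg : ∀ r, g (ι' r) = ι'' r) (hk : ∀ r, k (ι r) = ι'' r)
    (hgf : ∀ s, g (f s) = k s) (x : RightMul ι ⊗[R] A) :
    (RightMul.map g hg).rTensor A ((RightMul.map f hf).rTensor A x) =
      (RightMul.map k hk).rTensor A x := by
  rw [← LinearMap.comp_apply, ← LinearMap.rTensor_comp]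
  exact congrArg (fun h : RightMul ι →ₗ[R] RightMul ι'' => h.rTensor A x) (LinearMap.ext hgf)

variable {T T' : Type*} [Ring T] [Ring T'] {α : A →+* T} {α' : A →+* T'} {ψ : S →+* T}
  {ψ' : S' →+* T'} {f : S →+* S'} {g : T →+* T'}

theorem leftExtensionMap_map (h : ∀ r, ψ (ι r) = α (algebraMap R A r))
    (h' : ∀ r, ψ' (ι' r) = α' (algebraMap R A r)) (hf : ∀ r, f (ι r) = ι' r)
    (hg : ∀ a, g (α a) = α' a) (hψ : ∀ s, ψ' (f s) = g (ψ s)) (x : A ⊗[R] LeftMul ι) :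
    leftExtensionMap h' ((LeftMul.map f hf).lTensor A x) = g (leftExtensionMap h x) := by
  induction x using TensorProduct.induction_on with
  | zero => simp only [map_zero]
  | tmul a s =>
    exact (congrArg₂ (· * ·) (hg a).symm (hψ s)).trans (map_mul g (α a) (ψ s)).symm
  | add x y hx hy => simp only [map_add, hx, hy]

theorem rightExtensionMap_map (h : ∀ r, ψ (ι r) = α (algebraMap R A r))
    (h' : ∀ r, ψ' (ι' r) = α' (algebraMap R A r)) (hf : ∀ r, f (ι r) = ι' r)
    (hg : ∀ a, g (α a) = α' a) (hψ : ∀ s, ψ' (f s) = g (ψ s)) (x : RightMul ι ⊗[R] A) :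
    rightExtensionMap h' ((RightMul.map f hf).rTensor A x) = g (rightExtensionMap h x) := by
  induction x using TensorProduct.induction_on with
  | zero => simp only [map_zero]
  | tmul s a =>
    exact (congrArg₂ (· * ·) (hψ s) (hg a).symm).trans (map_mul g (ψ s) (α a)).symm
  | add x y hx hy => simp only [map_add, hx, hy]

end MapMul

section Colimit

variable {R A : Type*} [CommRing R] [CommRing A] [Algebra R A]
  {S T : ℕ → Type*} [∀ m, Ring (S m)] [∀ m, Ring (T m)] {S' T' : Type*} [Ring S'] [Ring T']
  {ι : ∀ m, R →+* S m} {α : ∀ m, A →+* T m} {ψ : ∀ m, S m →+* T m}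
  {ι' : R →+* S'} {α' : A →+* T'} {ψ' : S' →+* T'}
  {s : ∀ m m', m ≤ m' → S m →+* S m'} {t : ∀ m m', m ≤ m' → T m →+* T m'}
  {σ : ∀ m, S m →+* S'} {τ : ∀ m, T m →+* T'}

/-- Every tensor comes from a finite stage. If its image in `T'` vanishes, it vanishes at a later
stage, where injectivity of the level map kills the tensor. Surjectivity is read off at a finite
stage. -/
theorem isLeftExtensionIso_of_colimit (h' : ∀ r, ψ' (ι' r) = α' (algebraMap R A r))
    (h : ∀ m r, ψ m (ι m r) = α m (algebraMap R A r))
    (hs : ∀ m m' hm r, s m m' hm (ι m r) = ι m' r) (ht : ∀ m m' hm a, t m m' hm (α m a) = α m' a)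
    (hσ : ∀ m r, σ m (ι m r) = ι' r) (hτ : ∀ m a, τ m (α m a) = α' a)
    (hψ : ∀ m m' hm z, ψ m' (s m m' hm z) = t m m' hm (ψ m z))
    (hψ' : ∀ m z, ψ' (σ m z) = τ m (ψ m z))
    (hσs : ∀ m m' hm z, σ m' (s m m' hm z) = σ m z)
    (hσ_surj : ∀ z, ∃ m x, σ m x = z) (hτ_surj : ∀ z, ∃ m x, τ m x = z)
    (hτ_zero : ∀ m x, τ m x = 0 → ∃ m' hm, t m m' hm x = 0)
    (hiso : ∀ m, IsLeftExtensionIso (ι m) (α m) (ψ m)) : IsLeftExtensionIso ι' α' ψ' := by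
  have hb := fun m => (isLeftExtensionIso_iff (h m)).1 (hiso m)
  have hx : ∀ x : A ⊗[R] LeftMul ι', ∃ m y, (LeftMul.map (σ m) (hσ m)).lTensor A y = x := by
    intro x
    induction x using TensorProduct.induction_on with
    | zero => exact ⟨0, 0, map_zero _⟩
    | tmul a z =>
      obtain ⟨m, y, rfl⟩ := hσ_surj z
      exact ⟨m, a ⊗ₜ (show LeftMul (ι m) from y), rfl⟩
    | add x y hx hy =>
      obtain ⟨m, x, rfl⟩ := hx
      obtain ⟨m', y, rfl⟩ := hy
      refine ⟨max m m', (LeftMul.map (s m _ (le_max_left m m')) (hs _ _ _)).lTensor A x +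
        (LeftMul.map (s m' _ (le_max_right m m')) (hs _ _ _)).lTensor A y, ?_⟩
      rw [map_add, LeftMul.lTensor_map_map _ _ (hσ m) (hσs _ _ _),
        LeftMul.lTensor_map_map _ _ (hσ m') (hσs _ _ _)]
  rw [isLeftExtensionIso_iff h']
  refine ⟨(injective_iff_map_eq_zero _).2 fun x hx0 => ?_, fun z => ?_⟩
  · obtain ⟨m, y, rfl⟩ := hx x
    rw [leftExtensionMap_map (h m) h' (hσ m) (hτ m) (hψ' m)] at hx0
    obtain ⟨m', hm, h0⟩ := hτ_zero m _ hx0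
    rw [← leftExtensionMap_map (h m) (h m') (hs m m' hm) (ht m m' hm) (hψ m m' hm)] at h0
    rw [← LeftMul.lTensor_map_map (hs m m' hm) (hσ m') (hσ m) (hσs m m' hm),
      (injective_iff_map_eq_zero _).1 (hb m').1 _ h0, map_zero]
  · obtain ⟨m, x, rfl⟩ := hτ_surj z
    obtain ⟨y, rfl⟩ := (hb m).2 x
    exact ⟨_, leftExtensionMap_map (h m) h' (hσ m) (hτ m) (hψ' m) y⟩

/-- The same finite-stage argument with the tensor factors exchanged. -/
theorem isRightExtensionIso_of_colimit (h' : ∀ r, ψ' (ι' r) = α' (algebraMap R A r))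
    (h : ∀ m r, ψ m (ι m r) = α m (algebraMap R A r))
    (hs : ∀ m m' hm r, s m m' hm (ι m r) = ι m' r) (ht : ∀ m m' hm a, t m m' hm (α m a) = α m' a)
    (hσ : ∀ m r, σ m (ι m r) = ι' r) (hτ : ∀ m a, τ m (α m a) = α' a)
    (hψ : ∀ m m' hm z, ψ m' (s m m' hm z) = t m m' hm (ψ m z))
    (hψ' : ∀ m z, ψ' (σ m z) = τ m (ψ m z))
    (hσs : ∀ m m' hm z, σ m' (s m m' hm z) = σ m z)
    (hσ_surj : ∀ z, ∃ m x, σ m x = z) (hτ_surj : ∀ z, ∃ m x, τ m x = z)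
    (hτ_zero : ∀ m x, τ m x = 0 → ∃ m' hm, t m m' hm x = 0)
    (hiso : ∀ m, IsRightExtensionIso (ι m) (α m) (ψ m)) : IsRightExtensionIso ι' α' ψ' := by
  have hb := fun m => (isRightExtensionIso_iff (h m)).1 (hiso m)
  have hx : ∀ x : RightMul ι' ⊗[R] A, ∃ m y, (RightMul.map (σ m) (hσ m)).rTensor A y = x := by
    intro x
    induction x using TensorProduct.induction_on with
    | zero => exact ⟨0, 0, map_zero _⟩
    | tmul z a =>
      obtain ⟨m, y, rfl⟩ := hσ_surj z
      exact ⟨m, (show RightMul (ι m) from y) ⊗ₜ a, rfl⟩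
    | add x y hx hy =>
      obtain ⟨m, x, rfl⟩ := hx
      obtain ⟨m', y, rfl⟩ := hy
      refine ⟨max m m', (RightMul.map (s m _ (le_max_left m m')) (hs _ _ _)).rTensor A x +
        (RightMul.map (s m' _ (le_max_right m m')) (hs _ _ _)).rTensor A y, ?_⟩
      rw [map_add, RightMul.rTensor_map_map _ _ (hσ m) (hσs _ _ _),
        RightMul.rTensor_map_map _ _ (hσ m') (hσs _ _ _)]
  rw [isRightExtensionIso_iff h']
  refine ⟨(injective_iff_map_eq_zero _).2 fun x hx0 => ?_, fun z => ?_⟩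
  · obtain ⟨m, y, rfl⟩ := hx x
    rw [rightExtensionMap_map (h m) h' (hσ m) (hτ m) (hψ' m)] at hx0
    obtain ⟨m', hm, h0⟩ := hτ_zero m _ hx0
    rw [← rightExtensionMap_map (h m) (h m') (hs m m' hm) (ht m m' hm) (hψ m m' hm)] at h0
    rw [← RightMul.rTensor_map_map (hs m m' hm) (hσ m') (hσ m) (hσs m m' hm),
      (injective_iff_map_eq_zero _).1 (hb m').1 _ h0, map_zero]
  · obtain ⟨m, x, rfl⟩ := hτ_surj z
    obtain ⟨y, rfl⟩ := (hb m).2 x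
    exact ⟨_, rightExtensionMap_map (h m) h' (hσ m) (hτ m) (hψ' m) y⟩

end Colimit

/-! ### Homomorphisms between the direct limits -/

section DagMap

theorem weakCompletionMap_toWeakCompletion {V B C : Type*} [CommRing V] (π : V) [Ring B]
    [Algebra V B] [Ring C] [Algebra V C] (f : B →ₐ[V] C) (b : B) :
    weakCompletionMap π f (toWeakCompletion π B b) = toWeakCompletion π C (f b) := rfl

theorem weakCompletionMap_inclusion {V E F : Type*} [CommRing V] (π : V) [Ring E] [Algebra V E]
    [Ring F] [Algebra V F] {D D' : Subalgebra V E} {G G' : Subalgebra V F} (h : D ≤ D')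
    (h' : G ≤ G') {ψ : D →ₐ[V] G} {ψ' : D' →ₐ[V] G'}
    (hψ : ∀ P, ψ' (Subalgebra.inclusion h P) = Subalgebra.inclusion h' (ψ P))
    (z : WeakCompletion π D) :
    weakCompletionMap π ψ' (weakCompletionMap π (Subalgebra.inclusion h) z) =
      weakCompletionMap π (Subalgebra.inclusion h') (weakCompletionMap π ψ z) := by
  rw [weakCompletionMap_comp, weakCompletionMap_comp]
  exact congrArg (fun f => weakCompletionMap π f z) (AlgHom.ext hψ)

variable {V : Type*} [CommRing V] (π : V) (p : ℕ) [Fact p.Prime] {R A : Type*} [CommRing R]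
  [Algebra V R] [CommRing A] [Algebra V A] {n n' : ℕ} {t : Fin n → R} {u : Fin n' → A}

theorem dagTransition_funToDagLevel {m m' : ℕ} (h : m ≤ m') (r : R) :
    dagTransition π p t m m' h (funToDagLevel π p t m r) = funToDagLevel π p t m' r :=
  (weakCompletionMap_toWeakCompletion π _ (funToDiffOp V p m t r)).trans
    (congrArg (toWeakCompletion π (diffOp V p m' t)) (Subtype.ext rfl))

theorem dagOfLevel_dagTransition {m m' : ℕ} (h : m ≤ m') (z : DagDiffOpLevel π p t m) :
    dagOfLevel π p t m' (dagTransition π p t m m' h z) = dagOfLevel π p t m z :=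
  DirectLimit.mk_apply m m' z h

theorem dagOfLevel_funToDagLevel (m : ℕ) (r : R) :
    dagOfLevel π p t m (funToDagLevel π p t m r) = funToDag π p t r := by
  rw [← dagTransition_funToDagLevel π p (Nat.zero_le m), dagOfLevel_dagTransition, funToDag,
    RingHom.comp_apply]

theorem exists_dagOfLevel_eq (z : DagDiffOp π p t) : ∃ m x, dagOfLevel π p t m x = z := by
  obtain ⟨m, x, rfl⟩ := DirectLimit.exists_eq_mk _ z
  exact ⟨m, x, rfl⟩

theorem exists_dagTransition_eq_zero {m : ℕ} {x : DagDiffOpLevel π p t m}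
    (h : dagOfLevel π p t m x = 0) : ∃ m' hm, dagTransition π p t m m' hm x = 0 := by
  rw [← map_zero (dagOfLevel π p t m)] at h
  obtain ⟨m', h1, h2, e⟩ := Quotient.exact h
  exact ⟨m', h1, e.trans (map_zero (dagTransition π p t m m' h2))⟩

variable {π p} in
theorem dagLevelMap_dagTransition {m m' : ℕ} {ψ : diffOp V p m t →ₐ[V] diffOp V p m u}
    {ψ' : diffOp V p m' t →ₐ[V] diffOp V p m' u} (h : m ≤ m')
    (hψ : ∀ P, ψ' (Subalgebra.inclusion (diffOp_mono p t (Fact.out : p.Prime).pos h) P) =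
      Subalgebra.inclusion (diffOp_mono p u (Fact.out : p.Prime).pos h) (ψ P))
    (z : DagDiffOpLevel π p t m) :
    dagLevelMap π p ψ' (dagTransition π p t m m' h z) =
      dagTransition π p u m m' h (dagLevelMap π p ψ z) :=
  weakCompletionMap_inclusion π (diffOp_mono p t (Fact.out : p.Prime).pos h)
    (diffOp_mono p u (Fact.out : p.Prime).pos h) hψ z

variable {π p} in
/-- The map `D^† → D'^†` induced by compatible maps `D^(m) → D'^(m)`. -/
noncomputable def dagMap (ψ : ∀ m, diffOp V p m t →ₐ[V] diffOp V p m u)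
    (hψ : ∀ m m' h z, dagLevelMap π p (ψ m') (dagTransition π p t m m' h z) =
      dagTransition π p u m m' h (dagLevelMap π p (ψ m) z)) :
    DagDiffOp π p t →+* DagDiffOp π p u where
  toFun := DirectLimit.map (dagTransition π p t) (dagTransition π p u)
    (fun m => dagLevelMap π p (ψ m)) fun m m' h z => (hψ m m' h z).symm
  map_one' := by
    rw [DirectLimit.one_def 0]
    exact congrArg (fun x => (⟦⟨0, x⟩⟧ : DagDiffOp π p u)) (map_one (dagLevelMap π p (ψ 0)))
      |>.trans (DirectLimit.one_def 0).symm
  map_zero' := by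
    rw [DirectLimit.zero_def 0]
    exact congrArg (fun x => (⟦⟨0, x⟩⟧ : DagDiffOp π p u)) (map_zero (dagLevelMap π p (ψ 0)))
      |>.trans (DirectLimit.zero_def 0).symm
  map_mul' x y := by
    induction x, y using DirectLimit.induction₂ with
    | ih m x y =>
      rw [DirectLimit.mul_def]
      exact congrArg (fun x => (⟦⟨m, x⟩⟧ : DagDiffOp π p u)) (map_mul (dagLevelMap π p (ψ m)) x y)
        |>.trans (DirectLimit.mul_def m _ _).symm
  map_add' x y := by
    induction x, y using DirectLimit.induction₂ with
    | ih m x y =>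
      rw [DirectLimit.add_def]
      exact congrArg (fun x => (⟦⟨m, x⟩⟧ : DagDiffOp π p u)) (map_add (dagLevelMap π p (ψ m)) x y)
        |>.trans (DirectLimit.add_def m _ _).symm

variable {π p} in
theorem dagMap_dagOfLevel (ψ : ∀ m, diffOp V p m t →ₐ[V] diffOp V p m u)
    (hψ : ∀ m m' h z, dagLevelMap π p (ψ m') (dagTransition π p t m m' h z) =
      dagTransition π p u m m' h (dagLevelMap π p (ψ m) z)) (m : ℕ) (z : DagDiffOpLevel π p t m) :
    dagMap ψ hψ (dagOfLevel π p t m z) = dagOfLevel π p u m (dagLevelMap π p (ψ m) z) := rfl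

end DagMap

/-! ### Invertible integers, projectivity of finite étale algebras, and the theorem -/

/-- A natural number prime to the residue characteristic of a local ring is invertible. -/
theorem IsLocalRing.isUnit_natCast_of_not_dvd {V : Type*} [CommRing V] [IsLocalRing V] (p : ℕ)
    [CharP (IsLocalRing.ResidueField V) p] {u : ℕ} (hu : ¬ p ∣ u) : IsUnit (u : V) := by
  rw [← IsLocalRing.residue_ne_zero_iff_isUnit, map_natCast]
  exact fun h => hu ((CharP.cast_eq_zero_iff _ p u).1 h)

/-- A finite étale algebra is a projective module. -/
theorem Algebra.Etale.projective_of_finite (R A : Type*) [CommRing R] [CommRing A] [Algebra R A]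
    [Module.Finite R A] [Algebra.Etale R A] : Module.Projective R A := by
  have := Module.FinitePresentation.of_finite_of_finitePresentation (R := R) (S := A)
  have : Module.Flat R A := inferInstance
  exact Module.Flat.projective_of_finitePresentation

theorem mainTheorem9
    {V : Type*} [CommRing V] [IsDomain V] [IsDiscreteValuationRing V]
    [IsAdicComplete (IsLocalRing.maximalIdeal V) V] [CharZero V]
    (p : ℕ) [Fact p.Prime] [CharP (IsLocalRing.ResidueField V) p]
    [PerfectField (IsLocalRing.ResidueField V)]
    (π : V) (hπ : Irreducible π) (n : ℕ)
    {A : Type*} [CommRing A] [Algebra V A] [Algebra (DagPolynomial π n) A]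
    [IsScalarTower V (DagPolynomial π n) A]
    [Module.Finite (DagPolynomial π n) A] [Algebra.Etale (DagPolynomial π n) A] :
    (∀ m : ℕ, ∃! ψ : diffOp V p m (dagCoord π n) →ₐ[V] diffOp V p m (etaleCoord π n A),
      ExtendsOperators ψ) ∧
    ∀ ψ : (m : ℕ) → (diffOp V p m (dagCoord π n) →ₐ[V] diffOp V p m (etaleCoord π n A)),
      (∀ m, ExtendsOperators (ψ m)) →
      (∀ m,
        IsLeftExtensionIso (funToDagLevel π p (dagCoord π n) m)
          (funToDagLevel π p (etaleCoord π n A) m) (dagLevelMap π p (ψ m)) ∧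
        IsRightExtensionIso (funToDagLevel π p (dagCoord π n) m)
          (funToDagLevel π p (etaleCoord π n A) m) (dagLevelMap π p (ψ m))) ∧
      ∃ Ψ : DagDiffOp π p (dagCoord π n) →+* DagDiffOp π p (etaleCoord π n A),
        (∀ m z, Ψ (dagOfLevel π p (dagCoord π n) m z) =
          dagOfLevel π p (etaleCoord π n A) m (dagLevelMap π p (ψ m) z)) ∧
        IsLeftExtensionIso (funToDag π p (dagCoord π n)) (funToDag π p (etaleCoord π n A)) Ψ ∧
        IsRightExtensionIso (funToDag π p (dagCoord π n)) (funToDag π p (etaleCoord π n A)) Ψ := by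
  have hp : ∀ u : ℕ, ¬ p ∣ u → IsUnit (u : V) := fun u =>
    IsLocalRing.isUnit_natCast_of_not_dvd p
  have := Algebra.Etale.projective_of_finite (DagPolynomial π n) A
  have := DagPolynomial.isAddTorsionFree n hπ
  have := DagPolynomial.isAddTorsionFree_of_projective n (π := π) (A := A) hπ
  obtain ⟨η, η', hη, hη', hηη'⟩ := DagPolynomial.exists_hasseCoordinates n (A := A) hπ
  have hu : ∀ i, etaleCoord π n A i = algebraMap (DagPolynomial π n) A (dagCoord π n i) :=
    fun _ => rfl
  refine ⟨fun m => existsUnique_extendsOperators hp hη hη' hu hηη', fun ψ hψ => ?_⟩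
  have hiso := fun m => (hψ m).isExtensionIso π hp hη hη' hu hηη'
  -- Each level `m` operator has two images at level `m'`, obtained by including before or after
  -- extending. They agree on the image of the base ring, hence coincide.
  have hcompat : ∀ m m' h z,
      dagLevelMap π p (ψ m') (dagTransition π p (dagCoord π n) m m' h z) =
        dagTransition π p (etaleCoord π n A) m m' h (dagLevelMap π p (ψ m) z) := by
    refine fun m m' h => dagLevelMap_dagTransition h fun P =>
      hη'.eq_of_algebraMap hp hu _ _ fun r => ?_
    exact (hψ m' _ r).trans (hψ m P r).symm
  have hlevel : ∀ m r, dagLevelMap π p (ψ m) (funToDagLevel π p (dagCoord π n) m r) =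
      funToDagLevel π p (etaleCoord π n A) m (algebraMap _ A r) := fun m r =>
    congrArg (toWeakCompletion π (diffOp V p m (etaleCoord π n A)))
      ((hψ m).map_funToDiffOp hp hη' hu r)
  have hdag : ∀ r, dagMap ψ hcompat (funToDag π p (dagCoord π n) r) =
      funToDag π p (etaleCoord π n A) (algebraMap _ A r) := fun r =>
    congrArg (dagOfLevel π p (etaleCoord π n A) 0) (hlevel 0 r)
  refine ⟨hiso, dagMap ψ hcompat, dagMap_dagOfLevel ψ hcompat, ?_, ?_⟩
  · exact isLeftExtensionIso_of_colimit
      (s := fun m m' h => (dagTransition π p (dagCoord π n) m m' h).toRingHom)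
      (t := fun m m' h => (dagTransition π p (etaleCoord π n A) m m' h).toRingHom)
      (σ := dagOfLevel π p (dagCoord π n)) (τ := dagOfLevel π p (etaleCoord π n A))
      hdag hlevel (fun _ _ => dagTransition_funToDagLevel π p)
      (fun _ _ => dagTransition_funToDagLevel π p) (dagOfLevel_funToDagLevel π p)
      (dagOfLevel_funToDagLevel π p) hcompat (dagMap_dagOfLevel ψ hcompat)
      (fun _ _ => dagOfLevel_dagTransition π p) (exists_dagOfLevel_eq π p)
      (exists_dagOfLevel_eq π p) (fun _ _ => exists_dagTransition_eq_zero π p)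
      fun m => (hiso m).1
  · exact isRightExtensionIso_of_colimit
      (s := fun m m' h => (dagTransition π p (dagCoord π n) m m' h).toRingHom)
      (t := fun m m' h => (dagTransition π p (etaleCoord π n A) m m' h).toRingHom)
      (σ := dagOfLevel π p (dagCoord π n)) (τ := dagOfLevel π p (etaleCoord π n A))
      hdag hlevel (fun _ _ => dagTransition_funToDagLevel π p)
      (fun _ _ => dagTransition_funToDagLevel π p) (dagOfLevel_funToDagLevel π p)
      (dagOfLevel_funToDagLevel π p) hcompat (dagMap_dagOfLevel ψ hcompat)
      (fun _ _ => dagOfLevel_dagTransition π p) (exists_dagOfLevel_eq π p)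
      (exists_dagOfLevel_eq π p) (fun _ _ => exists_dagTransition_eq_zero π p)
      fun m => (hiso m).2
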